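/- **Definitions.** A *Grassmannian forest* with $n\ge 0$ boundary vertices is a finite acyclic graph $F$ embedded in a closed disk, with $n$ boundary vertices $b_1,\dots,b_n$ of degree $1$ on the boundary circle, labelled in clockwise order, and all other vertices, called *internal*, in the interior of the disk, such that every internal vertex is connected to the boundary by a path, no vertex has degree $2$, and each internal vertex $v$ carries an integer *helicity* $h(v)$: $h(v)\in\{0,1\}$ if $v$ is a boundary leaf (an internal vertex of degree $1$ adjacent to a boundary vertex), and $1\le h(v)\le\deg(v)-1$ otherwise. Grassmannian forests are considered up to orientation-preserving homeomorphisms of the disk that fix the labels of the boundary vertices. A *Grassmannian tree* is a connected (nonempty) Grassmannian forest. An internal vertex $v$ is *white* if $h(v)=1$, *black* if $h(v)=\deg(v)-1$, and *generic* otherwise. A Grassmannian forest is *contracted* if no two adjacent internal vertices are both white or both black (equivalently, it is maximal with respect to contracting edges between two adjacent internal white vertices, or two adjacent internal black vertices, into a single vertex of the same color). $F$ has *type* $(k,n)$ if $$k=\sum_{v\ \text{internal}}\Bigl(h(v)-\frac{\deg(v)}2\Bigr)+\frac n2 .$$ For an internal vertex put $m(v)=2\deg(v)-4$ if $v$ is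 generic and $m(v)=\deg(v)-1$ otherwise. The *mom-dimension* of a Grassmannian tree $T$ with $n$ boundary vertices is $n-1$ if $n\le 2$, and $1+\sum_{v\ \text{internal}}(m(v)-1)$ if $n\ge 3$; the mom-dimension of a Grassmannian forest is the sum of the mom-dimensions of the trees in it. For a power series $f$ in $x$ with zero constant term and invertible coefficient of $x$, $f^{\langle -1\rangle}$ denotes its compositional inverse with respect to $x$. **Theorem.** Let $$C(x,y,q)=\frac{x\bigl(1-x(1+y)q^2-x^2yq^2(1+q-q^2)-x^4y^2q^5(1+q)\bigr)}{(1+xq)(1+xyq)(1-xq^2)(1-xyq^2)},$$ $$\mathcal G_{\mathrm{tree}}(x,y,q)=x\bigl(1+y+yq\,C^{\langle -1\rangle}(x,y,q)\bigr),$$ regarded as power series in $x$ over $\mathbb Q[y,q]$. For all integers $n,k,r\ge 0$, the number of contracted Grassmannian trees of type $(k,n)$ with mom-dimension $r$ is finite and equal to $[x^ny^kq^r]\,\mathcal G_{\mathrm{tree}}(x,y,q)$. The number of contracted Grassmannian forests of type $(k,n)$ with mom-dimension $r$ is finite and equal to $[x^ny^kq^r]\,\mathcal G_{\mathrm{forest}}(x,y,q)$,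 where $\mathcal G_{\mathrm{forest}}$ is the power series determined by $$x\,\mathcal G_{\mathrm{forest}}(x,y,q)=\left(\frac{x}{1+\mathcal G_{\mathrm{tree}}(x,y,q)}\right)^{\langle -1\rangle},$$ or, equivalently, by $$[x^n]\,\mathcal G_{\mathrm{forest}}(x,y,q)=\frac1{n+1}[x^n]\bigl(1+\mathcal G_{\mathrm{tree}}(x,y,q)\bigr)^{n+1}\qquad (n\ge 0).$$ -/

import Mathlib

open PowerSeries

noncomputable section

/-- The data of an acyclic graph with `n` boundary vertices on the boundary circle of a closed disk,
with a helicity on each internal vertex and a rotation system, i.e. the clockwise cyclic order of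
the edges around every vertex. That the rotation system comes from an embedding in the disk is the
condition `PreForest.IsPlanar` below; the remaining conditions are in `GrassmannianForest`.

The vertices are the boundary vertices `Sum.inl 0, …, Sum.inl (n - 1)`, in clockwise order on the
boundary circle, and the internal vertices `Sum.inr v`. (An acyclic graph has no loops or multiple
edges, so a simple graph records all of it. Boundary vertices will have degree one and need no
cyclic order.) -/
structure PreForest (n : ℕ) where
  /-- the number of internal vertices -/
  numInt : ℕ
  /-- the underlying graph -/
  graph : SimpleGraph (Fin n ⊕ Fin numInt)
  /-- `next v u` is the neighbour of the internal vertex `v` that follows its neighbour `u` in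
  clockwise order around `v` (a value without meaning if `u` is not a neighbour of `v`) -/
  next : Fin numInt → Fin n ⊕ Fin numInt → Fin n ⊕ Fin numInt
  /-- `hel v` is the helicity of the internal vertex `v` -/
  hel : Fin numInt → ℕ
  acyclic : graph.IsAcyclic
  next_adj : ∀ v u, graph.Adj (Sum.inr v) u → graph.Adj (Sum.inr v) (next v u)
  /-- the neighbours of `v` form a single cycle under `next v` -/
  next_cycle : ∀ v u w, graph.Adj (Sum.inr v) u → graph.Adj (Sum.inr v) w →
    ∃ k : ℕ, (next v)^[k] u = w

namespace PreForest

variable {n : ℕ}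

/-- The degree of a vertex. -/
def deg (F : PreForest n) (v : Fin n ⊕ Fin F.numInt) : ℕ :=
  (F.graph.neighborSet v).ncard

/-- The successor relation on directed edges whose classes are the regions into which the forest
divides the disk.  The boundary of a region is followed with the region on the left: on arrival at
an internal vertex take the next edge in clockwise order; on arrival at a boundary vertex follow
the boundary circle anticlockwise to the adjacent boundary vertex, and leave along its edge. -/
inductive FaceStep (F : PreForest n) : F.graph.Dart → F.graph.Dart → Prop
  | turn (d d' : F.graph.Dart) (v : Fin F.numInt) (hd : d.snd = Sum.inr v)
      (hd' : d'.fst = Sum.inr v) (h : d'.snd = F.next v d.fst) : FaceStep F d d'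
  | arc (d d' : F.graph.Dart) (i : Fin n) (hd : d.snd = Sum.inl (finRotate n i))
      (hd' : d'.fst = Sum.inl i) : FaceStep F d d'

/-- The number of regions of the disk. -/
def numRegions (F : PreForest n) : ℕ :=
  Nat.card (Quot F.FaceStep)

/-- Euler's formula `V + F = E + 2` for the map on the sphere that consists of the forest and the
boundary circle of the disk: it has `n + numInt` vertices; its edges are those of the forest and
the `n` arcs of the circle; its faces are the regions of the disk and the outside of the disk.
If every internal vertex is connected to the boundary, this map is connected, and the formula says
that its genus is zero, i.e. that the rotation system comes from an embedding in the disk with the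
boundary vertices in clockwise order on the boundary circle.
(For `n = 0` the forest is empty and there is no condition.) -/
def IsPlanar (F : PreForest n) : Prop :=
  n = 0 ∨ (n + F.numInt) + (F.numRegions + 1) = (F.graph.edgeSet.ncard + n) + 2

/-- A boundary leaf: an internal vertex of degree one that is adjacent to a boundary vertex. -/
def IsBoundaryLeaf (F : PreForest n) (v : Fin F.numInt) : Prop :=
  F.deg (Sum.inr v) = 1 ∧ ∃ i : Fin n, F.graph.Adj (Sum.inr v) (Sum.inl i)

/-- A white vertex: one of helicity `1`. -/
def IsWhite (F : PreForest n) (v : Fin F.numInt) : Prop :=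
  F.hel v = 1

/-- A black vertex: one of helicity `deg v - 1`. -/
def IsBlack (F : PreForest n) (v : Fin F.numInt) : Prop :=
  F.hel v + 1 = F.deg (Sum.inr v)

/-- A generic vertex: one that is neither white nor black. -/
def IsGeneric (F : PreForest n) (v : Fin F.numInt) : Prop :=
  ¬ F.IsWhite v ∧ ¬ F.IsBlack v

end PreForest

/-- A Grassmannian forest with `n` boundary vertices (an acyclic Grassmannian graph embedded in a
disk), with a numbering of its internal vertices. -/
structure GrassmannianForest (n : ℕ) extends PreForest n where
  planar : toPreForest.IsPlanar
  /-- boundary vertices have degree one -/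
  deg_boundary : ∀ i : Fin n, toPreForest.deg (Sum.inl i) = 1
  /-- internal vertices are connected by a path to the boundary -/
  reachable_boundary : ∀ v, ∃ i : Fin n, graph.Reachable (Sum.inr v) (Sum.inl i)
  /-- there are no vertices of degree two -/
  deg_ne_two : ∀ v, toPreForest.deg (Sum.inr v) ≠ 2
  /-- the helicity of a boundary leaf is `0` or `1` -/
  hel_leaf : ∀ v, toPreForest.IsBoundaryLeaf v → hel v = 0 ∨ hel v = 1
  /-- the helicity of every other internal vertex lies between `1` and `deg v - 1` -/
  hel_internal : ∀ v, ¬ toPreForest.IsBoundaryLeaf v →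
    1 ≤ hel v ∧ hel v + 1 ≤ toPreForest.deg (Sum.inr v)

namespace GrassmannianForest

variable {n : ℕ}

/-- Two Grassmannian forests are the same (up to orientation preserving homeomorphisms of the disk
which fix the labels of the boundary vertices) if they differ by a bijection of the internal
vertices that respects adjacency, the cyclic orders around the vertices and the helicities. -/
def Iso (F F' : GrassmannianForest n) : Prop :=
  ∃ e : Fin F.numInt ≃ Fin F'.numInt,
    (∀ u w, F'.graph.Adj (Sum.map id e u) (Sum.map id e w) ↔ F.graph.Adj u w) ∧
    (∀ v u, F.graph.Adj (Sum.inr v) u →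
      F'.next (e v) (Sum.map id e u) = Sum.map id e (F.next v u)) ∧
    (∀ v, F'.hel (e v) = F.hel v)

theorem Iso.refl (F : GrassmannianForest n) : Iso F F :=
  ⟨Equiv.refl _, by simp, by simp, by simp⟩

theorem Iso.symm {F F' : GrassmannianForest n} (h : Iso F F') : Iso F' F := by
  obtain ⟨e, h1, h2, h3⟩ := h
  have key : ∀ u : Fin n ⊕ Fin F'.numInt, Sum.map id e (Sum.map id e.symm u) = u := by
    rintro (u | u) <;> simp
  have key' : ∀ u : Fin n ⊕ Fin F.numInt, Sum.map id e.symm (Sum.map id e u) = u := by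
    rintro (u | u) <;> simp
  refine ⟨e.symm, fun u w => ?_, fun v u hv => ?_, fun v => ?_⟩
  · rw [← h1, key, key]
  · have hadj : F.graph.Adj (Sum.inr (e.symm v)) (Sum.map id e.symm u) := by
      rw [← h1, key]; simpa using hv
    have := h2 _ _ hadj
    rw [key, Equiv.apply_symm_apply] at this
    rw [this, key']
  · rw [← h3, Equiv.apply_symm_apply]

theorem Iso.trans {F F' F'' : GrassmannianForest n} (h : Iso F F') (h' : Iso F' F'') :
    Iso F F'' := by
  obtain ⟨e, h1, h2, h3⟩ := h
  obtain ⟨e', h1', h2', h3'⟩ := h'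
  have key : ∀ u : Fin n ⊕ Fin F.numInt,
      Sum.map id (e.trans e') u = Sum.map id e' (Sum.map id e u) := by
    rintro (u | u) <;> simp
  refine ⟨e.trans e', fun u w => ?_, fun v u hv => ?_, fun v => ?_⟩
  · rw [key, key, h1', h1]
  · have hadj : F'.graph.Adj (Sum.inr (e v)) (Sum.map id e u) :=
      (h1 (Sum.inr v) u).2 hv
    rw [key, key, ← h2 v u hv, ← h2' _ _ hadj, Equiv.trans_apply]
  · rw [Equiv.trans_apply, h3', h3]

instance isoSetoid (n : ℕ) : Setoid (GrassmannianForest n) where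
  r := Iso
  iseqv := ⟨Iso.refl, Iso.symm, Iso.trans⟩

/-- A Grassmannian tree is a connected Grassmannian forest. -/
def IsTree (F : GrassmannianForest n) : Prop :=
  F.graph.Connected

/-- A Grassmannian forest is contracted if no vertex contraction move can be applied to it, that is,
if it is maximal in the order generated by these moves. Such a move can be applied to any two
adjacent internal vertices which are both white or both black, and merges them into one vertex
of the same colour (so that it lowers the number of vertices). -/
def IsContracted (F : GrassmannianForest n) : Prop :=
  ∀ v w, F.graph.Adj (Sum.inr v) (Sum.inr w) →
    ¬ (F.IsWhite v ∧ F.IsWhite w) ∧ ¬ (F.IsBlack v ∧ F.IsBlack w)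

/-- The helicity of a Grassmannian forest. -/
def helicity (F : GrassmannianForest n) : ℚ :=
  ∑ v : Fin F.numInt, ((F.hel v : ℚ) - (F.deg (Sum.inr v) : ℚ) / 2) + (n : ℚ) / 2

/-- The statistic `m(v)` on internal vertices. -/
def mdim (F : GrassmannianForest n) (v : Fin F.numInt) : ℤ :=
  open Classical in
  if F.IsGeneric v then 2 * (F.deg (Sum.inr v) : ℤ) - 4 else (F.deg (Sum.inr v) : ℤ) - 1

/-- The number of boundary vertices of the tree `c` of the forest `F`. -/
def numBoundary (F : GrassmannianForest n) (c : F.graph.ConnectedComponent) : ℕ :=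
  {i : Fin n | F.graph.connectedComponentMk (Sum.inl i) = c}.ncard

/-- The mom-dimension of the tree `c` of the forest `F`. -/
def treeMomDim (F : GrassmannianForest n) (c : F.graph.ConnectedComponent) : ℤ :=
  open Classical in
  if F.numBoundary c ≤ 2 then (F.numBoundary c : ℤ) - 1
  else 1 + ∑ v : Fin F.numInt with F.graph.connectedComponentMk (Sum.inr v) = c, (F.mdim v - 1)

/-- The mom-dimension of a Grassmannian forest (in particular, of a Grassmannian tree): the sum of
the mom-dimensions of its trees. -/
def momDim (F : GrassmannianForest n) : ℤ :=
  ∑ᶠ c : F.graph.ConnectedComponent, F.treeMomDim c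

/-- The contracted Grassmannian forests of type `(k, n)` with mom-dimension `r`. -/
def contractedForests (n k r : ℕ) : Set (Quotient (isoSetoid n)) :=
  {c | ∃ F : GrassmannianForest n, ⟦F⟧ = c ∧
    F.IsContracted ∧ F.helicity = k ∧ F.momDim = r}

/-- The contracted Grassmannian trees of type `(k, n)` with mom-dimension `r`. -/
def contractedTrees (n k r : ℕ) : Set (Quotient (isoSetoid n)) :=
  {c | ∃ F : GrassmannianForest n, ⟦F⟧ = c ∧
    F.IsTree ∧ F.IsContracted ∧ F.helicity = k ∧ F.momDim = r}

end GrassmannianForest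

namespace GrassmannianGF

/-- The coefficient ring `ℚ[y, q]`; the generating functions are power series in `x` over it. -/
abbrev CoeffRing : Type := MvPolynomial (Fin 2) ℚ

/-- The variable `x`. -/
abbrev x : CoeffRing⟦X⟧ := PowerSeries.X

/-- The variable `y`. -/
def y : CoeffRing⟦X⟧ := PowerSeries.C (MvPolynomial.X 0)

/-- The variable `q`. -/
def q : CoeffRing⟦X⟧ := PowerSeries.C (MvPolynomial.X 1)

/-- The coefficient `[xⁿ yᵏ qʳ] f`. -/
def coeffXYQ (n k r : ℕ) (f : CoeffRing⟦X⟧) : ℚ :=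
  MvPolynomial.coeff (Finsupp.single 0 k + Finsupp.single 1 r) (PowerSeries.coeff n f)

/-- The numerator of the rational function `C`. -/
def numC : CoeffRing⟦X⟧ :=
  x * (1 - x * (1 + y) * q ^ 2 - x ^ 2 * y * q ^ 2 * (1 + q - q ^ 2)
    - x ^ 4 * y ^ 2 * q ^ 5 * (1 + q))

/-- The denominator of the rational function `C`. -/
def denC : CoeffRing⟦X⟧ :=
  (1 + x * q) * (1 + x * y * q) * (1 - x * q ^ 2) * (1 - x * y * q ^ 2)

/-- The rational function `C = numC / denC`, as a power series in `x`. -/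
def serC : CoeffRing⟦X⟧ := numC * invOfUnit denC 1

theorem constantCoeff_denC : constantCoeff denC = 1 := by
  simp [denC]

theorem serC_mul_denC : serC * denC = numC := by
  rw [serC, mul_assoc, mul_comm (invOfUnit _ _), mul_invOfUnit _ _ (by simp [constantCoeff_denC]),
    mul_one]

theorem constantCoeff_serC : constantCoeff serC = 0 := by
  simp [serC, numC]

theorem isUnit_coeff_one_serC : IsUnit (coeff 1 serC) := by
  have : coeff 1 serC = 1 := by
    rw [serC, numC, mul_assoc, show (1 : ℕ) = 0 + 1 from rfl, coeff_succ_X_mul,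
      coeff_zero_eq_constantCoeff_apply]
    simp
  rw [this]
  exact isUnit_one

/-- The generating function of contracted Grassmannian trees, `x (1 + y + y q C^{⟨-1⟩})`, where
`C^{⟨-1⟩}` is the compositional inverse with respect to `x`. -/
def treeSeries : CoeffRing⟦X⟧ :=
  x * (1 + y + y * q * serC.substInvOfIsUnit isUnit_coeff_one_serC)

theorem constantCoeff_one_add_treeSeries : constantCoeff (1 + treeSeries) = 1 := by
  simp [treeSeries]

/-- The series `x / (1 + treeSeries)`. -/
def forestKernel : CoeffRing⟦X⟧ := x * invOfUnit (1 + treeSeries) 1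

theorem forestKernel_mul : forestKernel * (1 + treeSeries) = x := by
  rw [forestKernel, mul_assoc, mul_comm (invOfUnit _ _),
    mul_invOfUnit _ _ (by simp [constantCoeff_one_add_treeSeries]), mul_one]

theorem constantCoeff_forestKernel : constantCoeff forestKernel = 0 := by
  simp [forestKernel]

theorem isUnit_coeff_one_forestKernel : IsUnit (coeff 1 forestKernel) := by
  have : coeff 1 forestKernel = 1 := by
    rw [forestKernel, show (1 : ℕ) = 0 + 1 from rfl, coeff_succ_X_mul,
      coeff_zero_eq_constantCoeff_apply]
    simp
  rw [this]
  exact isUnit_one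

end GrassmannianGF

end

/-!
A Grassmannian forest is read along the boundary circle: its code (`Code`) lists, from the first
boundary vertex on, the planted tree that hangs from it and the rest of the forest, where a
planted tree is either a boundary vertex, preceded by the forest in the gap before it, or an
internal vertex with its helicity and its children in clockwise order. Three facts make this a
bijection between forests up to homeomorphism and codes. A forest which satisfies Euler's formula
has a code (`PreForest.exists_occ`): if two corners at the boundary circle lie in the same region,
then no path of the forest connects the boundary vertices between them with the others
(`PreForest.BoundaryDegOne.mem_Ioc_of_reachable`), as otherwise a connected combinatorial map
would have negative genus, against the bound `cycleCount_add_le` for permutations; so the gaps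
which are met on a walk around a tree are intervals of labels, and can be read in turn. Two
forests with the same code are isomorphic (`PreForest.exists_equiv_of_occ`). Every code is the
code of a forest (`Code.exists_preForest`), and this forest satisfies Euler's formula
(`PreForest.Occ.isPlanar`), by a count of the regions while the arcs of the boundary circle are
inserted one by one.

The degree conditions and the contractedness of a forest become the condition `Code.Good`, and the
type, the mom-dimension and the number of trees are sums over the code
(`GrassmannianForest.helicity_eq`, `GrassmannianForest.momDim_eq`,
`GrassmannianForest.isTree_iff`). In particular the special values of the mom-dimension for trees
with at most two boundary vertices agree with the general formula.

Let `P` and `F` be the generating functions of planted trees and of forests, where `x`, `y`, `q`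
mark boundary vertices, helicity and mom-dimension, and let `z` mark the trees. Decomposing codes
gives `F = 1 + x z (1 + y + y q P) F`, the summands `1 + y` being the two lollipops, and `P = x F
+ W + B + G`, where `W`, `B`, `G` collect the planted trees whose top is white, black and generic.
As no child of a white vertex is white, `W` is the sum of `q ^ (m - 1) * (P - W) ^ m` over `m ≥
2`, that is, `W (1 + q P) = q P ^ 2`; similarly for `B`, and `G` is a double geometric series in
`P`. Elimination gives `C(P) = x F` (`Code.treeGF_eq`). For `z = 0` only trees without forests in
their gaps remain, `F = 1`, and `P` is the inverse of `C`; this is the statement on trees. For `z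
= 1` substitution of `x F` for `x` in the series `T` of trees yields `1 + T(x F) = F`, so that `x
F` is the inverse of `x / (1 + T)`; the formula for its coefficients is Lagrange inversion
(`PowerSeries.lagrange`).
-/

/-! ### Counting the classes of a relation and the cycles of a permutation -/

section ClassCount

variable {X : Type*}

/-- The number of classes of the equivalence relation generated by `r`. -/
noncomputable def classCount (r : X → X → Prop) : ℕ := Nat.card (Quot r)

theorem classCount_congr {r s : X → X → Prop} (h : ∀ x y, r x y → Relation.EqvGen s x y)
    (h' : ∀ x y, s x y → Relation.EqvGen r x y) : classCount r = classCount s := by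
  refine Nat.card_congr ⟨Quot.lift (Quot.mk s) fun x y hxy => Quot.eqvGen_sound (h x y hxy),
    Quot.lift (Quot.mk r) fun x y hxy => Quot.eqvGen_sound (h' x y hxy), ?_, ?_⟩
  · rintro ⟨x⟩; rfl
  · rintro ⟨x⟩; rfl

theorem eqvGen_of_forall {r s : X → X → Prop} (h : ∀ x y, r x y → Relation.EqvGen s x y) {x y : X}
    (hxy : Relation.EqvGen r x y) : Relation.EqvGen s x y := by
  induction hxy with
  | rel _ _ h1 => exact h _ _ h1
  | refl _ => exact .refl _
  | symm _ _ _ ih => exact .symm _ _ ih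
  | trans _ _ _ _ _ ih1 ih2 => exact .trans _ _ _ ih1 ih2

/-- The relation `r` together with the pair `(a, b)`. -/
def addPair (r : X → X → Prop) (a b : X) (x y : X) : Prop := r x y ∨ (x = a ∧ y = b)

theorem classCount_addPair_of_eqvGen {r : X → X → Prop} {a b : X} (h : Relation.EqvGen r a b) :
    classCount (addPair r a b) = classCount r := by
  refine classCount_congr ?_ fun x y hxy => .rel _ _ (.inl hxy)
  rintro x y (hxy | ⟨rfl, rfl⟩)
  · exact .rel _ _ hxy
  · exact h

theorem classCount_addPair_of_not_eqvGen [Finite X] {r : X → X → Prop} {a b : X}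
    (h : ¬ Relation.EqvGen r a b) : classCount (addPair r a b) + 1 = classCount r := by
  classical
  have hab : Quot.mk r a ≠ Quot.mk r b := fun hab => h (Quot.eqvGen_exact hab)
  let f : X → {c : Quot r // c ≠ Quot.mk r b} := fun x =>
    if hx : Quot.mk r x = Quot.mk r b then ⟨Quot.mk r a, hab⟩ else ⟨Quot.mk r x, hx⟩
  have hf : ∀ x y, addPair r a b x y → f x = f y := by
    rintro x y (hxy | ⟨rfl, rfl⟩)
    · have : Quot.mk r x = Quot.mk r y := Quot.sound hxy
      simp only [f, this]
    · simp [f, hab]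
  have e : Quot (addPair r a b) ≃ {c : Quot r // c ≠ Quot.mk r b} :=
    { toFun := Quot.lift f hf
      invFun := fun c => Quot.lift (Quot.mk (addPair r a b))
        (fun x y hxy => Quot.sound (.inl hxy)) c.1
      left_inv := by
        rintro ⟨x⟩
        by_cases hx : Quot.mk r x = Quot.mk r b
        · have h1 : Quot.mk (addPair r a b) x = Quot.mk (addPair r a b) b :=
            Quot.eqvGen_sound (eqvGen_of_forall (fun _ _ h => .rel _ _ (.inl h))
              (Quot.eqvGen_exact hx))
          simp only [f, hx, dite_true]
          exact (Quot.sound (.inr ⟨rfl, rfl⟩)).trans h1.symm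
        · simp only [f, hx, dite_false]
      right_inv := by
        rintro ⟨⟨x⟩, hx⟩
        have hx' : Quot.mk r x ≠ Quot.mk r b := hx
        simp only [f, hx', dite_false] }
  have hc := Nat.card_congr e
  have : Fintype (Quot r) := Fintype.ofFinite _
  have h2 := Fintype.card_subtype_compl (fun c : Quot r => c = Quot.mk r b)
  rw [Fintype.card_subtype_eq] at h2
  have h3 : 0 < Fintype.card (Quot r) := Fintype.card_pos_iff.2 ⟨Quot.mk r a⟩
  simp only [classCount, hc, Nat.card_eq_fintype_card, ne_eq]
  omega

theorem classCount_le_one_of_forall [Finite X] {r : X → X → Prop}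
    (h : ∀ x y, Relation.EqvGen r x y) : classCount r ≤ 1 := by
  have : Subsingleton (Quot r) := ⟨by rintro ⟨x⟩ ⟨y⟩; exact Quot.eqvGen_sound (h x y)⟩
  exact Finite.card_le_one_iff_subsingleton.2 this

end ClassCount

section CycleCount

open Equiv.Perm

variable {X : Type*}

/-- The number of cycles of a permutation, fixed points included. -/
noncomputable def cycleCount (p : Equiv.Perm X) : ℕ := classCount fun x y => p x = y

theorem eqvGen_perm_iff {p : Equiv.Perm X} {x y : X} :
    Relation.EqvGen (fun x y => p x = y) x y ↔ SameCycle p x y := by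
  constructor
  · intro h
    induction h with
    | rel x y h => exact h ▸ (sameCycle_apply_right.2 (SameCycle.refl _ _))
    | refl _ => exact SameCycle.refl _ _
    | symm _ _ _ ih => exact ih.symm
    | trans _ _ _ _ _ ih1 ih2 => exact ih1.trans ih2
  · rintro ⟨i, rfl⟩
    induction i using Int.induction_on with
    | zero => exact .refl _
    | succ i ih =>
      refine .trans _ _ _ ih (.rel _ _ ?_)
      rw [add_comm, zpow_add, zpow_one, mul_apply]
    | pred i ih =>
      refine .trans _ _ _ ih (.symm _ _ (.rel _ _ ?_))
      rw [← mul_apply, ← zpow_one_add]; congr 1; congr 1; ring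

/-- The place where `swap a b * p` first departs from `p` on the cycle of `a`: after `k` steps `p`
returns to `a` or reaches `b`, and `swap a b * p` then goes to the other one of the two. -/
theorem exists_first_return [Finite X] [DecidableEq X] (p : Equiv.Perm X) (a b : X) :
    ∃ k, 0 < k ∧ (p^[k] a = a ∨ p^[k] a = b) ∧
      (∀ j, 0 < j → j < k → p^[j] a ≠ a ∧ p^[j] a ≠ b) ∧
      (∀ j, j < k → (Equiv.swap a b * p)^[j] a = p^[j] a) ∧
      (Equiv.swap a b * p)^[k] a = Equiv.swap a b (p^[k] a) := by
  classical
  have hex : ∃ k, 0 < k ∧ (p^[k] a = a ∨ p^[k] a = b) := by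
    refine ⟨orderOf p, orderOf_pos p, .inl ?_⟩
    rw [← coe_pow, pow_orderOf_eq_one, one_apply]
  obtain ⟨hk, hab⟩ := Nat.find_spec hex
  have hmin : ∀ j, 0 < j → j < Nat.find hex → p^[j] a ≠ a ∧ p^[j] a ≠ b := fun j hj hjk => by
    have := Nat.find_min hex hjk
    push Not at this
    exact this hj
  have hag : ∀ j, j < Nat.find hex → (Equiv.swap a b * p)^[j] a = p^[j] a := by
    intro j
    induction j with
    | zero => intro _; rfl
    | succ j ih =>
      intro hj
      have h1 := hmin (j + 1) (by omega) hj
      rw [Function.iterate_succ_apply', ih (by omega), mul_apply, ← Function.iterate_succ_apply' p,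
        Equiv.swap_apply_of_ne_of_ne h1.1 h1.2]
  refine ⟨Nat.find hex, hk, hab, hmin, hag, ?_⟩
  obtain ⟨m, hm⟩ : ∃ m, Nat.find hex = m + 1 := ⟨_, (Nat.succ_pred_eq_of_pos hk).symm⟩
  rw [hm, Function.iterate_succ_apply', hag m (by omega), mul_apply,
    ← Function.iterate_succ_apply' p]

theorem not_sameCycle_of_iterate [Finite X] {p : Equiv.Perm X} {a b : X} {k : ℕ} (hk : 0 < k)
    (ha : p^[k] a = a) (h : ∀ j, j < k → p^[j] a ≠ b) : ¬ SameCycle p a b := by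
  intro hs
  obtain ⟨i, -, hi⟩ := hs.exists_pow_eq'
  have h1 : Function.IsPeriodicPt p k a := ha
  refine h (i % k) (Nat.mod_lt _ hk) ?_
  rw [h1.iterate_mod_apply, ← coe_pow]
  exact hi

theorem sameCycle_swap_mul [Finite X] [DecidableEq X] {p : Equiv.Perm X} {a b : X}
    (h : ¬ SameCycle p a b) :
    SameCycle (Equiv.swap a b * p) a b := by
  obtain ⟨k, -, h1 | h1, -, -, h3⟩ := exists_first_return p a b
  · rw [h1, Equiv.swap_apply_left] at h3
    refine ⟨k, ?_⟩
    rw [zpow_natCast, coe_pow]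
    exact h3
  · refine absurd ⟨(k : ℤ), ?_⟩ h
    rw [zpow_natCast, coe_pow]
    exact h1

theorem not_sameCycle_swap_mul [Finite X] [DecidableEq X] {p : Equiv.Perm X} {a b : X}
    (h : SameCycle p a b) (hab : a ≠ b) :
    ¬ SameCycle (Equiv.swap a b * p) a b := by
  obtain ⟨k, hk, h1, h2, h4, h3⟩ := exists_first_return p a b
  have h5 : ∀ j, j < k → p^[j] a ≠ b := fun j hj => by
    rcases Nat.eq_zero_or_pos j with rfl | hj0
    · exact hab
    · exact (h2 j hj0 hj).2
  rcases h1 with h1 | h1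
  · exact absurd h (not_sameCycle_of_iterate hk h1 h5)
  · rw [h1, Equiv.swap_apply_right] at h3
    exact not_sameCycle_of_iterate hk h3 fun j hj => by rw [h4 j hj]; exact h5 j hj

theorem eqvGen_addPair_swap_mul [DecidableEq X] {r : X → X → Prop} (p : Equiv.Perm X) (a b x y : X)
    (hr : ∀ x y, p x = y → r x y) (hxy : (Equiv.swap a b * p) x = y) :
    Relation.EqvGen (addPair r a b) x y := by
  have h1 : Relation.EqvGen (addPair r a b) x (p x) := .rel _ _ (.inl (hr _ _ rfl))
  have h2 : Relation.EqvGen (addPair r a b) a b := .rel _ _ (.inr ⟨rfl, rfl⟩)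
  rw [mul_apply] at hxy
  by_cases ha : p x = a
  · rw [ha, Equiv.swap_apply_left] at hxy
    exact hxy ▸ .trans _ _ _ (ha ▸ h1) h2
  · by_cases hb : p x = b
    · rw [hb, Equiv.swap_apply_right] at hxy
      exact hxy ▸ .trans _ _ _ (hb ▸ h1) h2.symm
    · rw [Equiv.swap_apply_of_ne_of_ne ha hb] at hxy
      exact hxy ▸ h1

theorem classCount_addPair_swap_mul [DecidableEq X] (p : Equiv.Perm X) (a b : X) :
    classCount (addPair (fun x y => (Equiv.swap a b * p) x = y) a b) =
      classCount (addPair (fun x y => p x = y) a b) := by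
  refine classCount_congr ?_ ?_
  · rintro x y (h | ⟨rfl, rfl⟩)
    · exact eqvGen_addPair_swap_mul p a b x y (fun _ _ h => h) h
    · exact .rel _ _ (.inr ⟨rfl, rfl⟩)
  · rintro x y (h | ⟨rfl, rfl⟩)
    · refine eqvGen_addPair_swap_mul (Equiv.swap a b * p) a b x y (fun _ _ h => h) ?_
      rw [Equiv.swap_mul_self_mul]
      exact h
    · exact .rel _ _ (.inr ⟨rfl, rfl⟩)

theorem cycleCount_swap_mul_of_not_sameCycle [Finite X] [DecidableEq X] {p : Equiv.Perm X} {a b : X}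
    (h : ¬ SameCycle p a b) : cycleCount (Equiv.swap a b * p) + 1 = cycleCount p := by
  have h1 := classCount_addPair_of_eqvGen (eqvGen_perm_iff.2 (sameCycle_swap_mul h))
  have h2 := classCount_addPair_of_not_eqvGen (mt eqvGen_perm_iff.1 h)
  rw [classCount_addPair_swap_mul] at h1
  exact (congrArg (· + 1) h1).symm.trans h2

theorem cycleCount_swap_mul_of_sameCycle [Finite X] [DecidableEq X] {p : Equiv.Perm X} {a b : X}
    (h : SameCycle p a b) (hab : a ≠ b) : cycleCount (Equiv.swap a b * p) = cycleCount p + 1 := by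
  have h1 := classCount_addPair_of_eqvGen (eqvGen_perm_iff.2 h)
  have h2 := classCount_addPair_of_not_eqvGen (mt eqvGen_perm_iff.1 (not_sameCycle_swap_mul h hab))
  rw [classCount_addPair_swap_mul, h1] at h2
  exact h2.symm

theorem cycleCount_le_swap_mul [Finite X] [DecidableEq X] (p : Equiv.Perm X) {a b : X} (hab : a ≠ b) :
    cycleCount p ≤ cycleCount (Equiv.swap a b * p) + 1 := by
  by_cases h : SameCycle p a b
  · rw [cycleCount_swap_mul_of_sameCycle h hab]; omega
  · rw [cycleCount_swap_mul_of_not_sameCycle h]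

theorem cycleCount_le_card [Finite X] (p : Equiv.Perm X) : cycleCount p ≤ Nat.card X :=
  Nat.card_le_card_of_surjective (Quot.mk _) Quot.mk_surjective

theorem cycleCount_one : cycleCount (1 : Equiv.Perm X) = Nat.card X := by
  refine Nat.card_congr ⟨Quot.lift id fun x y h => h, Quot.mk _, ?_, fun x => rfl⟩
  rintro ⟨x⟩; rfl

/-- The genus of a combinatorial map is not negative: for permutations `a`, `b` of a finite set,
the numbers of cycles of `a`, `b` and `a * b` and the number of orbits of the group generated by
`a` and `b` satisfy this inequality. The proof splits fixed points off `a` one at a time. -/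
theorem cycleCount_add_le [Finite X] [DecidableEq X] (a b : Equiv.Perm X) :
    cycleCount a + cycleCount b + cycleCount (a * b) ≤
      Nat.card X + 2 * classCount (fun x y => a x = y ∨ b x = y) := by
  obtain ⟨d, hd⟩ : ∃ d, Nat.card X ≤ cycleCount a + d := ⟨Nat.card X, by omega⟩
  induction d generalizing a with
  | zero =>
    by_cases h1 : a = 1
    · subst h1
      have h2 : classCount (fun x y : X => (1 : Equiv.Perm X) x = y ∨ b x = y) = cycleCount b := by
        refine classCount_congr ?_ fun x y h => .rel _ _ (.inr h)
        rintro x y (rfl | h)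
        · exact .refl _
        · exact .rel _ _ h
      rw [h2, cycleCount_one, one_mul]
      omega
    · obtain ⟨i, hi⟩ : ∃ i, a i ≠ i := by
        by_contra! hc
        exact h1 (Equiv.ext hc)
      have := cycleCount_swap_mul_of_sameCycle
        (sameCycle_apply_right.2 (SameCycle.refl a i)) hi.symm
      have h3 := cycleCount_le_card (Equiv.swap i (a i) * a)
      omega
  | succ d ih =>
    by_cases h1 : a = 1
    · exact ih a (by rw [h1, cycleCount_one]; omega)
    · obtain ⟨i, hi⟩ : ∃ i, a i ≠ i := by
        by_contra! hc
        exact h1 (Equiv.ext hc)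
      have hsc := cycleCount_swap_mul_of_sameCycle
        (sameCycle_apply_right.2 (SameCycle.refl a i)) hi.symm
      have h4 := ih (Equiv.swap i (a i) * a) (by omega)
      set a' := Equiv.swap i (a i) * a with ha'
      have haa : a = Equiv.swap i (a i) * a' := by rw [ha', Equiv.swap_mul_self_mul]
      have hprod : a * b = Equiv.swap i (a i) * (a' * b) := by rw [← mul_assoc, ← haa]
      have hcc : classCount (addPair (fun x y => a' x = y ∨ b x = y) i (a i)) =
          classCount (fun x y => a x = y ∨ b x = y) := by
        refine classCount_congr ?_ ?_
        · rintro x y ((h | h) | ⟨rfl, rfl⟩)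
          · refine eqvGen_of_forall ?_ (eqvGen_addPair_swap_mul (r := fun x y => a x = y ∨ b x = y)
              a i (a i) x y (fun _ _ => .inl) h)
            rintro x y (h | ⟨rfl, rfl⟩)
            · exact .rel _ _ h
            · exact .rel _ _ (.inl rfl)
          · exact .rel _ _ (.inr h)
          · exact .rel _ _ (.inl rfl)
        · rintro x y (h | h)
          · refine eqvGen_addPair_swap_mul a' i (a i) x y (fun _ _ => .inl) ?_
            rw [← haa]; exact h
          · exact .rel _ _ (.inl (.inr h))
      by_cases h5 : Relation.EqvGen (fun x y => a' x = y ∨ b x = y) i (a i)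
      · rw [classCount_addPair_of_eqvGen h5] at hcc
        have h6 := cycleCount_le_swap_mul (a * b) hi.symm
        rw [hprod, Equiv.swap_mul_self_mul, ← hprod] at h6
        omega
      · have h6 := classCount_addPair_of_not_eqvGen h5
        have h7 : ¬ SameCycle (a' * b) i (a i) := fun hs => h5 <| by
          refine eqvGen_of_forall ?_ (eqvGen_perm_iff.2 hs)
          rintro x y rfl
          exact .trans _ _ _ (.rel _ _ (.inr rfl)) (.rel _ _ (.inl rfl))
        have h8 := cycleCount_swap_mul_of_not_sameCycle h7
        rw [← hprod] at h8
        omega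

end CycleCount

noncomputable section

/-! ### The combinatorial map of a forest -/

instance SimpleGraph.Dart.instFinite {V : Type*} [Finite V] (G : SimpleGraph V) : Finite G.Dart :=
  Finite.of_injective _ (SimpleGraph.Dart.toProd_injective (G := G))

theorem dart_ext {V : Type*} {G : SimpleGraph V} {d d' : G.Dart} (h : d.fst = d'.fst)
    (h' : d.snd = d'.snd) : d = d' :=
  SimpleGraph.Dart.ext _ _ (Prod.ext h h')

theorem finRotate_mk_of_lt {n z : ℕ} (h : z + 1 < n) :
    finRotate n ⟨z, by omega⟩ = ⟨z + 1, h⟩ := by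
  obtain ⟨m, rfl⟩ : ∃ m, n = m + 1 := ⟨n - 1, by omega⟩
  exact finRotate_of_lt (by omega)

theorem finRotate_mk_last {n : ℕ} (h : 0 < n) : finRotate n ⟨n - 1, by omega⟩ = ⟨0, h⟩ := by
  obtain ⟨m, rfl⟩ : ∃ m, n = m + 1 := ⟨n - 1, by omega⟩
  exact finRotate_last'

namespace PreForest

variable {n : ℕ} (F : PreForest n)

/-- All boundary vertices have degree one. -/
def BoundaryDegOne : Prop := ∀ i : Fin n, F.deg (Sum.inl i) = 1

/-- Every internal vertex is connected to the boundary. -/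
def ReachesBoundary : Prop := ∀ v, ∃ i : Fin n, F.graph.Reachable (Sum.inr v) (Sum.inl i)

variable {F}

theorem BoundaryDegOne.exists_unique_adj (hb : F.BoundaryDegOne) (i : Fin n) :
    ∃ w, ∀ x, F.graph.Adj (Sum.inl i) x ↔ x = w := by
  obtain ⟨w, hw⟩ := Set.ncard_eq_one.1 (hb i)
  exact ⟨w, fun x => by rw [← SimpleGraph.mem_neighborSet, hw, Set.mem_singleton_iff]⟩

/-- The only neighbour of a boundary vertex. -/
def BoundaryDegOne.nbr (hb : F.BoundaryDegOne) (i : Fin n) : Fin n ⊕ Fin F.numInt :=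
  (hb.exists_unique_adj i).choose

theorem BoundaryDegOne.adj_iff (hb : F.BoundaryDegOne) {i : Fin n} {x : Fin n ⊕ Fin F.numInt} :
    F.graph.Adj (Sum.inl i) x ↔ x = hb.nbr i :=
  (hb.exists_unique_adj i).choose_spec x

/-- The dart that leaves a boundary vertex. -/
def BoundaryDegOne.out (hb : F.BoundaryDegOne) (i : Fin n) : F.graph.Dart :=
  ⟨(Sum.inl i, hb.nbr i), hb.adj_iff.2 rfl⟩

@[simp]
theorem BoundaryDegOne.out_fst (hb : F.BoundaryDegOne) (i : Fin n) : (hb.out i).fst = Sum.inl i :=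
  rfl

theorem BoundaryDegOne.eq_out (hb : F.BoundaryDegOne) {i : Fin n} {d : F.graph.Dart}
    (h : d.fst = Sum.inl i) : d = hb.out i := by
  have h1 : F.graph.Adj (Sum.inl i) d.snd := h ▸ d.adj
  exact dart_ext h (hb.adj_iff.1 h1)

theorem BoundaryDegOne.out_injective (hb : F.BoundaryDegOne) : Function.Injective hb.out :=
  fun _ _ h => Sum.inl_injective (congrArg (fun d : F.graph.Dart => d.fst) h)

theorem exists_next_eq {v : Fin F.numInt} {w : Fin n ⊕ Fin F.numInt}
    (hw : F.graph.Adj (Sum.inr v) w) : ∃ u, F.graph.Adj (Sum.inr v) u ∧ F.next v u = w := by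
  obtain ⟨k, hk⟩ := F.next_cycle v _ w (F.next_adj v w hw) hw
  have hadj : ∀ j, F.graph.Adj (Sum.inr v) ((F.next v)^[j] w) := fun j => by
    induction j with
    | zero => exact hw
    | succ j ih => rw [Function.iterate_succ_apply']; exact F.next_adj _ _ ih
  refine ⟨(F.next v)^[k] w, hadj k, ?_⟩
  rw [← Function.iterate_succ_apply' (F.next v), Function.iterate_succ_apply, hk]

namespace BoundaryDegOne

variable (hb : F.BoundaryDegOne)

/-- The rotation of the map obtained by contracting the boundary circle to one more vertex: the
next dart in clockwise order around an internal vertex; and from a boundary vertex on to the dart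
that leaves the boundary vertex before it. -/
def rotFun (d : F.graph.Dart) : F.graph.Dart :=
  match h : d.fst with
  | Sum.inl i => hb.out ((finRotate n).symm i)
  | Sum.inr v => ⟨(Sum.inr v, F.next v d.snd), F.next_adj v d.snd (h ▸ d.adj)⟩

theorem rotFun_inl {d : F.graph.Dart} {i : Fin n} (h : d.fst = Sum.inl i) :
    hb.rotFun d = hb.out ((finRotate n).symm i) := by
  unfold rotFun
  split
  · next j hj => rw [h] at hj; cases hj; rfl
  · next j hj => rw [h] at hj; cases hj

theorem rotFun_inr {d : F.graph.Dart} {v : Fin F.numInt} (h : d.fst = Sum.inr v) :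
    (hb.rotFun d).fst = Sum.inr v ∧ (hb.rotFun d).snd = F.next v d.snd := by
  unfold rotFun
  split
  · next j hj => rw [h] at hj; cases hj
  · next j hj => rw [h] at hj; cases hj; exact ⟨rfl, rfl⟩

theorem rotFun_surjective : Function.Surjective hb.rotFun := by
  intro d
  rcases h : d.fst with i | v
  · refine ⟨hb.out (finRotate n i), ?_⟩
    rw [hb.rotFun_inl (hb.out_fst _), Equiv.symm_apply_apply, hb.eq_out h]
  · obtain ⟨u, hu, hu'⟩ := exists_next_eq (v := v) (w := d.snd) (h ▸ d.adj)
    obtain ⟨h1, h2⟩ := hb.rotFun_inr (d := ⟨(Sum.inr v, u), hu⟩) rfl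
    exact ⟨_, dart_ext (h1.trans h.symm) (h2.trans hu')⟩

/-- The rotation `rotFun` as a permutation of the darts. -/
def rot : Equiv.Perm F.graph.Dart :=
  Equiv.ofBijective hb.rotFun (Finite.surjective_iff_bijective.1 hb.rotFun_surjective)

theorem rot_inr {d : F.graph.Dart} {v : Fin F.numInt} (h : d.fst = Sum.inr v) :
    (hb.rot d).fst = Sum.inr v ∧ (hb.rot d).snd = F.next v d.snd :=
  hb.rotFun_inr h

theorem rot_out_finRotate (i : Fin n) : hb.rot (hb.out (finRotate n i)) = hb.out i := by
  refine (hb.rotFun_inl (hb.out_fst _)).trans ?_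
  rw [Equiv.symm_apply_apply]

theorem rot_out_succ {z : ℕ} (h : z + 1 < n) :
    hb.rot (hb.out ⟨z + 1, h⟩) = hb.out ⟨z, by omega⟩ := by
  rw [← finRotate_mk_of_lt h, rot_out_finRotate]

theorem rot_out_zero (h : 0 < n) : hb.rot (hb.out ⟨0, h⟩) = hb.out ⟨n - 1, by omega⟩ := by
  rw [← finRotate_mk_last h, rot_out_finRotate]

end BoundaryDegOne

variable (F) in
/-- The reversal of darts. -/
def dartSymm : Equiv.Perm F.graph.Dart :=
  Function.Involutive.toPerm SimpleGraph.Dart.symm SimpleGraph.Dart.symm_involutive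

namespace BoundaryDegOne

variable (hb : F.BoundaryDegOne)

/-- The permutation of the darts whose cycles are the boundaries of the regions. -/
def face : Equiv.Perm F.graph.Dart := hb.rot * F.dartSymm

theorem face_apply (d : F.graph.Dart) : hb.face d = hb.rot d.symm := rfl

theorem faceStep_iff (d d' : F.graph.Dart) : F.FaceStep d d' ↔ hb.face d = d' := by
  constructor
  · rintro (⟨v, hd, hd', h⟩ | ⟨i, hd, hd'⟩)
    · have h1 : d.symm.fst = Sum.inr v := hd
      obtain ⟨h2, h3⟩ := hb.rot_inr h1
      exact dart_ext (h2.trans hd'.symm) (h3.trans h.symm)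
    · have h1 : d.symm.fst = Sum.inl (finRotate n i) := hd
      rw [face_apply, hb.eq_out h1, rot_out_finRotate, ← hb.eq_out hd']
  · rintro rfl
    rcases h : d.snd with i | v
    · refine .arc _ _ ((finRotate n).symm i) (by rw [h, Equiv.apply_symm_apply]) ?_
      have h1 : d.symm.fst = Sum.inl i := h
      rw [face_apply, hb.eq_out h1]
      exact congrArg (fun d : F.graph.Dart => d.fst) (hb.rotFun_inl (hb.out_fst i))
    · have h1 : d.symm.fst = Sum.inr v := h
      obtain ⟨h2, h3⟩ := hb.rot_inr h1
      exact .turn _ _ v h h2 h3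

theorem numRegions_eq : F.numRegions = cycleCount hb.face :=
  classCount_congr (fun _ _ h => .rel _ _ ((hb.faceStep_iff _ _).1 h))
    fun _ _ h => .rel _ _ ((hb.faceStep_iff _ _).2 h)

end BoundaryDegOne

theorem cycleCount_dartSymm : cycleCount F.dartSymm = F.graph.edgeSet.ncard := by
  refine Nat.card_congr (Equiv.ofBijective (Quot.lift (fun d => ⟨d.edge, d.edge_mem⟩) ?_) ⟨?_, ?_⟩)
  · rintro d _ rfl
    exact Subtype.ext (d.edge_symm).symm
  · rintro ⟨d⟩ ⟨d'⟩ h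
    rcases (SimpleGraph.dart_edge_eq_iff d d').1 (congrArg Subtype.val h) with rfl | rfl
    · rfl
    · exact (Quot.sound (r := fun x y => F.dartSymm x = y) (a := d') rfl).symm
  · rintro ⟨e, he⟩
    induction e with
    | h x y => exact ⟨Quot.mk _ ⟨(x, y), he⟩, rfl⟩

theorem card_dart : Nat.card F.graph.Dart = 2 * F.graph.edgeSet.ncard := by
  classical
  rw [Nat.card_eq_fintype_card, SimpleGraph.dart_card_eq_twice_card_edges,
    ← SimpleGraph.coe_edgeFinset, Set.ncard_coe_finset]

/-! ### Connectivity by rotation steps -/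

section Connect

variable {r : F.graph.Dart → F.graph.Dart → Prop}

theorem eqvGen_of_fst_eq_inr
    (h : ∀ (d d' : F.graph.Dart) (v : Fin F.numInt), d.fst = Sum.inr v → d'.fst = Sum.inr v →
      d'.snd = F.next v d.snd → Relation.EqvGen r d d')
    {d d' : F.graph.Dart} {v : Fin F.numInt} (hd : d.fst = Sum.inr v) (hd' : d'.fst = Sum.inr v) :
    Relation.EqvGen r d d' := by
  obtain ⟨k, hk⟩ := F.next_cycle v d.snd d'.snd (hd ▸ d.adj) (hd' ▸ d'.adj)
  induction k generalizing d with
  | zero =>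
    have : d = d' := dart_ext (hd.trans hd'.symm) hk
    exact this ▸ .refl _
  | succ k ih =>
    have h2 : F.graph.Adj (Sum.inr v) d.snd := hd ▸ d.adj
    exact .trans _ _ _ (h d ⟨(Sum.inr v, F.next v d.snd), F.next_adj _ _ h2⟩ v hd rfl rfl)
      (ih rfl hk)

theorem eqvGen_of_reachable (hb : F.BoundaryDegOne)
    (h : ∀ (d d' : F.graph.Dart) (v : Fin F.numInt), d.fst = Sum.inr v → d'.fst = Sum.inr v →
      d'.snd = F.next v d.snd → Relation.EqvGen r d d')
    (hs : ∀ d, Relation.EqvGen r d d.symm) {d d' : F.graph.Dart}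
    (hr : F.graph.Reachable d.fst d'.fst) : Relation.EqvGen r d d' := by
  have key : ∀ d d' : F.graph.Dart, d.fst = d'.fst → Relation.EqvGen r d d' := by
    intro d d' hdd
    rcases h1 : d.fst with i | v
    · rw [hb.eq_out h1, hb.eq_out (d := d') (hdd ▸ h1)]; exact .refl _
    · exact eqvGen_of_fst_eq_inr h h1 (hdd ▸ h1)
  obtain ⟨p⟩ := hr
  generalize hx : d.fst = x at p
  generalize hy : d'.fst = y at p
  induction p generalizing d with
  | nil => exact key _ _ (hx.trans hy.symm)
  | cons hadj p ih =>
    exact .trans _ _ _ (key d ⟨(_, _), hadj⟩ hx) (.trans _ _ _ (hs _) (ih (d := (SimpleGraph.Dart.mk (_, _) hadj).symm) rfl hy))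

end Connect

theorem ReachesBoundary.exists_adj (hr : F.ReachesBoundary) (v : Fin F.numInt) :
    ∃ w, F.graph.Adj (Sum.inr v) w := by
  obtain ⟨i, ⟨p⟩⟩ := hr v
  cases p with
  | cons h _ => exact ⟨_, h⟩

theorem ReachesBoundary.exists_reachable (hr : F.ReachesBoundary) (x : Fin n ⊕ Fin F.numInt) :
    ∃ i : Fin n, F.graph.Reachable x (Sum.inl i) := by
  rcases x with i | v
  · exact ⟨i, .refl _⟩
  · exact hr v

namespace BoundaryDegOne

variable (hb : F.BoundaryDegOne)

theorem sameCycle_rot_out (i j : Fin n) : hb.rot.SameCycle (hb.out i) (hb.out j) := by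
  have key : ∀ (z : ℕ) (hz : z < n) (h0 : 0 < n),
      hb.rot.SameCycle (hb.out ⟨z, hz⟩) (hb.out ⟨0, h0⟩) := by
    intro z
    induction z with
    | zero => exact fun _ _ => .refl _ _
    | succ z ih =>
      intro hz h0
      have := ih (by omega) h0
      rw [← hb.rot_out_succ hz] at this
      exact Equiv.Perm.sameCycle_apply_left.1 this
  exact (key i i.2 i.pos).trans (key j j.2 i.pos).symm

theorem sameCycle_rot_of_fst_eq_inr {d d' : F.graph.Dart} {v : Fin F.numInt}
    (hd : d.fst = Sum.inr v) (hd' : d'.fst = Sum.inr v) : hb.rot.SameCycle d d' := by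
  refine eqvGen_perm_iff.1 (eqvGen_of_fst_eq_inr (fun d d' v h1 h2 h3 => .rel _ _ ?_) hd hd')
  obtain ⟨h4, h5⟩ := hb.rot_inr h1
  exact dart_ext (h4.trans h2.symm) (h5.trans h3.symm)

theorem cycleCount_rot (hr : F.ReachesBoundary) (hn : 0 < n) :
    cycleCount hb.rot = F.numInt + 1 := by
  let f : F.graph.Dart → Fin F.numInt ⊕ Unit := fun d => Sum.elim (fun _ => Sum.inr ()) Sum.inl d.fst
  have hf : ∀ d d', hb.rot d = d' → f d = f d' := by
    rintro d _ rfl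
    rcases h : d.fst with i | v
    · have h2 : (hb.rot d).fst = _ := congrArg (fun d : F.graph.Dart => d.fst) (hb.rotFun_inl h)
      simp only [out_fst] at h2
      simp only [f, h, h2, Sum.elim_inl]
    · simp only [f, h, (hb.rot_inr h).1]
  have e : Quot (fun d d' => hb.rot d = d') ≃ Fin F.numInt ⊕ Unit := by
    refine Equiv.ofBijective (Quot.lift f hf) ⟨?_, ?_⟩
    · rintro ⟨d⟩ ⟨d'⟩ hdd
      replace hdd : f d = f d' := hdd
      refine Quot.eqvGen_sound (eqvGen_perm_iff.2 ?_)
      rcases h : d.fst with i | v <;> rcases h' : d'.fst with j | w <;> simp only [f, h, h'] at hdd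
      · rw [hb.eq_out h, hb.eq_out h']; exact hb.sameCycle_rot_out i j
      · cases hdd
      · cases hdd
      · cases hdd; exact hb.sameCycle_rot_of_fst_eq_inr h h'
    · rintro (v | ⟨⟩)
      · obtain ⟨w, hw⟩ := hr.exists_adj v
        exact ⟨Quot.mk _ ⟨(Sum.inr v, w), hw⟩, rfl⟩
      · exact ⟨Quot.mk _ (hb.out ⟨0, hn⟩), rfl⟩
  rw [cycleCount, classCount, Nat.card_congr e]
  simp

theorem isPlanar_iff (hn : 0 < n) :
    F.IsPlanar ↔ F.numInt + 1 + cycleCount hb.face = F.graph.edgeSet.ncard + 2 := by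
  rw [IsPlanar, hb.numRegions_eq]
  omega

theorem numInt_add_cycleCount_face_le (hr : F.ReachesBoundary) (hn : 0 < n) :
    F.numInt + 1 + cycleCount hb.face ≤ F.graph.edgeSet.ncard + 2 := by
  classical
  have h1 := cycleCount_add_le hb.rot F.dartSymm
  rw [hb.cycleCount_rot hr hn, cycleCount_dartSymm, card_dart] at h1
  have h2 : classCount (fun x y => hb.rot x = y ∨ F.dartSymm x = y) ≤ 1 := by
    refine classCount_le_one_of_forall fun d d' => ?_
    have key : ∀ d : F.graph.Dart, Relation.EqvGen
        (fun x y => hb.rot x = y ∨ F.dartSymm x = y) d (hb.out ⟨0, hn⟩) := fun d => by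
      obtain ⟨i, hi⟩ := hr.exists_reachable d.fst
      refine .trans _ _ _ (eqvGen_of_reachable hb (d' := hb.out i) ?_ ?_ hi) ?_
      · intro d d' v h1 h2 h3
        obtain ⟨h4, h5⟩ := hb.rot_inr h1
        exact .rel _ _ (.inl (dart_ext (h4.trans h2.symm) (h5.trans h3.symm)))
      · exact fun d => .rel _ _ (.inr rfl)
      · exact eqvGen_of_forall (fun _ _ h => .rel _ _ (.inl h))
          (eqvGen_perm_iff.2 (hb.sameCycle_rot_out i _))
    exact .trans _ _ _ (key d) (.symm _ _ (key d'))
  have h3 : cycleCount (hb.rot * F.dartSymm) = cycleCount hb.face := rfl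
  omega

/-- In a planar forest, if the corners of the disk after the boundary vertices `i < k` are in the
same region, then no path of the forest connects the boundary vertices in `(i, k]` with the others.
Otherwise the map in which the vertex of the contracted boundary circle is split in two, which has
one more vertex and one more region, would still be connected and have negative genus. -/
theorem mem_Ioc_of_reachable (hp : F.IsPlanar) (hr : F.ReachesBoundary) {i k : Fin n} (hik : i < k)
    (hs : hb.face.SameCycle (hb.out i) (hb.out k)) {x y : Fin n}
    (hxy : F.graph.Reachable (Sum.inl x) (Sum.inl y)) (hx : i < x ∧ x ≤ k) : i < y ∧ y ≤ k := by
  classical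
  by_contra hy
  have hn : 0 < n := by omega
  have hne : hb.out i ≠ hb.out k := fun h => hik.ne (hb.out_injective h)
  set s := Equiv.swap (hb.out i) (hb.out k) with hsdef
  have h1 := cycleCount_swap_mul_of_sameCycle (hb.sameCycle_rot_out i k) hne
  have h2 := cycleCount_swap_mul_of_sameCycle hs hne
  have h3 := cycleCount_add_le (s * hb.rot) F.dartSymm
  have h4 : s * hb.rot * F.dartSymm = s * hb.face := mul_assoc _ _ _
  have h5 := (hb.isPlanar_iff hn).1 hp
  rw [h4, h1, h2, hb.cycleCount_rot hr hn, cycleCount_dartSymm, card_dart] at h3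
  set r : F.graph.Dart → F.graph.Dart → Prop :=
    fun x y => (s * hb.rot) x = y ∨ F.dartSymm x = y with hrdef
  have hint : ∀ (d d' : F.graph.Dart) (v : Fin F.numInt), d.fst = Sum.inr v → d'.fst = Sum.inr v →
      d'.snd = F.next v d.snd → Relation.EqvGen r d d' := by
    intro d d' v h1 h2 h3
    obtain ⟨h4, h5⟩ := hb.rot_inr h1
    have h6 : hb.rot d = d' := dart_ext (h4.trans h2.symm) (h5.trans h3.symm)
    have h7 : ∀ j, d' ≠ hb.out j := fun j hj => by rw [hj, out_fst] at h2; cases h2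
    refine .rel _ _ (.inl ?_)
    rw [Equiv.Perm.mul_apply, h6, hsdef, Equiv.swap_apply_of_ne_of_ne (h7 i) (h7 k)]
  have hsymm : ∀ d, Relation.EqvGen r d d.symm := fun d => .rel _ _ (.inr rfl)
  have hstep : ∀ (z : ℕ) (hz : z + 1 < n), z ≠ i → z ≠ k →
      Relation.EqvGen r (hb.out ⟨z + 1, hz⟩) (hb.out ⟨z, by omega⟩) := by
    intro z hz hzi hzk
    refine .rel _ _ (.inl ?_)
    rw [Equiv.Perm.mul_apply, hb.rot_out_succ, hsdef, Equiv.swap_apply_of_ne_of_ne]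
    · exact fun h => hzi (congrArg Fin.val (hb.out_injective h))
    · exact fun h => hzk (congrArg Fin.val (hb.out_injective h))
  have hin : ∀ (z : ℕ) (hz : z < n), i < z → z ≤ k →
      Relation.EqvGen r (hb.out ⟨z, hz⟩) (hb.out ⟨i + 1, by omega⟩) := by
    intro z
    induction z with
    | zero => intro hz hz'; omega
    | succ z ih =>
      intro hz h1 h2
      rcases Nat.lt_or_ge i z with h3 | h3
      · exact .trans _ _ _ (hstep z hz (by omega) (by omega)) (ih _ h3 (by omega))
      · have : z = i := by omega
        subst this; exact .refl _
  have hlow : ∀ (z : ℕ) (hz : z < n), z ≤ i →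
      Relation.EqvGen r (hb.out ⟨z, hz⟩) (hb.out ⟨0, hn⟩) := by
    intro z
    induction z with
    | zero => intro _ _; exact .refl _
    | succ z ih =>
      intro hz h1
      exact .trans _ _ _ (hstep z hz (by omega) (by omega)) (ih _ (by omega))
  have hhigh : ∀ (m z : ℕ) (hz : z < n), k < z → z + m = n - 1 →
      Relation.EqvGen r (hb.out ⟨z, hz⟩) (hb.out ⟨0, hn⟩) := by
    intro m
    induction m with
    | zero =>
      intro z hz hkz hzm
      have : z = n - 1 := by omega
      subst this
      refine .symm _ _ (.rel _ _ (.inl ?_))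
      rw [Equiv.Perm.mul_apply, hb.rot_out_zero, hsdef, Equiv.swap_apply_of_ne_of_ne]
      · intro h
        have : n - 1 = i := congrArg Fin.val (hb.out_injective h)
        omega
      · intro h
        have : n - 1 = k := congrArg Fin.val (hb.out_injective h)
        omega
    | succ m ih =>
      intro z hz hkz hzm
      exact .trans _ _ _ (.symm _ _ (hstep z (by omega) (by omega) (by omega)))
        (ih (z + 1) (by omega) (by omega) (by omega))
  have hout : ∀ z : Fin n, ¬ (i < z ∧ z ≤ k) → Relation.EqvGen r (hb.out z) (hb.out ⟨0, hn⟩) := by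
    intro z hz
    rcases Nat.lt_or_ge k z with h | h
    · exact hhigh (n - 1 - z) z z.2 h (by omega)
    · refine hlow z z.2 ?_
      by_contra hc
      exact hz ⟨by omega, h⟩
  have hxy' : Relation.EqvGen r (hb.out x) (hb.out y) := eqvGen_of_reachable hb hint hsymm hxy
  have hbase : Relation.EqvGen r (hb.out ⟨i + 1, by omega⟩) (hb.out ⟨0, hn⟩) :=
    .trans _ _ _ (.symm _ _ (hin x x.2 hx.1 hx.2)) (.trans _ _ _ hxy' (hout y hy))
  have hall : classCount r ≤ 1 := by
    have key : ∀ d, Relation.EqvGen r d (hb.out ⟨0, hn⟩) := fun d => by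
      obtain ⟨j, hj⟩ := hr.exists_reachable d.fst
      refine .trans _ _ _ (eqvGen_of_reachable hb (d' := hb.out j) hint hsymm hj) ?_
      by_cases hj' : i < j ∧ j ≤ k
      · exact .trans _ _ _ (hin j j.2 hj'.1 hj'.2) hbase
      · exact hout j hj'
    exact classCount_le_one_of_forall fun d d' => .trans _ _ _ (key d) (.symm _ _ (key d'))
  omega

end BoundaryDegOne

end PreForest
end

noncomputable section

/-! ### Branches of an acyclic graph -/

namespace SimpleGraph

variable {V : Type*} {G : SimpleGraph V}

theorem Reachable.induct {x y : V} (h : G.Reachable x y) {p : V → Prop} (h0 : p x)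
    (hs : ∀ y z, p y → G.Adj y z → p z) : p y := by
  obtain ⟨w⟩ := h
  induction w with
  | nil => exact h0
  | cons hadj w ih => exact ih (hs _ _ h0 hadj)

variable (G) in
/-- The vertices that can be reached from `w` without visiting `v`; for an edge `vw` of a forest,
the part of the tree that lies beyond this edge. -/
def branch (v w : V) : Set V := {x | (G.deleteIncidenceSet v).Reachable w x}

theorem self_mem_branch (v w : V) : w ∈ G.branch v w := Reachable.refl w

theorem notMem_branch {v w : V} (h : w ≠ v) : v ∉ G.branch v w := fun hx =>
  Reachable.induct (p := fun y => y ≠ v) hx h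
    (fun _ _ _ hadj => (deleteIncidenceSet_adj.1 hadj).2.2) rfl

theorem IsAcyclic.not_reachable_deleteIncidenceSet (hG : G.IsAcyclic) {v w w' : V}
    (hw : G.Adj v w) (hw' : G.Adj v w') (hne : w ≠ w') :
    ¬ (G.deleteIncidenceSet v).Reachable w w' := by
  intro h
  have hb := isBridge_iff.1 (isAcyclic_iff_forall_adj_isBridge.1 hG hw)
  refine hb ?_
  have h1 : (G.deleteEdges {s(v, w)}).Reachable w w' := by
    refine h.mono fun x y hxy => ?_
    obtain ⟨h2, h3, h4⟩ := deleteIncidenceSet_adj.1 hxy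
    rw [deleteEdges_adj]
    refine ⟨h2, fun h5 => ?_⟩
    rcases Sym2.eq_iff.1 h5 with ⟨h6, -⟩ | ⟨-, h6⟩
    · exact h3 h6
    · exact h4 h6
  have h2 : (G.deleteEdges {s(v, w)}).Adj v w' := by
    rw [deleteEdges_adj]
    refine ⟨hw', fun h5 => ?_⟩
    rcases Sym2.eq_iff.1 h5 with ⟨-, h6⟩ | ⟨h6, -⟩
    · exact hne h6.symm
    · exact hw.ne h6
  exact h2.reachable.trans h1.symm

theorem IsAcyclic.eq_of_mem_branch (hG : G.IsAcyclic) {v w w' x : V}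
    (hw : G.Adj v w) (hw' : G.Adj v w') (h : x ∈ G.branch v w) (h' : x ∈ G.branch v w') :
    w = w' := by
  by_contra hne
  exact hG.not_reachable_deleteIncidenceSet hw hw' hne (Reachable.trans h (Reachable.symm h'))

theorem IsAcyclic.branch_subset (hG : G.IsAcyclic) {u v w : V} (hu : G.Adj u v) (hw : G.Adj v w)
    (hne : w ≠ u) : G.branch v w ⊆ G.branch u v := by
  intro x hx
  have hnu : ∀ y, (G.deleteIncidenceSet v).Reachable w y → y ≠ u := by
    rintro y hy rfl
    exact hG.not_reachable_deleteIncidenceSet hw hu.symm hne hy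
  refine (Reachable.induct (p := fun y => (G.deleteIncidenceSet v).Reachable w y ∧
    (G.deleteIncidenceSet u).Reachable v y) hx ⟨.refl _, ?_⟩ ?_).2
  · exact (deleteIncidenceSet_adj.2 ⟨hw, hu.ne', hne⟩).reachable
  · rintro y z ⟨h1, h2⟩ hyz
    have h3 := h1.trans hyz.reachable
    exact ⟨h3, h2.trans (deleteIncidenceSet_adj.2
      ⟨(deleteIncidenceSet_adj.1 hyz).1, hnu _ h1, hnu _ h3⟩).reachable⟩

end SimpleGraph

/-! ### Codes -/

/-- The three kinds of codes: of a planted tree, of a list of planted trees (the children of an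
internal vertex), and of a forest. -/
inductive CodeKind
  | tree
  | list
  | forest

/-- Codes of planar forests, read along the boundary circle. A forest is empty, or has a first
boundary vertex (the root of its tree), from which a planted tree hangs, followed by the rest of
the forest. A planted tree is a boundary vertex, preceded by the forest that lies in the gap before
it, or an internal vertex with its helicity and its children. -/
inductive Code : CodeKind → Type
  | leaf (g : Code .forest) : Code .tree
  | node (h : ℕ) (cs : Code .list) : Code .tree
  | lnil : Code .list
  | lcons (c : Code .tree) (cs : Code .list) : Code .list
  | fnil : Code .forest
  | fcons (c : Code .tree) (g : Code .forest) : Code .forest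

namespace Code

/-- The number of vertices. -/
def size : {κ : CodeKind} → Code κ → ℕ
  | _, leaf g => g.size + 1
  | _, node _ cs => cs.size + 1
  | _, lnil => 0
  | _, lcons c cs => c.size + cs.size
  | _, fnil => 0
  | _, fcons c g => c.size + g.size + 1

/-- The number of trees in a list (and `0` for codes of the other kinds). -/
def len : {κ : CodeKind} → Code κ → ℕ
  | _, lcons _ cs => cs.len + 1
  | _, _ => 0

/-- The number of boundary vertices. -/
def numBd : {κ : CodeKind} → Code κ → ℕ
  | _, leaf g => g.numBd + 1
  | _, node _ cs => cs.numBd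
  | _, lnil => 0
  | _, lcons c cs => c.numBd + cs.numBd
  | _, fnil => 0
  | _, fcons c g => c.numBd + g.numBd + 1

end Code

/-- A place in a forest where a code can be read: the dart from `u` to `v` for a planted tree; an
internal vertex `a`, the first child `x` and the place `t` to stop for a list; no information for
a forest, which is located by its boundary labels alone. -/
inductive Loc (B I : Type) : CodeKind → Type
  | tree (u v : B ⊕ I) : Loc B I .tree
  | list (a : I) (x t : B ⊕ I) : Loc B I .list
  | forest : Loc B I .forest

/-- The vertex to which the part of a forest that is read at a place is attached. -/
def Loc.anchor {B I : Type} : {κ : CodeKind} → Loc B I κ → Option (B ⊕ I)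
  | _, .tree u _ => some u
  | _, .list a _ _ => some (.inr a)
  | _, .forest => none

namespace PreForest

variable {n : ℕ} {F : PreForest n}

/-- `F.Occ c p s e L` says that the code `c` can be read in `F` at the place `p`, that the boundary
vertices in this part of `F` have the labels `s, …, e - 1`, and that `L` lists its vertices. -/
inductive Occ (F : PreForest n) : {κ : CodeKind} → Code κ → Loc (Fin n) (Fin F.numInt) κ → ℕ → ℕ →
    List (Fin n ⊕ Fin F.numInt) → Prop
  | leaf {u : Fin n ⊕ Fin F.numInt} {i : Fin n} {g : Code .forest} {s e : ℕ}
      {L : List (Fin n ⊕ Fin F.numInt)} (hadj : F.graph.Adj u (.inl i)) (he : e = i + 1)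
      (hg : Occ F g .forest s i L) : Occ F (.leaf g) (.tree u (.inl i)) s e (L ++ [.inl i])
  | node {u : Fin n ⊕ Fin F.numInt} {a : Fin F.numInt} {h : ℕ} {cs : Code .list} {s e : ℕ}
      {L : List (Fin n ⊕ Fin F.numInt)} (hadj : F.graph.Adj u (.inr a)) (hh : F.hel a = h)
      (hcs : Occ F cs (.list a (F.next a u) u) s e L) :
      Occ F (.node h cs) (.tree u (.inr a)) s e (.inr a :: L)
  | lnil (a : Fin F.numInt) (t : Fin n ⊕ Fin F.numInt) (s : ℕ) : Occ F .lnil (.list a t t) s s []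
  | lcons {a : Fin F.numInt} {x t : Fin n ⊕ Fin F.numInt} {c : Code .tree} {cs : Code .list}
      {s m e : ℕ} {L₁ L₂ : List (Fin n ⊕ Fin F.numInt)} (hx : x ≠ t)
      (hc : Occ F c (.tree (.inr a) x) s m L₁) (hcs : Occ F cs (.list a (F.next a x) t) m e L₂) :
      Occ F (.lcons c cs) (.list a x t) s e (L₁ ++ L₂)
  | fnil (s : ℕ) : Occ F .fnil .forest s s []
  | fcons {i : Fin n} {v : Fin n ⊕ Fin F.numInt} {c : Code .tree} {g : Code .forest} {s m e : ℕ}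
      {L₁ L₂ : List (Fin n ⊕ Fin F.numInt)} (hi : (i : ℕ) = s) (hadj : F.graph.Adj (.inl i) v)
      (hc : Occ F c (.tree (.inl i) v) (s + 1) m L₁) (hg : Occ F g .forest m e L₂) :
      Occ F (.fcons c g) .forest s e (.inl i :: (L₁ ++ L₂))

namespace Occ

variable {κ : CodeKind} {c : Code κ} {p : Loc (Fin n) (Fin F.numInt) κ} {s e : ℕ}
  {L : List (Fin n ⊕ Fin F.numInt)}

theorem adj {c : Code .tree} {u v : Fin n ⊕ Fin F.numInt} (h : F.Occ c (.tree u v) s e L) :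
    F.graph.Adj u v := by
  cases h <;> assumption

theorem mem_of_tree {c : Code .tree} {u v : Fin n ⊕ Fin F.numInt}
    (h : F.Occ c (.tree u v) s e L) : v ∈ L := by
  cases h <;> simp

theorem le (h : F.Occ c p s e L) : s ≤ e := by
  induction h <;> omega

theorem end_eq (h : F.Occ c p s e L) : e = s + c.numBd := by
  induction h <;> simp only [Code.numBd] <;> omega

theorem length_eq (h : F.Occ c p s e L) : L.length = c.size := by
  induction h <;> simp_all [Code.size]

theorem inl_mem_iff (h : F.Occ c p s e L) (j : Fin n) : Sum.inl j ∈ L ↔ s ≤ j ∧ (j : ℕ) < e := by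
  induction h with
  | @leaf u i g s e L hadj he hg ih =>
    have := hg.le
    simp only [List.mem_append, ih, List.mem_singleton, Sum.inl.injEq, Fin.ext_iff]
    omega
  | node hadj hh hcs ih => simpa using ih
  | lnil a t s => simp
  | lcons hx hc hcs ih1 ih2 =>
    have := hc.le
    have := hcs.le
    simp only [List.mem_append, ih1, ih2]
    omega
  | fnil s => simp
  | fcons hi hadj hc hg ih1 ih2 =>
    have := hc.le
    have := hg.le
    simp only [List.mem_cons, List.mem_append, ih1, ih2, Sum.inl.injEq, Fin.ext_iff]
    omega

/-- The children of `a` in a list, in the order of the rotation. -/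
theorem list_iterate : ∀ (cs : Code .list) {a : Fin F.numInt} {x t : Fin n ⊕ Fin F.numInt}
    {s e : ℕ} {L : List (Fin n ⊕ Fin F.numInt)}, F.Occ cs (.list a x t) s e L →
    (F.next a)^[cs.len] x = t ∧ ∀ j < cs.len, (F.next a)^[j] x ≠ t ∧ (F.next a)^[j] x ∈ L ∧
      F.graph.Adj (.inr a) ((F.next a)^[j] x)
  | .lnil, _, _, _, _, _, _, h => by
    cases h
    exact ⟨rfl, fun j hj => absurd hj (Nat.not_lt_zero j)⟩
  | .lcons c cs, _, _, _, _, _, _, h => by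
    cases h with
    | lcons hx hc hcs =>
      obtain ⟨h1, h2⟩ := list_iterate cs hcs
      refine ⟨h1, fun j hj => ?_⟩
      cases j with
      | zero => exact ⟨hx, List.mem_append_left _ hc.mem_of_tree, hc.adj⟩
      | succ j =>
        obtain ⟨h3, h4, h5⟩ := h2 j (Nat.lt_of_succ_lt_succ hj)
        exact ⟨h3, List.mem_append_right _ h4, h5⟩

theorem list_iterate_ne {cs : Code .list} {a : Fin F.numInt} {x t : Fin n ⊕ Fin F.numInt}
    (h : F.Occ cs (.list a x t) s e L) {i j : ℕ} (hij : i < j) (hj : j ≤ cs.len) :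
    (F.next a)^[i] x ≠ (F.next a)^[j] x := by
  obtain ⟨h1, h2⟩ := list_iterate cs h
  intro heq
  have h3 := congrArg ((F.next a)^[cs.len - j]) heq
  rw [← Function.iterate_add_apply, ← Function.iterate_add_apply, Nat.sub_add_cancel hj, h1] at h3
  exact (h2 _ (by omega)).1 h3

/-- The neighbours of an internal vertex in the order of the rotation, from the parent `u` on. -/
theorem exists_iterate_of_adj {cs : Code .list} {a : Fin F.numInt} {u : Fin n ⊕ Fin F.numInt}
    (hu : F.graph.Adj (.inr a) u) (h : F.Occ cs (.list a (F.next a u) u) s e L)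
    {y : Fin n ⊕ Fin F.numInt} (hy : F.graph.Adj (.inr a) y) :
    ∃ k ≤ cs.len, (F.next a)^[k] u = y := by
  obtain ⟨h1, -⟩ := list_iterate cs h
  obtain ⟨k, hk⟩ := F.next_cycle a u y hu hy
  have h2 : Function.IsPeriodicPt (F.next a) (cs.len + 1) u := h1
  exact ⟨k % (cs.len + 1), Nat.le_of_lt_succ (Nat.mod_lt _ (Nat.succ_pos _)),
    (h2.iterate_mod_apply k).trans hk⟩

theorem deg_eq {cs : Code .list} {a : Fin F.numInt} {u : Fin n ⊕ Fin F.numInt}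
    (hu : F.graph.Adj (.inr a) u) (h : F.Occ cs (.list a (F.next a u) u) s e L) :
    F.deg (.inr a) = cs.len + 1 := by
  obtain ⟨h1, h2⟩ := list_iterate cs h
  have himg : F.graph.neighborSet (.inr a) =
      (fun k => (F.next a)^[k] u) '' (Finset.range (cs.len + 1) : Set ℕ) := by
    ext y
    simp only [SimpleGraph.mem_neighborSet, Set.mem_image, Finset.coe_range, Set.mem_Iio]
    constructor
    · intro hy
      obtain ⟨k, hk, hk'⟩ := exists_iterate_of_adj hu h hy
      exact ⟨k, by omega, hk'⟩
    · rintro ⟨k, hk, rfl⟩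
      cases k with
      | zero => exact hu
      | succ k => exact (h2 k (by omega)).2.2
  have hinj : Set.InjOn (fun k => (F.next a)^[k] u) (Finset.range (cs.len + 1) : Set ℕ) := by
    have key : ∀ i j, i < j → j < cs.len + 1 → (F.next a)^[i] u ≠ (F.next a)^[j] u := by
      intro i j hij hj heq
      obtain ⟨j, rfl⟩ : ∃ j', j = j' + 1 := ⟨j - 1, by omega⟩
      rw [Function.iterate_succ_apply] at heq
      cases i with
      | zero => exact (h2 j (by omega)).1 heq.symm
      | succ i => exact list_iterate_ne h (Nat.lt_of_succ_lt_succ hij) (by omega) heq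
    intro i hi j hj heq
    simp only [Finset.coe_range, Set.mem_Iio] at hi hj
    rcases lt_trichotomy i j with h3 | h3 | h3
    · exact absurd heq (key i j h3 hj)
    · exact h3
    · exact absurd heq.symm (key j i h3 hi)
  rw [deg, himg, hinj.ncard_image, Set.ncard_coe_finset, Finset.card_range]

theorem mem_or_anchor_of_adj (hb : F.BoundaryDegOne) (h : F.Occ c p s e L)
    {x y : Fin n ⊕ Fin F.numInt} (hx : x ∈ L) (hxy : F.graph.Adj x y) :
    y ∈ L ∨ p.anchor = some y := by
  induction h with
  | @leaf u i g s e L hadj he hg ih =>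
    rcases List.mem_append.1 hx with hx | hx
    · rcases ih hx with h | h
      · exact .inl (List.mem_append_left _ h)
      · cases h
    · rw [List.mem_singleton] at hx
      subst hx
      exact .inr (congrArg some ((hb.adj_iff.1 hadj.symm).trans (hb.adj_iff.1 hxy).symm))
  | @node u a h cs s e L hadj hh hcs ih =>
    rcases List.mem_cons.1 hx with hx | hx
    · subst hx
      obtain ⟨k, hk, rfl⟩ := exists_iterate_of_adj hadj.symm hcs hxy
      cases k with
      | zero => exact .inr rfl
      | succ k => exact .inl (List.mem_cons_of_mem _ ((list_iterate cs hcs).2 k hk).2.1)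
    · rcases ih hx with h | h
      · exact .inl (List.mem_cons_of_mem _ h)
      · cases h; exact .inl List.mem_cons_self
  | lnil a t s => cases hx
  | lcons hx' hc hcs ih1 ih2 =>
    rcases List.mem_append.1 hx with hx | hx
    · exact (ih1 hx).imp (List.mem_append_left _) id
    · exact (ih2 hx).imp (List.mem_append_right _) id
  | fnil s => cases hx
  | @fcons i v c g s m e L₁ L₂ hi hadj hc hg ih1 ih2 =>
    refine .inl ?_
    rcases List.mem_cons.1 hx with hx | hx
    · subst hx
      rw [(hb.adj_iff.1 hxy).trans (hb.adj_iff.1 hadj).symm]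
      exact List.mem_cons_of_mem _ (List.mem_append_left _ hc.mem_of_tree)
    · rcases List.mem_append.1 hx with hx | hx
      · rcases ih1 hx with h | h
        · exact List.mem_cons_of_mem _ (List.mem_append_left _ h)
        · cases h; exact List.mem_cons_self
      · rcases ih2 hx with h | h
        · exact List.mem_cons_of_mem _ (List.mem_append_right _ h)
        · cases h

theorem mem_of_reachable (hb : F.BoundaryDegOne) (h : F.Occ c p s e L)
    {x y : Fin n ⊕ Fin F.numInt} (hx : x ∈ L) (hxy : F.graph.Reachable x y)
    (ha : ∀ u, p.anchor = some u → ¬ F.graph.Reachable x u) : y ∈ L := by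
  refine (hxy.induct (p := fun y => F.graph.Reachable x y ∧ y ∈ L) ⟨.refl _, hx⟩ ?_).2
  rintro y z ⟨h1, h2⟩ hyz
  have h3 := h1.trans hyz.reachable
  exact ⟨h3, (h.mem_or_anchor_of_adj hb h2 hyz).resolve_right fun h4 => ha z h4 h3⟩

theorem forest_mem_of_reachable (hb : F.BoundaryDegOne) {c : Code .forest}
    (h : F.Occ c .forest s e L) {x y : Fin n ⊕ Fin F.numInt} (hx : x ∈ L)
    (hxy : F.graph.Reachable x y) : y ∈ L :=
  h.mem_of_reachable hb hx hxy fun _ h => nomatch h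

/-- Among the vertices that are read at a place, those in the tree of its anchor lie beyond the
edge, or beyond one of the edges, at which the reading starts; the others are in the gaps. -/
theorem mem_branch (hb : F.BoundaryDegOne) (h : F.Occ c p s e L) {x : Fin n ⊕ Fin F.numInt}
    (hx : x ∈ L) : match p with
      | .tree u v => F.graph.Reachable x v → x ∈ F.graph.branch u v
      | .list a y _ => F.graph.Reachable x (.inr a) →
          ∃ k < c.len, x ∈ F.graph.branch (.inr a) ((F.next a)^[k] y)
      | .forest => True := by
  induction h with
  | @leaf u i g s e L hadj he hg ih =>
    intro hr
    rcases List.mem_append.1 hx with hx | hx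
    · have := (hg.inl_mem_iff i).1 (hg.forest_mem_of_reachable hb hx hr)
      omega
    · rw [List.mem_singleton] at hx
      subst hx
      exact SimpleGraph.self_mem_branch _ _
  | @node u a h cs s e L hadj hh hcs ih =>
    intro hr
    rcases List.mem_cons.1 hx with hx | hx
    · subst hx
      exact SimpleGraph.self_mem_branch _ _
    · obtain ⟨k, hk, hk'⟩ := ih hx hr
      obtain ⟨h1, -, h2⟩ := (list_iterate cs hcs).2 k hk
      exact F.acyclic.branch_subset hadj h2 h1 hk'
  | lnil a t s => cases hx
  | @lcons a x t c cs s m e L₁ L₂ hx' hc hcs ih1 ih2 =>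
    intro hr
    rcases List.mem_append.1 hx with hx | hx
    · exact ⟨0, Nat.succ_pos _, ih1 hx (hr.trans hc.adj.reachable)⟩
    · obtain ⟨k, hk, hk'⟩ := ih2 hx hr
      exact ⟨k + 1, Nat.succ_lt_succ hk, hk'⟩
  | fnil s => trivial
  | fcons hi hadj hc hg ih1 ih2 => trivial

theorem nodup (hb : F.BoundaryDegOne) (hr : F.ReachesBoundary) (h : F.Occ c p s e L) :
    L.Nodup := by
  induction h with
  | @leaf u i g s e L hadj he hg ih =>
    refine List.nodup_append'.2 ⟨ih, List.nodup_singleton _, ?_⟩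
    rw [List.disjoint_singleton, hg.inl_mem_iff]
    omega
  | @node u a h cs s e L hadj hh hcs ih =>
    refine List.nodup_cons.2 ⟨fun hm => ?_, ih⟩
    obtain ⟨k, hk, hk'⟩ := hcs.mem_branch hb hm (.refl _)
    exact SimpleGraph.notMem_branch ((list_iterate cs hcs).2 k hk).2.2.ne' hk'
  | lnil a t s => exact List.nodup_nil
  | @lcons a x t c cs s m e L₁ L₂ hx' hc hcs ih1 ih2 =>
    refine List.nodup_append'.2 ⟨ih1, ih2, fun y h1 h2 => ?_⟩
    by_cases hy : F.graph.Reachable y (.inr a)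
    · obtain ⟨k, hk, hk'⟩ := hcs.mem_branch hb h2 hy
      have h3 := F.acyclic.eq_of_mem_branch hc.adj ((list_iterate cs hcs).2 k hk).2.2
        (hc.mem_branch hb h1 (hy.trans hc.adj.reachable)) hk'
      exact list_iterate_ne (Occ.lcons hx' hc hcs) (Nat.succ_pos k) (Nat.succ_le_succ hk.le) h3
    · obtain ⟨j, hj⟩ := hr.exists_reachable y
      have ha : ∀ u, some (Sum.inr a : Fin n ⊕ Fin F.numInt) = some u →
          ¬ F.graph.Reachable y u := by
        rintro _ ⟨rfl⟩; exact hy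
      have h3 := (hc.inl_mem_iff j).1 (hc.mem_of_reachable hb h1 hj ha)
      have h4 := (hcs.inl_mem_iff j).1 (hcs.mem_of_reachable hb h2 hj ha)
      omega
  | fnil s => exact List.nodup_nil
  | @fcons i v c g s m e L₁ L₂ hi hadj hc hg ih1 ih2 =>
    have hle := hc.le
    refine List.nodup_cons.2 ⟨?_, List.nodup_append'.2 ⟨ih1, ih2, fun y h1 h2 => ?_⟩⟩
    · rw [List.mem_append, hc.inl_mem_iff, hg.inl_mem_iff]
      omega
    · by_cases hy : F.graph.Reachable y (.inl i)
      · have := (hg.inl_mem_iff i).1 (hg.forest_mem_of_reachable hb h2 hy)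
        omega
      · obtain ⟨j, hj⟩ := hr.exists_reachable y
        have h3 := (hc.inl_mem_iff j).1 (hc.mem_of_reachable hb h1 hj
          (by rintro _ ⟨rfl⟩; exact hy))
        have h4 := (hg.inl_mem_iff j).1 (hg.forest_mem_of_reachable hb h2 hj)
        omega

theorem mem_of_forest (hb : F.BoundaryDegOne) (hr : F.ReachesBoundary) {c : Code .forest}
    (h : F.Occ c .forest 0 n L) (x : Fin n ⊕ Fin F.numInt) : x ∈ L := by
  obtain ⟨i, hi⟩ := hr.exists_reachable x
  exact h.forest_mem_of_reachable hb ((h.inl_mem_iff i).2 ⟨Nat.zero_le _, i.2⟩) hi.symm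

/-- The code that is read at a place is determined by the place and the labels where the reading
starts and, for a forest, ends. -/
theorem unique (hb : F.BoundaryDegOne) (h : F.Occ c p s e L) {c' : Code κ} {e' : ℕ}
    {L' : List (Fin n ⊕ Fin F.numInt)} (h' : F.Occ c' p s e' L') (he : κ = .forest → e = e') :
    c = c' ∧ e = e' := by
  induction h generalizing e' L' with
  | leaf hadj he₁ hg ih =>
    cases h' with
    | leaf hadj' he₂ hg' =>
      obtain ⟨rfl, -⟩ := ih hg' fun _ => rfl
      exact ⟨rfl, he₁.trans he₂.symm⟩
  | node hadj hh hcs ih =>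
    cases h' with
    | node hadj' hh' hcs' =>
      obtain ⟨rfl, rfl⟩ := ih hcs' nofun
      exact ⟨by rw [← hh, ← hh'], rfl⟩
  | lnil a t s =>
    cases h' with
    | lnil => exact ⟨rfl, rfl⟩
    | lcons hx => exact absurd rfl hx
  | lcons hx hc hcs ih1 ih2 =>
    cases h' with
    | lnil => exact absurd rfl hx
    | lcons hx' hc' hcs' =>
      obtain ⟨rfl, rfl⟩ := ih1 hc' nofun
      obtain ⟨rfl, rfl⟩ := ih2 hcs' nofun
      exact ⟨rfl, rfl⟩
  | fnil s =>
    cases h' with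
    | fnil => exact ⟨rfl, rfl⟩
    | fcons hi hadj hc hg =>
      have := hc.le
      have := hg.le
      have := he rfl
      omega
  | fcons hi hadj hc hg ih1 ih2 =>
    cases h' with
    | fnil =>
      have := hc.le
      have := hg.le
      have := he rfl
      omega
    | fcons hi' hadj' hc' hg' =>
      obtain rfl := Fin.ext (hi.trans hi'.symm)
      obtain rfl := (hb.adj_iff.1 hadj).trans (hb.adj_iff.1 hadj').symm
      obtain ⟨rfl, rfl⟩ := ih1 hc' nofun
      obtain ⟨rfl, rfl⟩ := ih2 hg' he
      exact ⟨rfl, rfl⟩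

end Occ

end PreForest
end

noncomputable section

/-! ### Codes and isomorphisms -/

/-- The image of a place under a renumbering of the internal vertices. -/
def Loc.map {B I J : Type} (f : I → J) : {κ : CodeKind} → Loc B I κ → Loc B J κ
  | _, .tree u v => .tree (Sum.map id f u) (Sum.map id f v)
  | _, .list a x t => .list (f a) (Sum.map id f x) (Sum.map id f t)
  | _, .forest => .forest

namespace PreForest

variable {n : ℕ} {F F' : PreForest n}

namespace Occ

theorem map {κ : CodeKind} {c : Code κ} {p : Loc (Fin n) (Fin F.numInt) κ} {s e : ℕ}
    {L : List (Fin n ⊕ Fin F.numInt)} (h : F.Occ c p s e L) (f : Fin F.numInt ≃ Fin F'.numInt)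
    (hadj : ∀ u w, F.graph.Adj u w → F'.graph.Adj (Sum.map id f u) (Sum.map id f w))
    (hnext : ∀ v u, F.graph.Adj (Sum.inr v) u →
      F'.next (f v) (Sum.map id f u) = Sum.map id f (F.next v u))
    (hhel : ∀ v, F'.hel (f v) = F.hel v) :
    F'.Occ c (p.map f) s e (L.map (Sum.map id f)) := by
  induction h with
  | leaf h1 he hg ih =>
    rw [List.map_append]
    exact .leaf (hadj _ _ h1) he ih
  | @node u a h cs s e L h1 hh hcs ih =>
    refine .node (hadj _ _ h1) ((hhel a).trans hh) ?_
    rw [hnext a u h1.symm]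
    exact ih
  | lnil a t s => exact .lnil _ _ _
  | @lcons a x t c cs s m e L₁ L₂ hx hc hcs ih1 ih2 =>
    rw [List.map_append]
    have hinj : Function.Injective (Sum.map (id : Fin n → Fin n) f) :=
      Function.injective_id.sumMap f.injective
    refine .lcons (fun h => hx (hinj h)) ih1 ?_
    rw [hnext a x hc.adj]
    exact ih2
  | fnil s => exact .fnil s
  | fcons hi h1 hc hg ih1 ih2 =>
    rw [List.map_cons, List.map_append]
    exact .fcons hi (hadj _ _ h1) ih1 ih2

/-- The vertices `x` and `y` have the same place in the same code that is read at `p` and `q`: they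
have the same index in the lists of the vertices that are read, or both are the anchors. -/
def Corr {κ : CodeKind} (L : List (Fin n ⊕ Fin F.numInt)) (L' : List (Fin n ⊕ Fin F'.numInt))
    (p : Loc (Fin n) (Fin F.numInt) κ) (q : Loc (Fin n) (Fin F'.numInt) κ)
    (x : Fin n ⊕ Fin F.numInt) (y : Fin n ⊕ Fin F'.numInt) : Prop :=
  (x, y) ∈ List.zip L L' ∨ (p.anchor = some x ∧ q.anchor = some y)

theorem Corr.imp {κ κ' : CodeKind} {L M : List (Fin n ⊕ Fin F.numInt)}
    {L' M' : List (Fin n ⊕ Fin F'.numInt)}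
    {p : Loc (Fin n) (Fin F.numInt) κ} {q : Loc (Fin n) (Fin F'.numInt) κ}
    {p' : Loc (Fin n) (Fin F.numInt) κ'} {q' : Loc (Fin n) (Fin F'.numInt) κ'}
    {x : Fin n ⊕ Fin F.numInt} {y : Fin n ⊕ Fin F'.numInt} (h : Corr L L' p q x y)
    (h1 : ∀ z ∈ List.zip L L', z ∈ List.zip M M')
    (h2 : p.anchor = some x → q.anchor = some y → Corr M M' p' q' x y) : Corr M M' p' q' x y :=
  h.elim (fun h => .inl (h1 _ h)) fun h => h2 h.1 h.2

theorem mem_zip_of_tree {c : Code .tree} {u v : Fin n ⊕ Fin F.numInt}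
    {u' v' : Fin n ⊕ Fin F'.numInt} {s e s' e' : ℕ} {L : List (Fin n ⊕ Fin F.numInt)}
    {L' : List (Fin n ⊕ Fin F'.numInt)} (h : F.Occ c (.tree u v) s e L)
    (h' : F'.Occ c (.tree u' v') s' e' L') : (v, v') ∈ List.zip L L' := by
  cases h with
  | leaf hadj he hg =>
    cases h' with
    | leaf hadj' he' hg' =>
      rw [List.zip_append (hg.length_eq.trans hg'.length_eq.symm)]
      exact List.mem_append_right _ (List.mem_singleton_self _)
  | node hadj hh hcs =>
    cases h' with
    | node hadj' hh' hcs' => exact List.mem_cons_self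

theorem mem_zip_iterate : ∀ (cs : Code .list) {a : Fin F.numInt} {x t : Fin n ⊕ Fin F.numInt}
    {a' : Fin F'.numInt} {x' t' : Fin n ⊕ Fin F'.numInt} {s e s' e' : ℕ}
    {L : List (Fin n ⊕ Fin F.numInt)} {L' : List (Fin n ⊕ Fin F'.numInt)},
    F.Occ cs (.list a x t) s e L → F'.Occ cs (.list a' x' t') s' e' L' →
    ∀ j < cs.len, ((F.next a)^[j] x, (F'.next a')^[j] x') ∈ List.zip L L'
  | .lnil, _, _, _, _, _, _, _, _, _, _, _, _, _, _ => fun j hj => absurd hj (Nat.not_lt_zero j)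
  | .lcons c cs, _, _, _, _, _, _, _, _, _, _, _, _, h, h' => by
    cases h with
    | lcons hx hc hcs =>
      cases h' with
      | lcons hx' hc' hcs' =>
        intro j hj
        rw [List.zip_append (hc.length_eq.trans hc'.length_eq.symm)]
        cases j with
        | zero => exact List.mem_append_left _ (mem_zip_of_tree hc hc')
        | succ j =>
          exact List.mem_append_right _ (mem_zip_iterate cs hcs hcs' j (Nat.lt_of_succ_lt_succ hj))

theorem eq_of_mem_zip {κ : CodeKind} {c : Code κ} {p : Loc (Fin n) (Fin F.numInt) κ}
    {q : Loc (Fin n) (Fin F'.numInt) κ} {s e e' : ℕ} {L : List (Fin n ⊕ Fin F.numInt)}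
    {L' : List (Fin n ⊕ Fin F'.numInt)} (h : F.Occ c p s e L) (h' : F'.Occ c q s e' L')
    {x : Fin n ⊕ Fin F.numInt} {y : Fin n ⊕ Fin F'.numInt} (hxy : (x, y) ∈ List.zip L L') :
    (∃ i, x = .inl i ∧ y = .inl i) ∨ ∃ a b, x = .inr a ∧ y = .inr b ∧ F'.hel b = F.hel a := by
  induction h generalizing e' L' with
  | @leaf u i g s e L hadj he hg ih =>
    cases h' with
    | @leaf u' i' _ _ _ L' hadj' he' hg' =>
      have h1 := hg.end_eq
      have h2 := hg'.end_eq
      obtain rfl : i = i' := Fin.ext (h1.trans h2.symm)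
      rw [List.zip_append (hg.length_eq.trans hg'.length_eq.symm)] at hxy
      rcases List.mem_append.1 hxy with hxy | hxy
      · exact ih hg' hxy
      · cases List.mem_singleton.1 hxy
        exact .inl ⟨i, rfl, rfl⟩
  | @node u a h cs s e L hadj hh hcs ih =>
    cases h' with
    | @node u' a' _ _ _ _ L' hadj' hh' hcs' =>
      rcases List.mem_cons.1 hxy with hxy | hxy
      · cases hxy
        exact .inr ⟨a, a', rfl, rfl, hh'.trans hh.symm⟩
      · exact ih hcs' hxy
  | lnil a t s => exact absurd hxy (by simp)
  | lcons hx hc hcs ih1 ih2 =>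
    cases h' with
    | lcons hx' hc' hcs' =>
      rw [List.zip_append (hc.length_eq.trans hc'.length_eq.symm)] at hxy
      obtain rfl := hc.end_eq.trans hc'.end_eq.symm
      exact (List.mem_append.1 hxy).elim (ih1 hc') (ih2 hcs')
  | fnil s => exact absurd hxy (by simp)
  | @fcons i v c g s m e L₁ L₂ hi hadj hc hg ih1 ih2 =>
    cases h' with
    | @fcons i' v' _ _ _ m' _ L₁' L₂' hi' hadj' hc' hg' =>
      obtain rfl : i = i' := Fin.ext (hi.trans hi'.symm)
      obtain rfl := hc.end_eq.trans hc'.end_eq.symm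
      rw [List.zip_cons_cons] at hxy
      rcases List.mem_cons.1 hxy with hxy | hxy
      · cases hxy
        exact .inl ⟨i, rfl, rfl⟩
      · rw [List.zip_append (hc.length_eq.trans hc'.length_eq.symm)] at hxy
        exact (List.mem_append.1 hxy).elim (ih1 hc') (ih2 hg')

theorem exists_corr_of_adj (hb : F.BoundaryDegOne) {κ : CodeKind} {c : Code κ}
    {p : Loc (Fin n) (Fin F.numInt) κ} {q : Loc (Fin n) (Fin F'.numInt) κ} {s e s' e' : ℕ}
    {L : List (Fin n ⊕ Fin F.numInt)} {L' : List (Fin n ⊕ Fin F'.numInt)} (h : F.Occ c p s e L)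
    (h' : F'.Occ c q s' e' L') {x : Fin n ⊕ Fin F.numInt} {x' : Fin n ⊕ Fin F'.numInt}
    (hxy : (x, x') ∈ List.zip L L') {y : Fin n ⊕ Fin F.numInt} (hy : F.graph.Adj x y) :
    ∃ y', Corr L L' p q y y' ∧ F'.graph.Adj x' y' ∧
      ∀ a a', x = .inr a → x' = .inr a' → Corr L L' p q (F.next a y) (F'.next a' y') := by
  induction h generalizing s' e' L' with
  | @leaf u i g s e L hadj he hg ih =>
    cases h' with
    | @leaf u' i' _ _ _ L' hadj' he' hg' =>
      rw [List.zip_append (hg.length_eq.trans hg'.length_eq.symm)] at hxy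
      have hsub : ∀ z ∈ List.zip L L', z ∈ List.zip (L ++ [Sum.inl i]) (L' ++ [Sum.inl i']) :=
        fun z hz => by
          rw [List.zip_append (hg.length_eq.trans hg'.length_eq.symm)]
          exact List.mem_append_left _ hz
      rcases List.mem_append.1 hxy with hxy | hxy
      · obtain ⟨y', h1, h2, h3⟩ := ih hg' hxy
        exact ⟨y', h1.imp hsub nofun, h2, fun a a' ha ha' => (h3 a a' ha ha').imp hsub nofun⟩
      · cases List.mem_singleton.1 hxy
        obtain rfl : y = u := (hb.adj_iff.1 hy).trans (hb.adj_iff.1 hadj.symm).symm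
        exact ⟨u', .inr ⟨rfl, rfl⟩, hadj'.symm, nofun⟩
  | @node u a h cs s e L hadj hh hcs ih =>
    cases h' with
    | @node u' a' _ _ _ _ L' hadj' hh' hcs' =>
      have hk : ∀ k ≤ cs.len + 1, Corr (.inr a :: L) (.inr a' :: L') (.tree u (.inr a))
          (.tree u' (.inr a')) ((F.next a)^[k] u) ((F'.next a')^[k] u') := by
        intro k hk
        cases k with
        | zero => exact .inr ⟨rfl, rfl⟩
        | succ k =>
          rcases Nat.lt_or_eq_of_le (Nat.le_of_succ_le_succ hk) with hk | rfl
          · exact .inl (List.mem_cons_of_mem _ (mem_zip_iterate cs hcs hcs' k hk))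
          · rw [Function.iterate_succ_apply, Function.iterate_succ_apply,
              (list_iterate cs hcs).1, (list_iterate cs hcs').1]
            exact .inr ⟨rfl, rfl⟩
      have hsub : ∀ z ∈ List.zip L L', z ∈ List.zip (Sum.inr a :: L) (Sum.inr a' :: L') :=
        fun z hz => List.mem_cons_of_mem _ hz
      have hanc : ∀ {z z'}, Loc.anchor (.list a (F.next a u) u) = some z →
          Loc.anchor (.list a' (F'.next a' u') u') = some z' →
          Corr (.inr a :: L) (.inr a' :: L') (.tree u (.inr a)) (.tree u' (.inr a')) z z' := by
        rintro z z' ⟨rfl⟩ ⟨rfl⟩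
        exact .inl List.mem_cons_self
      rcases List.mem_cons.1 hxy with hxy | hxy
      · cases hxy
        obtain ⟨k, hk', rfl⟩ := exists_iterate_of_adj hadj.symm hcs hy
        refine ⟨(F'.next a')^[k] u', hk k (by omega), ?_, ?_⟩
        · cases k with
          | zero => exact hadj'.symm
          | succ k => exact ((list_iterate cs hcs').2 k hk').2.2
        · rintro _ _ ⟨rfl⟩ ⟨rfl⟩
          rw [← Function.iterate_succ_apply' (F.next _), ← Function.iterate_succ_apply' (F'.next _)]
          exact hk (k + 1) (by omega)
      · obtain ⟨y', h1, h2, h3⟩ := ih hcs' hxy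
        exact ⟨y', h1.imp hsub hanc, h2, fun a a' ha ha' => (h3 a a' ha ha').imp hsub hanc⟩
  | lnil a t s => exact absurd hxy (by simp)
  | @lcons a x t c cs s m e L₁ L₂ hx hc hcs ih1 ih2 =>
    cases h' with
    | @lcons a' x' t' _ _ _ m' _ L₁' L₂' hx' hc' hcs' =>
      have hlen := hc.length_eq.trans hc'.length_eq.symm
      rw [List.zip_append hlen] at hxy
      simp only [Corr, List.zip_append hlen, List.mem_append] at ih1 ih2 ⊢
      rcases List.mem_append.1 hxy with hxy | hxy
      · obtain ⟨y', h1, h2, h3⟩ := ih1 hc' hxy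
        exact ⟨y', h1.imp .inl id, h2, fun a a' ha ha' => (h3 a a' ha ha').imp .inl id⟩
      · obtain ⟨y', h1, h2, h3⟩ := ih2 hcs' hxy
        exact ⟨y', h1.imp .inr id, h2, fun a a' ha ha' => (h3 a a' ha ha').imp .inr id⟩
  | fnil s => exact absurd hxy (by simp)
  | @fcons i v c g s m e L₁ L₂ hi hadj hc hg ih1 ih2 =>
    cases h' with
    | @fcons i' v' _ _ _ m' _ L₁' L₂' hi' hadj' hc' hg' =>
      have hlen := hc.length_eq.trans hc'.length_eq.symm
      have hsub1 : ∀ z ∈ List.zip L₁ L₁', z ∈ List.zip (Sum.inl i :: (L₁ ++ L₂))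
          (Sum.inl i' :: (L₁' ++ L₂')) := fun z hz => by
        rw [List.zip_cons_cons, List.zip_append hlen]
        exact List.mem_cons_of_mem _ (List.mem_append_left _ hz)
      have hsub2 : ∀ z ∈ List.zip L₂ L₂', z ∈ List.zip (Sum.inl i :: (L₁ ++ L₂))
          (Sum.inl i' :: (L₁' ++ L₂')) := fun z hz => by
        rw [List.zip_cons_cons, List.zip_append hlen]
        exact List.mem_cons_of_mem _ (List.mem_append_right _ hz)
      have hanc : ∀ {z z'}, Loc.anchor (.tree (.inl i) v) = some z →
          Loc.anchor (.tree (.inl i') v') = some z' →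
          Corr (.inl i :: (L₁ ++ L₂)) (.inl i' :: (L₁' ++ L₂')) .forest .forest z z' := by
        rintro z z' ⟨rfl⟩ ⟨rfl⟩
        exact .inl List.mem_cons_self
      rw [List.zip_cons_cons] at hxy
      rcases List.mem_cons.1 hxy with hxy | hxy
      · cases hxy
        obtain rfl : y = v := (hb.adj_iff.1 hy).trans (hb.adj_iff.1 hadj).symm
        exact ⟨v', .inl (hsub1 _ (mem_zip_of_tree hc hc')), hadj', nofun⟩
      · rw [List.zip_append hlen] at hxy
        rcases List.mem_append.1 hxy with hxy | hxy
        · obtain ⟨y', h1, h2, h3⟩ := ih1 hc' hxy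
          exact ⟨y', h1.imp hsub1 hanc, h2, fun a a' ha ha' => (h3 a a' ha ha').imp hsub1 hanc⟩
        · obtain ⟨y', h1, h2, h3⟩ := ih2 hg' hxy
          exact ⟨y', h1.imp hsub2 nofun, h2, fun a a' ha ha' => (h3 a a' ha ha').imp hsub2 nofun⟩

end Occ

theorem _root_.List.exists_mem_zip_of_mem {α β : Type*} {l : List α} {l' : List β}
    (h : l.length = l'.length) {x : α} (hx : x ∈ l) : ∃ y, (x, y) ∈ List.zip l l' := by
  obtain ⟨i, hi, rfl⟩ := List.getElem_of_mem hx
  refine ⟨l'[i]'(h ▸ hi), List.mem_of_getElem (i := i) (h := by simp; omega) ?_⟩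
  rw [List.getElem_zip]

theorem _root_.List.Nodup.eq_of_mem_zip {α β : Type*} {l : List α} {l' : List β} (h : l.Nodup)
    {x : α} {y y' : β} (hy : (x, y) ∈ List.zip l l') (hy' : (x, y') ∈ List.zip l l') : y = y' := by
  obtain ⟨i, hi, h1⟩ := List.getElem_of_mem hy
  obtain ⟨j, hj, h2⟩ := List.getElem_of_mem hy'
  rw [List.getElem_zip, Prod.mk.injEq] at h1 h2
  obtain rfl := (h.getElem_inj_iff).1 (h1.1.trans h2.1.symm)
  exact h1.2.symm.trans h2.2

/-- Forests with the same code are isomorphic: the vertices that are read at the same time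
correspond. -/
theorem exists_equiv_of_occ (hb : F.BoundaryDegOne) (hr : F.ReachesBoundary)
    (hb' : F'.BoundaryDegOne) (hr' : F'.ReachesBoundary) {c : Code .forest}
    {L : List (Fin n ⊕ Fin F.numInt)} {L' : List (Fin n ⊕ Fin F'.numInt)}
    (h : F.Occ c .forest 0 n L) (h' : F'.Occ c .forest 0 n L') :
    ∃ e : Fin F.numInt ≃ Fin F'.numInt,
      (∀ u w, F'.graph.Adj (Sum.map id e u) (Sum.map id e w) ↔ F.graph.Adj u w) ∧
      (∀ v u, F.graph.Adj (Sum.inr v) u →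
        F'.next (e v) (Sum.map id e u) = Sum.map id e (F.next v u)) ∧
      (∀ v, F'.hel (e v) = F.hel v) := by
  have hlen := h.length_eq.trans h'.length_eq.symm
  have hex : ∀ a : Fin F.numInt, ∃ b : Fin F'.numInt, (Sum.inr a, Sum.inr b) ∈ List.zip L L' ∧
      F'.hel b = F.hel a := by
    intro a
    obtain ⟨y, hy⟩ := List.exists_mem_zip_of_mem hlen (h.mem_of_forest hb hr (.inr a))
    rcases h.eq_of_mem_zip h' hy with ⟨i, h1, -⟩ | ⟨a', b, h1, rfl, h2⟩
    · cases h1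
    · cases h1; exact ⟨b, hy, h2⟩
  choose f hf hhel using hex
  have hflip : ∀ {x y}, (x, y) ∈ List.zip L L' ↔ (y, x) ∈ List.zip L' L := fun {x y} => by
    rw [← List.zip_swap, List.mem_map]
    constructor
    · rintro ⟨⟨z, w⟩, hz, hzw⟩; cases hzw; exact hz
    · exact fun hz => ⟨_, hz, rfl⟩
  have hmap : ∀ {x y}, (x, y) ∈ List.zip L L' → y = Sum.map id f x := by
    intro x y hxy
    rcases h.eq_of_mem_zip h' hxy with ⟨i, rfl, rfl⟩ | ⟨a, b, rfl, rfl, -⟩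
    · rfl
    · exact (h.nodup hb hr).eq_of_mem_zip hxy (hf a)
  have hmem : ∀ x, (x, Sum.map id f x) ∈ List.zip L L' := by
    intro x
    obtain ⟨y, hy⟩ := List.exists_mem_zip_of_mem hlen (h.mem_of_forest hb hr x)
    exact hmap hy ▸ hy
  have hinj : Function.Injective f := fun a a' haa => by
    have h1 := hflip.1 (hf a)
    rw [haa] at h1
    exact Sum.inr_injective ((h'.nodup hb' hr').eq_of_mem_zip h1 (hflip.1 (hf a')))
  have hsurj : Function.Surjective f := fun b => by
    obtain ⟨x, hx⟩ := List.exists_mem_zip_of_mem hlen.symm (h'.mem_of_forest hb' hr' (.inr b))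
    have h1 := hmap (hflip.2 hx)
    rcases x with i | a
    · cases h1
    · exact ⟨a, Sum.inr_injective h1.symm⟩
  have hinj' : Function.Injective (Sum.map (id : Fin n → Fin n) f) :=
    Function.injective_id.sumMap hinj
  refine ⟨Equiv.ofBijective f ⟨hinj, hsurj⟩, fun u w => ⟨fun huw => ?_, fun huw => ?_⟩,
    fun v u huv => ?_, hhel⟩
  · obtain ⟨y, h1 | h1, h2, -⟩ := h'.exists_corr_of_adj hb' h (hflip.1 (hmem u)) huw
    · rw [← hinj' (hmap (hflip.2 h1))] at h2; exact h2
    · exact nomatch h1.1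
  · obtain ⟨y, h1 | h1, h2, -⟩ := h.exists_corr_of_adj hb h' (hmem u) huw
    · rw [hmap h1] at h2; exact h2
    · exact nomatch h1.1
  · obtain ⟨y, h1 | h1, -, h2⟩ := h.exists_corr_of_adj hb h' (hmem (.inr v)) huv
    · rw [hmap h1] at h2
      rcases h2 v (f v) rfl rfl with h3 | h3
      · exact hmap h3
      · exact nomatch h3.1
    · exact nomatch h1.1

end PreForest
end

noncomputable section

/-! ### Planar forests have codes -/

namespace PreForest

variable {n : ℕ} {F : PreForest n}

variable (F) in
/-- No path of the forest leads from the boundary vertices `s, …, e - 1` to other ones. -/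
def ClosedInterval (s e : ℕ) : Prop :=
  ∀ x y : Fin n, F.graph.Reachable (.inl x) (.inl y) → (s ≤ x ∧ (x : ℕ) < e) → s ≤ y ∧ (y : ℕ) < e

theorem ClosedInterval.sdiff {s m e : ℕ} (h : F.ClosedInterval s e) (h' : F.ClosedInterval s m)
    (hsm : s ≤ m) : F.ClosedInterval m e := by
  intro x y hxy hx
  have h1 := h x y hxy (by omega)
  refine ⟨?_, h1.2⟩
  by_contra hc
  have h2 := h' y x hxy.symm (by omega)
  omega

namespace BoundaryDegOne

variable (hb : F.BoundaryDegOne)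

/-- The dart `d` is on the boundary of the region that contains the corner of the disk just before
the label `s`. -/
def AtCorner (d : F.graph.Dart) (s : ℕ) : Prop :=
  ∃ k : Fin n, (k : ℕ) + 1 = s ∧ hb.face.SameCycle d (hb.out k)

theorem closedInterval_of_sameCycle (hp : F.IsPlanar) (hr : F.ReachesBoundary) {i k : Fin n}
    (hik : i < k) (hs : hb.face.SameCycle (hb.out i) (hb.out k)) :
    F.ClosedInterval (i + 1) (k + 1) := by
  intro x y hxy hx
  have := hb.mem_Ioc_of_reachable hp hr hik hs hxy ⟨by omega, by omega⟩
  omega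

variable {hb}

theorem AtCorner.face {d : F.graph.Dart} {s : ℕ} (h : hb.AtCorner d s) :
    hb.AtCorner (hb.face d) s := by
  obtain ⟨k, hk, h⟩ := h
  exact ⟨k, hk, Equiv.Perm.sameCycle_apply_left.2 h⟩

theorem face_eq {u : Fin n ⊕ Fin F.numInt} {a : Fin F.numInt} (h : F.graph.Adj u (.inr a)) :
    hb.face ⟨(u, .inr a), h⟩ = ⟨(.inr a, F.next a u), F.next_adj a u h.symm⟩ := by
  obtain ⟨h1, h2⟩ := hb.rot_inr (d := SimpleGraph.Dart.symm ⟨(u, .inr a), h⟩) (v := a) rfl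
  exact dart_ext h1 h2

/-- Reading a list of planted trees, if each of its trees can be read. -/
theorem exists_occ_list {s₀ e₀ : ℕ} {a : Fin F.numInt} {u : Fin n ⊕ Fin F.numInt}
    (hu : F.graph.Adj (.inr a) u)
    (H : ∀ (w : Fin n ⊕ Fin F.numInt) (hw : F.graph.Adj (.inr a) w), w ≠ u → ∀ s, s₀ < s → s ≤ e₀ →
      hb.AtCorner ⟨(.inr a, w), hw⟩ s → ∃ c m L, F.Occ c (.tree (.inr a) w) s m L ∧ m ≤ e₀ ∧
        hb.AtCorner ⟨(w, .inr a), hw.symm⟩ m) (j : ℕ) :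
    ∀ (x : Fin n ⊕ Fin F.numInt) (hx : F.graph.Adj (.inr a) x) (s : ℕ), (F.next a)^[j] x = u →
      (∀ i < j, (F.next a)^[i] x ≠ u) → s₀ < s → s ≤ e₀ → hb.AtCorner ⟨(.inr a, x), hx⟩ s →
      ∃ cs m L, F.Occ cs (.list a x u) s m L ∧ m ≤ e₀ ∧ hb.AtCorner ⟨(.inr a, u), hu⟩ m := by
  induction j with
  | zero =>
    rintro x hx s rfl - - hs hc
    exact ⟨_, _, _, .lnil _ _ _, hs, hc⟩
  | succ j ih =>
    intro x hx s hj hne hs hs' hc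
    obtain ⟨c, m, L, h1, h2, h3⟩ := H x hx (hne 0 (Nat.succ_pos j)) s hs hs' hc
    replace h3 := h3.face
    rw [face_eq] at h3
    obtain ⟨cs, m', L', h4, h5, h6⟩ := ih _ _ m hj (fun i hi => hne (i + 1) (Nat.succ_lt_succ hi))
      (hs.trans_le h1.le) h2 h3
    exact ⟨_, _, _, .lcons (hne 0 (Nat.succ_pos j)) h1 h4, h5, h6⟩

/-- Reading a planted tree, if forests in the gaps can be read: walk around the tree, clockwise
around the region on the left. By planarity the gap before each boundary vertex on the way is an
interval of labels that no path leaves. -/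
theorem exists_occ_tree (hp : F.IsPlanar) (hr : F.ReachesBoundary) {i₀ : Fin n} {e₀ : ℕ}
    (hcl : F.ClosedInterval i₀ e₀)
    (H : ∀ s e : ℕ, i₀ < s → s ≤ e → e ≤ e₀ → F.ClosedInterval s e → ∃ c L, F.Occ c .forest s e L)
    (N : ℕ) :
    ∀ (u v : Fin n ⊕ Fin F.numInt) (huv : F.graph.Adj u v) (s : ℕ),
      (F.graph.branch u v).ncard ≤ N → .inl i₀ ∉ F.graph.branch u v →
      F.graph.Reachable (.inl i₀) v → i₀ < s → s ≤ e₀ → hb.AtCorner ⟨(u, v), huv⟩ s →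
      ∃ c m L, F.Occ c (.tree u v) s m L ∧ m ≤ e₀ ∧ hb.AtCorner ⟨(v, u), huv.symm⟩ m := by
  induction N with
  | zero =>
    intro u v huv s hN
    have := (Set.ncard_eq_zero (Set.toFinite _)).1 (Nat.le_zero.1 hN)
    exact absurd (SimpleGraph.self_mem_branch u v) (this ▸ Set.notMem_empty _)
  | succ N ih =>
    rintro u (l | a) huv s hN hi hri hs hs' hc
    · obtain ⟨k, rfl, hk⟩ := hc
      have hl := hcl i₀ l hri ⟨le_rfl, by omega⟩
      have hne : i₀ ≠ l := by
        rintro rfl; exact hi (SimpleGraph.self_mem_branch _ _)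
      have hne' : (i₀ : ℕ) ≠ l := fun h => hne (Fin.ext h)
      obtain ⟨l, hl'⟩ := l
      obtain ⟨l, rfl⟩ : ∃ l', l = l' + 1 := ⟨l - 1, by simp at hl hne'; omega⟩
      have hface : hb.face ⟨(u, .inl ⟨l + 1, hl'⟩), huv⟩ = hb.out ⟨l, by omega⟩ := by
        rw [face_apply, hb.eq_out (d := SimpleGraph.Dart.symm _) rfl, hb.rot_out_succ]
      have hsc : hb.face.SameCycle (hb.out k) (hb.out ⟨l, by omega⟩) :=
        hface ▸ Equiv.Perm.sameCycle_apply_right.2 hk.symm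
      simp only at hl hne'
      have hgap : F.ClosedInterval (k + 1) (l + 1) ∧ (k : ℕ) ≤ l := by
        rcases lt_trichotomy (k : ℕ) l with h | h | h
        · exact ⟨hb.closedInterval_of_sameCycle hp hr (k := ⟨l, by omega⟩) h hsc, h.le⟩
        · rw [h]
          exact ⟨fun x y _ hx => by omega, le_rfl⟩
        · have h1 := hb.closedInterval_of_sameCycle hp hr (i := ⟨l, by omega⟩) h hsc.symm _ _
            hri.symm
          simp only at h1
          omega
      obtain ⟨g, L, hg⟩ := H (k + 1) (l + 1) hs (by omega) (by omega) hgap.1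
      exact ⟨.leaf g, l + 2, _, .leaf huv rfl hg, by omega, ⟨l + 1, hl'⟩, rfl,
        hb.eq_out (d := ⟨(.inl ⟨l + 1, hl'⟩, u), huv.symm⟩) rfl ▸ .refl _ _⟩
    · have hex := F.next_cycle a (F.next a u) u (F.next_adj a u huv.symm) huv.symm
      classical
      have hc' := hc.face
      rw [face_eq] at hc'
      obtain ⟨cs, m, L, h1, h2, h3⟩ := exists_occ_list (hb := hb) (s₀ := i₀) (e₀ := e₀) huv.symm
        (fun w hw hwu s hs hs' hcw => by
          have hsub := F.acyclic.branch_subset huv hw hwu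
          refine ih _ _ hw s ?_ (fun h => hi (hsub h)) (hri.trans hw.reachable) hs hs' hcw
          have hlt := Set.ncard_lt_ncard (hsub.ssubset_of_ne fun h =>
            SimpleGraph.notMem_branch hw.ne' (h ▸ SimpleGraph.self_mem_branch u (.inr a)))
            (Set.toFinite _)
          omega)
        (Nat.find hex) _ _ s (Nat.find_spec hex) (fun i hi => Nat.find_min hex hi) hs hs' hc'
      exact ⟨_, _, _, .node huv rfl h1, h2, h3⟩

/-- Reading the part of a planar forest on an interval of labels that no path leaves. -/
theorem exists_occ_forest (hp : F.IsPlanar) (hr : F.ReachesBoundary) (hb : F.BoundaryDegOne)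
    (N : ℕ) : ∀ s e, s ≤ e → e ≤ n → e ≤ s + N → F.ClosedInterval s e →
      ∃ c L, F.Occ c .forest s e L := by
  induction N with
  | zero =>
    intro s e h1 _ h2 _
    obtain rfl : s = e := by omega
    exact ⟨_, _, .fnil _⟩
  | succ N ih =>
    intro s e hse hen hN hcl
    rcases hse.eq_or_lt with rfl | hlt
    · exact ⟨_, _, .fnil _⟩
    set i₀ : Fin n := ⟨s, by omega⟩ with hi₀
    have hadj : F.graph.Adj (.inl i₀) (hb.nbr i₀) := hb.adj_iff.2 rfl
    obtain ⟨c, m, L, h1, h2, k, rfl, h3⟩ := exists_occ_tree (hb := hb) hp hr (i₀ := i₀) (e₀ := e) hcl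
      (fun s' e' hs' hse' he' hcl' => ih s' e' hse' (by omega) (by have : s < s' := hs'; omega) hcl')
      _ _ _ hadj (s + 1) le_rfl (SimpleGraph.notMem_branch hadj.ne') hadj.reachable
      (Nat.lt_succ_self s) (by omega) ⟨i₀, rfl, .refl _ _⟩
    have hle := h1.le
    have hk : F.ClosedInterval s (k + 1) := by
      replace h3 := Equiv.Perm.sameCycle_apply_left.2 h3
      rw [face_apply, hb.eq_out (i := i₀) (d := SimpleGraph.Dart.symm _) rfl] at h3
      rcases Nat.eq_zero_or_pos s with rfl | hs
      · rw [hb.rot_out_zero] at h3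
        rcases Nat.lt_or_ge (k : ℕ) (n - 1) with h | h
        · have h4 := hb.closedInterval_of_sameCycle hp hr (k := ⟨n - 1, by omega⟩) h h3.symm
          intro x y hxy hx
          refine ⟨Nat.zero_le _, ?_⟩
          by_contra hc
          have := h4 y x hxy.symm (by simp only; omega)
          omega
        · intro x y _ _
          omega
      · obtain ⟨s, rfl⟩ : ∃ s', s = s' + 1 := ⟨s - 1, by omega⟩
        rw [hi₀, hb.rot_out_succ] at h3
        exact hb.closedInterval_of_sameCycle hp hr (i := ⟨s, by omega⟩)
          (Fin.lt_def.2 (by simp only; omega)) h3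
    obtain ⟨g, L', h4⟩ := ih (k + 1) e h2 hen (by omega) (hcl.sdiff hk (by omega))
    exact ⟨_, _, .fcons (i := i₀) rfl hadj h1 h4⟩

end BoundaryDegOne

theorem exists_occ (hp : F.IsPlanar) (hb : F.BoundaryDegOne) (hr : F.ReachesBoundary) :
    ∃ c L, F.Occ c .forest 0 n L :=
  BoundaryDegOne.exists_occ_forest hp hr hb n 0 n (Nat.zero_le _) le_rfl (by omega)
    fun _ y _ _ => ⟨Nat.zero_le _, y.2⟩

end PreForest
end

noncomputable section

/-! ### Roots, components and the number of edges -/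

namespace Code

/-- The labels of the roots of the trees in a code that is read from the label `s` on. -/
def roots : {κ : CodeKind} → Code κ → ℕ → List ℕ
  | _, leaf g, s => g.roots s
  | _, node _ cs, s => cs.roots s
  | _, lnil, _ => []
  | _, lcons c cs, s => c.roots s ++ cs.roots (s + c.numBd)
  | _, fnil, _ => []
  | _, fcons c g, s => s :: (c.roots (s + 1) ++ g.roots (s + 1 + c.numBd))

/-- The number of trees in a forest, those in the gaps included. -/
def numRoots : {κ : CodeKind} → Code κ → ℕ
  | _, leaf g => g.numRoots
  | _, node _ cs => cs.numRoots
  | _, lnil => 0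
  | _, lcons c cs => c.numRoots + cs.numRoots
  | _, fnil => 0
  | _, fcons c g => c.numRoots + g.numRoots + 1

theorem length_roots {κ : CodeKind} (c : Code κ) (s : ℕ) : (c.roots s).length = c.numRoots := by
  induction c generalizing s <;> simp_all [roots, numRoots]

theorem mem_roots_bounds {κ : CodeKind} {c : Code κ} {s i : ℕ} (h : i ∈ c.roots s) :
    s ≤ i ∧ i < s + c.numBd := by
  induction c generalizing s with
  | leaf g ih => have := ih h; simp only [numBd]; omega
  | node h cs ih => exact ih h
  | lnil => cases h
  | lcons c cs ih1 ih2 =>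
    simp only [numBd]
    rcases List.mem_append.1 h with h | h
    · have := ih1 h; omega
    · have := ih2 h; omega
  | fnil => cases h
  | fcons c g ih1 ih2 =>
    simp only [numBd]
    rcases List.mem_cons.1 h with h | h
    · omega
    · rcases List.mem_append.1 h with h | h
      · have := ih1 h; omega
      · have := ih2 h; omega

theorem nodup_roots {κ : CodeKind} (c : Code κ) (s : ℕ) : (c.roots s).Nodup := by
  induction c generalizing s with
  | leaf g ih => exact ih s
  | node h cs ih => exact ih s
  | lnil => exact List.nodup_nil
  | lcons c cs ih1 ih2 =>
    refine List.nodup_append'.2 ⟨ih1 s, ih2 _, fun i h1 h2 => ?_⟩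
    have := mem_roots_bounds h1
    have := mem_roots_bounds h2
    omega
  | fnil => exact List.nodup_nil
  | fcons c g ih1 ih2 =>
    refine List.nodup_cons.2 ⟨fun h => ?_, List.nodup_append'.2 ⟨ih1 _, ih2 _, fun i h1 h2 => ?_⟩⟩
    · rcases List.mem_append.1 h with h | h
      · have := mem_roots_bounds h; omega
      · have := mem_roots_bounds h; omega
    · have := mem_roots_bounds h1
      have := mem_roots_bounds h2
      omega

/-- The sum of a weight over all vertices: `β` for a boundary vertex, and `φ h d` for an internal
vertex of helicity `h` and degree `d`. -/
def wsum {M : Type*} [AddCommMonoid M] (β : M) (φ : ℕ → ℕ → M) : {κ : CodeKind} → Code κ → M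
  | _, leaf g => g.wsum β φ + β
  | _, node h cs => φ h (cs.len + 1) + cs.wsum β φ
  | _, lnil => 0
  | _, lcons c cs => c.wsum β φ + cs.wsum β φ
  | _, fnil => 0
  | _, fcons c g => β + (c.wsum β φ + g.wsum β φ)

/-- The handshaking lemma for codes: every planted tree has one more edge, which leads to its
anchor, so that the degrees in a planted tree add up to an odd number. -/
theorem wsum_deg {κ : CodeKind} (c : Code κ) :
    c.wsum 1 (fun _ d => d) + 2 * c.numRoots +
      (match κ with | .tree => 1 | .list => c.len | .forest => 0) = 2 * c.size := by
  induction c <;> simp only [wsum, numRoots, size, len] at * <;> omega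

end Code

namespace PreForest

variable {n : ℕ} {F : PreForest n}

namespace Occ

variable {κ : CodeKind} {c : Code κ} {p : Loc (Fin n) (Fin F.numInt) κ} {s e : ℕ}
  {L : List (Fin n ⊕ Fin F.numInt)}

theorem sum_map_eq {M : Type*} [AddCommMonoid M] {β : M} {φ : ℕ → ℕ → M}
    {f : Fin n ⊕ Fin F.numInt → M} (hβ : ∀ i, f (.inl i) = β)
    (hφ : ∀ a, f (.inr a) = φ (F.hel a) (F.deg (.inr a))) (h : F.Occ c p s e L) :
    (L.map f).sum = c.wsum β φ := by
  induction h with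
  | leaf hadj he hg ih => simp [Code.wsum, ih, hβ]
  | node hadj hh hcs ih => simp [Code.wsum, ih, hφ, hh, hcs.deg_eq hadj.symm]
  | lnil a t s => simp [Code.wsum]
  | lcons hx hc hcs ih1 ih2 => simp [Code.wsum, ih1, ih2]
  | fnil s => simp [Code.wsum]
  | fcons hi hadj hc hg ih1 ih2 => simp [Code.wsum, ih1, ih2, hβ]

theorem sum_eq {M : Type*} [AddCommMonoid M] {β : M} {φ : ℕ → ℕ → M}
    {f : Fin n ⊕ Fin F.numInt → M} (hb : F.BoundaryDegOne) (hr : F.ReachesBoundary)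
    (hβ : ∀ i, f (.inl i) = β) (hφ : ∀ a, f (.inr a) = φ (F.hel a) (F.deg (.inr a)))
    {c : Code .forest} (h : F.Occ c .forest 0 n L) : ∑ x, f x = c.wsum β φ := by
  rw [← h.sum_map_eq hβ hφ, ← List.sum_toFinset _ (h.nodup hb hr)]
  refine Finset.sum_congr (Finset.ext fun x => ?_) fun _ _ => rfl
  simp [h.mem_of_forest hb hr x]

theorem two_mul_edges (hb : F.BoundaryDegOne) (hr : F.ReachesBoundary) {c : Code .forest}
    (h : F.Occ c .forest 0 n L) : F.graph.edgeSet.ncard + c.numRoots = n + F.numInt := by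
  classical
  have h1 := h.sum_eq (f := F.deg) hb hr (β := 1) (φ := fun _ d => d) hb fun _ => rfl
  have h2 := F.graph.sum_degrees_eq_twice_card_edges
  have h3 : ∀ x, F.graph.degree x = F.deg x := fun x => by
    rw [deg, ← Nat.card_coe_set_eq, Nat.card_eq_fintype_card,
      SimpleGraph.card_neighborSet_eq_degree]
  simp only [h3, h1] at h2
  rw [← Set.ncard_coe_finset, SimpleGraph.coe_edgeFinset] at h2
  have h4 := c.wsum_deg
  have h5 : L.length = n + F.numInt := by
    have h6 := h.nodup hb hr
    rw [← List.toFinset_card_of_nodup h6, Finset.eq_univ_of_forall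
      (s := L.toFinset) fun x => List.mem_toFinset.2 (h.mem_of_forest hb hr x)]
    simp
  rw [← h.length_eq, h5] at h4
  simp only at h4
  omega

theorem bounds_of_reachable_root (hb : F.BoundaryDegOne) (h : F.Occ c p s e L) {i j : Fin n}
    (hi : (i : ℕ) ∈ c.roots s) (hij : F.graph.Reachable (.inl i) (.inl j)) :
    s ≤ j ∧ (j : ℕ) < e := by
  have hforest : ∀ {c : Code .forest} {s e : ℕ} {L : List (Fin n ⊕ Fin F.numInt)},
      F.Occ c .forest s e L → (i : ℕ) ∈ c.roots s → s ≤ j ∧ (j : ℕ) < e := fun h hi => by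
    rw [← h.inl_mem_iff]
    refine h.forest_mem_of_reachable hb ((h.inl_mem_iff i).2 ?_) hij
    rw [h.end_eq]
    exact Code.mem_roots_bounds hi
  induction h with
  | leaf hadj he hg ih => have := hforest hg hi; omega
  | node hadj hh hcs ih => exact ih hi
  | lnil a t s => cases hi
  | lcons hx hc hcs ih1 ih2 =>
    have := hc.le
    have := hcs.le
    rcases List.mem_append.1 hi with hi | hi
    · have := ih1 hi; omega
    · rw [← hc.end_eq] at hi
      have := ih2 hi; omega
  | fnil s => cases hi
  | fcons h1 h2 h3 h4 => exact hforest (.fcons h1 h2 h3 h4) hi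

theorem root_eq_of_reachable (hb : F.BoundaryDegOne) (h : F.Occ c p s e L) {i j : Fin n}
    (hi : (i : ℕ) ∈ c.roots s) (hj : (j : ℕ) ∈ c.roots s)
    (hij : F.graph.Reachable (.inl i) (.inl j)) : i = j := by
  have hdisj : ∀ {κ κ' : CodeKind} {c : Code κ} {c' : Code κ'}
      {p : Loc (Fin n) (Fin F.numInt) κ} {p' : Loc (Fin n) (Fin F.numInt) κ'} {s m m' e : ℕ}
      {L L' : List (Fin n ⊕ Fin F.numInt)}, F.Occ c p s m L → F.Occ c' p' m e L' →
      ∀ {i j : Fin n}, (i : ℕ) ∈ c.roots s → (j : ℕ) ∈ c'.roots m →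
      ¬ F.graph.Reachable (.inl i) (.inl j) := by
    intro κ κ' c c' p p' s m _ e L L' h h' i j hi hj hij
    have := h.bounds_of_reachable_root hb hi hij
    have := Code.mem_roots_bounds hj
    omega
  induction h with
  | leaf hadj he hg ih => exact ih hi hj
  | node hadj hh hcs ih => exact ih hi hj
  | lnil a t s => cases hi
  | lcons hx hc hcs ih1 ih2 =>
    simp only [Code.roots, List.mem_append, ← hc.end_eq] at hi hj
    rcases hi with hi | hi <;> rcases hj with hj | hj
    · exact ih1 hi hj
    · exact absurd hij (hdisj (m' := 0) hc hcs hi hj)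
    · exact absurd hij.symm (hdisj (m' := 0) hc hcs hj hi)
    · exact ih2 hi hj
  | fnil s => cases hi
  | fcons h1 h2 hc hg ih1 ih2 =>
    have := hc.le
    simp only [Code.roots, List.mem_cons, List.mem_append, ← hc.end_eq] at hi hj
    rcases hi with hi | hi | hi <;> rcases hj with hj | hj | hj
    · exact Fin.ext (hi.trans hj.symm)
    · have := hc.bounds_of_reachable_root hb hj hij.symm; omega
    · have := hg.bounds_of_reachable_root hb hj hij.symm; omega
    · have := hc.bounds_of_reachable_root hb hi hij; omega
    · exact ih1 hi hj
    · exact absurd hij (hdisj (m' := 0) hc hg hi hj)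
    · have := hg.bounds_of_reachable_root hb hi hij; omega
    · exact absurd hij.symm (hdisj (m' := 0) hc hg hj hi)
    · exact ih2 hi hj

theorem exists_root_reachable (h : F.Occ c p s e L) {x : Fin n ⊕ Fin F.numInt} (hx : x ∈ L) :
    (∃ i : Fin n, (i : ℕ) ∈ c.roots s ∧ F.graph.Reachable x (.inl i)) ∨
      ∃ u, p.anchor = some u ∧ F.graph.Reachable x u := by
  induction h with
  | leaf hadj he hg ih =>
    rcases List.mem_append.1 hx with hx | hx
    · exact (ih hx).imp id nofun
    · rw [List.mem_singleton] at hx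
      subst hx
      exact .inr ⟨_, rfl, hadj.symm.reachable⟩
  | node hadj hh hcs ih =>
    rcases List.mem_cons.1 hx with hx | hx
    · subst hx
      exact .inr ⟨_, rfl, hadj.symm.reachable⟩
    · rcases ih hx with h | ⟨w, ⟨rfl⟩, h⟩
      · exact .inl h
      · exact .inr ⟨_, rfl, h.trans hadj.symm.reachable⟩
  | lnil a t s => cases hx
  | lcons hx' hc hcs ih1 ih2 =>
    rcases List.mem_append.1 hx with hx | hx
    · rcases ih1 hx with ⟨i, hi, h⟩ | h
      · exact .inl ⟨i, List.mem_append_left _ hi, h⟩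
      · exact .inr h
    · rcases ih2 hx with ⟨i, hi, h⟩ | h
      · exact .inl ⟨i, List.mem_append_right _ (hc.end_eq ▸ hi), h⟩
      · exact .inr h
  | fnil s => cases hx
  | @fcons i v c g s m e L₁ L₂ hi hadj hc hg ih1 ih2 =>
    left
    have h0 : (i : ℕ) ∈ (Code.fcons c g).roots s := by
      rw [hi]; exact List.mem_cons_self
    rcases List.mem_cons.1 hx with hx | hx
    · subst hx
      exact ⟨i, h0, .refl _⟩
    · rcases List.mem_append.1 hx with hx | hx
      · rcases ih1 hx with ⟨j, hj, h⟩ | ⟨w, ⟨rfl⟩, h⟩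
        · exact ⟨j, List.mem_cons_of_mem _ (List.mem_append_left _ hj), h⟩
        · exact ⟨i, h0, h⟩
      · rcases ih2 hx with ⟨j, hj, h⟩ | ⟨w, h, -⟩
        · exact ⟨j, List.mem_cons_of_mem _ (List.mem_append_right _ (hc.end_eq ▸ hj)), h⟩
        · cases h

end Occ

/-! ### Forests with codes are planar -/

namespace BoundaryDegOne

variable (hb : F.BoundaryDegOne)

/-- A step along the boundary of a region that, at boundary vertices, only uses the arcs of the
boundary circle between consecutive labels up to `t`. -/
def ArcStep (t : ℕ) (d d' : F.graph.Dart) : Prop :=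
  hb.face d = d' ∧ ∀ j : Fin n, d.snd = .inl j → 0 < (j : ℕ) ∧ (j : ℕ) ≤ t

/-- The dart `d` is reached from the corner just before the label `s` by a walk along the boundary
of a region which only uses the arcs before this corner. -/
def WalkTo (d : F.graph.Dart) (s : ℕ) : Prop :=
  ∃ k : Fin n, (k : ℕ) + 1 = s ∧ Relation.ReflTransGen (hb.ArcStep k) (hb.out k) d

variable {hb}

theorem walkTo_out (i : Fin n) : hb.WalkTo (hb.out i) (i + 1) := ⟨i, rfl, .refl⟩

theorem WalkTo.next {u : Fin n ⊕ Fin F.numInt} {a : Fin F.numInt} {h : F.graph.Adj u (.inr a)}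
    {s : ℕ} (hw : hb.WalkTo ⟨(u, .inr a), h⟩ s) :
    hb.WalkTo ⟨(.inr a, F.next a u), F.next_adj a u h.symm⟩ s := by
  obtain ⟨k, hk, hw⟩ := hw
  exact ⟨k, hk, hw.tail ⟨face_eq h, nofun⟩⟩

/-- Reading a code is a walk that passes the boundary vertices in the order of their labels; it
goes from every boundary vertex to the next one that is not a root. -/
theorem walkTo_of_occ {κ : CodeKind} {c : Code κ} {p : Loc (Fin n) (Fin F.numInt) κ} {s e : ℕ}
    {L : List (Fin n ⊕ Fin F.numInt)} (h : F.Occ c p s e L) :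
    match p with
    | .tree u v => ∀ (huv : F.graph.Adj u v), hb.WalkTo ⟨(u, v), huv⟩ s →
        hb.WalkTo ⟨(v, u), huv.symm⟩ e ∧
        ∀ i : Fin n, s ≤ i → (i : ℕ) < e → (i : ℕ) ∉ c.roots s → hb.WalkTo (hb.out i).symm i
    | .list a x t => ∀ (hx : F.graph.Adj (.inr a) x) (ht : F.graph.Adj (.inr a) t),
        hb.WalkTo ⟨(.inr a, x), hx⟩ s → hb.WalkTo ⟨(.inr a, t), ht⟩ e ∧
        ∀ i : Fin n, s ≤ i → (i : ℕ) < e → (i : ℕ) ∉ c.roots s → hb.WalkTo (hb.out i).symm i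
    | .forest => (∀ d, hb.WalkTo d s → hb.WalkTo d e) ∧
        ∀ i : Fin n, s ≤ i → (i : ℕ) < e → (i : ℕ) ∉ c.roots s → hb.WalkTo (hb.out i).symm i := by
  induction h with
  | @leaf u i g s e L hadj he hg ih =>
    intro huv hw
    have h1 : ⟨(.inl i, u), huv.symm⟩ = hb.out i := hb.eq_out rfl
    refine ⟨?_, fun j hj1 hj2 hj3 => ?_⟩
    · rw [h1, he]
      exact walkTo_out i
    · rcases Nat.lt_or_ge j i with h2 | h2
      · exact ih.2 j hj1 h2 hj3
      · obtain rfl : j = i := Fin.ext (by omega)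
        rw [← h1]
        exact ih.1 _ hw
  | @node u a h cs s e L hadj hh hcs ih =>
    intro huv hw
    exact ih (F.next_adj a u huv.symm) huv.symm hw.next
  | lnil a t s =>
    intro hx ht hw
    exact ⟨hw, fun i h1 h2 => by omega⟩
  | @lcons a x t c cs s m e L₁ L₂ hx' hc hcs ih1 ih2 =>
    intro hx ht hw
    obtain ⟨h1, h2⟩ := ih1 hx hw
    obtain ⟨h3, h4⟩ := ih2 (F.next_adj a x hx) ht h1.next
    refine ⟨h3, fun i hi1 hi2 hi3 => ?_⟩
    rw [Code.roots, List.mem_append, ← hc.end_eq, not_or] at hi3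
    rcases Nat.lt_or_ge i m with h5 | h5
    · exact h2 i hi1 h5 hi3.1
    · exact h4 i h5 hi2 hi3.2
  | fnil s => exact ⟨fun d h => h, fun i h1 h2 => by omega⟩
  | @fcons i v c g s m e L₁ L₂ hi hadj hc hg ih1 ih2 =>
    subst hi
    have hle := hc.le
    have h0 : (⟨(.inl i, v), hadj⟩ : F.graph.Dart) = hb.out i := hb.eq_out rfl
    obtain ⟨⟨k', hk', h1⟩, h2⟩ := ih1 hadj (h0 ▸ walkTo_out i)
    refine ⟨fun d hd => ih2.1 d ?_, fun j hj1 hj2 hj3 => ?_⟩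
    · obtain ⟨k, hk, hw⟩ := hd
      refine ⟨k', hk', (h1.tail (c := hb.out k) ⟨?_, ?_⟩).trans (Relation.ReflTransGen.mono ?_ _ _ hw)⟩
      · rw [face_apply]
        have h3 : (SimpleGraph.Dart.mk (v, .inl i) hadj.symm).symm = hb.out i := h0
        have h4 : i = ⟨(k : ℕ) + 1, by omega⟩ := Fin.ext hk.symm
        rw [h3, h4, hb.rot_out_succ]
      · rintro j hj
        cases hj
        omega
      · rintro d d' ⟨h3, h4⟩
        exact ⟨h3, fun j hj => ⟨(h4 j hj).1, by have := (h4 j hj).2; omega⟩⟩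
    · rw [Code.roots, List.mem_cons, List.mem_append, ← hc.end_eq, not_or, not_or] at hj3
      rcases Nat.lt_or_ge j m with h5 | h5
      · exact h2 j (by omega) h5 hj3.2.1
      · exact ih2.2 j h5 hj2 hj3.2.2

/-- The permutation `π` follows the boundaries of the regions in the map whose boundary circle
is replaced by the cycle through the labels `0, …, z`; the other boundary vertices are turned
around. -/
def IsPartialFace (hb : F.BoundaryDegOne) (z : Fin n) (π : Equiv.Perm F.graph.Dart) : Prop :=
  ∀ d : F.graph.Dart, (∀ v, d.snd = .inr v → π d = hb.face d) ∧ ∀ j : Fin n, d.snd = .inl j →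
    ((j : ℕ) = 0 → π d = hb.out z) ∧ (0 < (j : ℕ) → j ≤ z → π d = hb.face d) ∧
      (z < j → π d = hb.out j)

theorem IsPartialFace.swap_mul [DecidableEq F.graph.Dart] {z : ℕ} {hz : z + 1 < n}
    {π : Equiv.Perm F.graph.Dart} (h : IsPartialFace hb ⟨z + 1, hz⟩ π) :
    IsPartialFace hb ⟨z, by omega⟩
      (Equiv.swap (hb.out ⟨z, by omega⟩) (hb.out ⟨z + 1, hz⟩) * π) := by
  intro d
  obtain ⟨h1, h2⟩ := h d
  refine ⟨fun v hv => ?_, fun j hj => ?_⟩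
  · have h3 : ∀ i, hb.face d ≠ hb.out i := fun i hi => by
      have h4 := (hb.rot_inr (d := d.symm) (v := v) hv).1
      rw [← face_apply, hi] at h4
      cases h4
    rw [Equiv.Perm.mul_apply, h1 v hv, Equiv.swap_apply_of_ne_of_ne (h3 _) (h3 _)]
  · obtain ⟨h3, h4, h5⟩ := h2 j hj
    refine ⟨fun hj0 => ?_, fun hj0 hjz => ?_, fun hjz => ?_⟩
    · rw [Equiv.Perm.mul_apply, h3 hj0, Equiv.swap_apply_right]
    · rw [Fin.le_def] at hjz
      simp only at hjz
      obtain ⟨j, hjn⟩ := j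
      obtain ⟨j, rfl⟩ : ∃ j', j = j' + 1 := ⟨j - 1, by simp only at hj0; omega⟩
      simp only at hjz
      rw [Equiv.Perm.mul_apply, h4 hj0 (Fin.le_def.2 (by simp only; omega)),
        face_apply, hb.eq_out (d := d.symm) hj, hb.rot_out_succ, Equiv.swap_apply_of_ne_of_ne]
      · intro h6
        have : j = z := congrArg Fin.val (hb.out_injective h6)
        omega
      · intro h6
        have : j = z + 1 := congrArg Fin.val (hb.out_injective h6)
        omega
    · rw [Fin.lt_def] at hjz
      simp only at hjz
      rcases Nat.lt_or_ge (z + 1) j with h6 | h6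
      · rw [Equiv.Perm.mul_apply, h5 h6, Equiv.swap_apply_of_ne_of_ne]
        · intro h7
          have : (j : ℕ) = z := congrArg Fin.val (hb.out_injective h7)
          omega
        · intro h7
          have : (j : ℕ) = z + 1 := congrArg Fin.val (hb.out_injective h7)
          omega
      · obtain rfl : j = ⟨z + 1, hz⟩ := Fin.ext (by simp only; omega)
        rw [Equiv.Perm.mul_apply, h4 (Nat.succ_pos z) le_rfl, face_apply,
          hb.eq_out (d := d.symm) hj, hb.rot_out_succ, Equiv.swap_apply_left]

theorem isPartialFace_face (hn : 0 < n) : IsPartialFace hb ⟨n - 1, by omega⟩ hb.face := by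
  refine fun d => ⟨fun _ _ => rfl, fun j hj => ⟨fun hj0 => ?_, fun _ _ => rfl, fun hjn => ?_⟩⟩
  · obtain rfl : j = ⟨0, hn⟩ := Fin.ext hj0
    rw [face_apply, hb.eq_out (d := d.symm) hj, hb.rot_out_zero]
  · rw [Fin.lt_def] at hjn
    simp only at hjn
    omega

/-- The arcs of the boundary circle are inserted one by one. The arc at a vertex that is not a root
splits a region; the arc at a root joins at most two regions. -/
theorem le_cycleCount_of_isPartialFace {c : Code .forest} {L : List (Fin n ⊕ Fin F.numInt)}
    (h : F.Occ c .forest 0 n L) (z : ℕ) : ∀ (hz : z < n) (π : Equiv.Perm F.graph.Dart),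
      IsPartialFace hb ⟨z, hz⟩ π → (c.numRoots : ℤ) +
        ∑ i ∈ Finset.Icc 1 z, (if i ∈ c.roots 0 then -1 else 1) ≤ cycleCount π := by
  classical
  induction z with
  | zero =>
    intro hz π hπ
    -- Without arcs, the walks around different trees are different cycles.
    have hcomp : ∀ d d', Relation.EqvGen (fun x y => π x = y) d d' →
        F.graph.Reachable d.fst d'.fst := by
      intro d d' hdd
      induction hdd with
      | rel d d' hd =>
        subst hd
        obtain ⟨h1, h2⟩ := hπ d
        have h3 : F.graph.Reachable d.fst d.snd := d.adj.reachable
        rcases h4 : d.snd with j | v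
        · rw [h4] at h3
          rcases Nat.eq_zero_or_pos j with h5 | h5
          · rw [(h2 j h4).1 h5]
            exact (Fin.ext h5 : j = ⟨0, hz⟩) ▸ h3
          · rw [(h2 j h4).2.2 h5]
            exact h3
        · rw [h1 v h4, face_apply, (hb.rot_inr (d := d.symm) (v := v) h4).1]
          exact h4 ▸ h3
      | refl _ => exact .refl _
      | symm _ _ _ ih => exact ih.symm
      | trans _ _ _ _ _ ih1 ih2 => exact ih1.trans ih2
    have hlt : ∀ i ∈ (c.roots 0).toFinset, i < n := fun i hi => by
      have h1 := Code.mem_roots_bounds (List.mem_toFinset.1 hi)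
      have h2 := h.end_eq
      omega
    have hcard : Fintype.card (c.roots 0).toFinset ≤ cycleCount π := by
      rw [← Nat.card_eq_fintype_card]
      refine Nat.card_le_card_of_injective
        (fun i : (c.roots 0).toFinset => Quot.mk _ (hb.out ⟨i, hlt i i.2⟩)) fun i j hij => ?_
      have h1 := hcomp _ _ (Quot.eqvGen_exact hij)
      have h2 := h.root_eq_of_reachable hb (List.mem_toFinset.1 i.2) (List.mem_toFinset.1 j.2) h1
      exact Subtype.ext (congrArg Fin.val h2)
    rw [Fintype.card_coe, List.toFinset_card_of_nodup (c.nodup_roots 0), c.length_roots] at hcard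
    simpa using hcard
  | succ z ih =>
    intro hz π hπ
    have hπ' := hπ.swap_mul
    have h1 := ih _ _ hπ'
    have hne : hb.out ⟨z, by omega⟩ ≠ hb.out ⟨z + 1, hz⟩ := fun h => by
      have : z = z + 1 := congrArg Fin.val (hb.out_injective h)
      omega
    rw [Finset.sum_Icc_succ_top (by omega)]
    set π' := Equiv.swap (hb.out ⟨z, by omega⟩) (hb.out ⟨z + 1, hz⟩) * π with hπdef
    have hππ : π = Equiv.swap (hb.out ⟨z, by omega⟩) (hb.out ⟨z + 1, hz⟩) * π' := by
      rw [hπdef, Equiv.swap_mul_self_mul]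
    split_ifs with hroot
    · have h2 := cycleCount_le_swap_mul π' hne
      rw [← hππ] at h2
      omega
    · have hs : π'.SameCycle (hb.out ⟨z, by omega⟩) (hb.out ⟨z + 1, hz⟩) := by
        obtain ⟨k, hk, hw⟩ := (walkTo_of_occ (hb := hb) h).2 ⟨z + 1, hz⟩ (Nat.zero_le _) hz hroot
        have hkz : k = ⟨z, by omega⟩ := Fin.ext (Nat.succ_injective hk)
        rw [hkz] at hw
        have h3 : ∀ d, Relation.ReflTransGen (hb.ArcStep z) (hb.out ⟨z, by omega⟩) d →
            π'.SameCycle (hb.out ⟨z, by omega⟩) d := by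
          intro d hd
          induction hd with
          | refl => exact .refl _ _
          | @tail d d' _ hstep ih' =>
            obtain ⟨rfl, h4⟩ := hstep
            have h5 : π' d = hb.face d := by
              rcases h5 : d.snd with j | v
              · exact ((hπ' d).2 j h5).2.1 (h4 j h5).1 (h4 j h5).2
              · exact (hπ' d).1 v h5
            rw [← h5]
            exact Equiv.Perm.sameCycle_apply_right.2 ih'
        have h4 := ((hπ' (hb.out ⟨z + 1, hz⟩).symm).2 ⟨z + 1, hz⟩ rfl).2.2
          (Fin.lt_def.2 (Nat.lt_succ_self z))
        rw [← h4]
        exact Equiv.Perm.sameCycle_apply_right.2 (h3 _ hw)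
      have h2 := cycleCount_swap_mul_of_sameCycle hs hne
      rw [← hππ] at h2
      omega

end BoundaryDegOne

theorem Occ.isPlanar (hb : F.BoundaryDegOne) (hr : F.ReachesBoundary) {c : Code .forest}
    {L : List (Fin n ⊕ Fin F.numInt)} (h : F.Occ c .forest 0 n L) : F.IsPlanar := by
  rcases Nat.eq_zero_or_pos n with hn | hn
  · exact .inl hn
  rw [hb.isPlanar_iff hn]
  refine le_antisymm (hb.numInt_add_cycleCount_face_le hr hn) ?_
  have h1 := BoundaryDegOne.le_cycleCount_of_isPartialFace (hb := hb) h (n - 1) (by omega) _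
    (BoundaryDegOne.isPartialFace_face hn)
  have h2 := h.two_mul_edges hb hr
  have h0 : 0 ∈ c.roots 0 := by
    have h3 := h.end_eq
    cases c with
    | fnil => simp [Code.numBd] at h3; omega
    | fcons c g => exact List.mem_cons_self
  have h3 : ∀ i ∈ (c.roots 0).toFinset, i < n := fun i hi => by
    have h1 := Code.mem_roots_bounds (List.mem_toFinset.1 hi)
    have h2 := h.end_eq
    omega
  have h4 : ∑ i ∈ Finset.range n, (if i ∈ c.roots 0 then -1 else 1 : ℤ) =
      n - 2 * c.numRoots := by
    have h5 : ∀ i, (if i ∈ c.roots 0 then -1 else 1 : ℤ) =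
        1 - 2 * (if i ∈ (c.roots 0).toFinset then 1 else 0) := fun i => by
      simp only [List.mem_toFinset]
      split_ifs <;> norm_num
    simp only [h5, Finset.sum_sub_distrib, ← Finset.mul_sum, Finset.sum_boole]
    rw [Finset.filter_mem_eq_inter, Finset.inter_eq_right.2 fun i hi => Finset.mem_range.2 (h3 i hi),
      List.toFinset_card_of_nodup (c.nodup_roots 0), c.length_roots]
    simp
  have h6 : ∑ i ∈ Finset.range n, (if i ∈ c.roots 0 then -1 else 1 : ℤ) =
      -1 + ∑ i ∈ Finset.Icc 1 (n - 1), (if i ∈ c.roots 0 then -1 else 1 : ℤ) := by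
    rw [Finset.range_eq_Ico, Finset.sum_eq_sum_Ico_succ_bot hn, if_pos h0]
    congr 1
  omega

end PreForest
end

noncomputable section

/-! ### The vertices of a code -/

namespace Code

/-- The vertices of the forest described by a code. -/
inductive Vert : {κ : CodeKind} → Code κ → Type
  | leafTop (g : Code .forest) : Vert (leaf g)
  | leafGap {g : Code .forest} (x : Vert g) : Vert (leaf g)
  | nodeTop (h : ℕ) (cs : Code .list) : Vert (node h cs)
  | nodeIn {h : ℕ} {cs : Code .list} (x : Vert cs) : Vert (node h cs)
  | head {c : Code .tree} {cs : Code .list} (x : Vert c) : Vert (lcons c cs)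
  | tail {c : Code .tree} {cs : Code .list} (x : Vert cs) : Vert (lcons c cs)
  | root (c : Code .tree) (g : Code .forest) : Vert (fcons c g)
  | first {c : Code .tree} {g : Code .forest} (x : Vert c) : Vert (fcons c g)
  | rest {c : Code .tree} {g : Code .forest} (x : Vert g) : Vert (fcons c g)

open Vert

/-- The vertices that are attached to a vertex outside the code, in clockwise order. -/
def tops : {κ : CodeKind} → (c : Code κ) → List c.Vert
  | _, leaf g => [leafTop g]
  | _, node h cs => [nodeTop h cs]
  | _, lnil => []
  | _, lcons c cs => c.tops.map head ++ cs.tops.map tail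
  | _, fnil => []
  | _, fcons _ _ => []

namespace Vert

/-- The children of a vertex in clockwise order. -/
def children : {κ : CodeKind} → {c : Code κ} → c.Vert → List c.Vert
  | _, _, leafTop _ => []
  | _, _, leafGap x => x.children.map leafGap
  | _, _, nodeTop _ cs => cs.tops.map nodeIn
  | _, _, nodeIn x => x.children.map nodeIn
  | _, _, head x => x.children.map head
  | _, _, tail x => x.children.map tail
  | _, _, root c _ => c.tops.map first
  | _, _, first x => x.children.map first
  | _, _, rest x => x.children.map rest

/-- The label of a boundary vertex, or the helicity of an internal vertex. -/
def info : {κ : CodeKind} → {c : Code κ} → c.Vert → ℕ ⊕ ℕ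
  | _, _, leafTop g => .inl g.numBd
  | _, _, leafGap x => x.info
  | _, _, nodeTop h _ => .inr h
  | _, _, nodeIn x => x.info
  | _, _, head x => x.info
  | _, lcons c _, tail x => x.info.map (c.numBd + ·) id
  | _, _, root _ _ => .inl 0
  | _, _, first x => x.info.map (1 + ·) id
  | _, fcons c _, rest x => x.info.map (1 + c.numBd + ·) id

/-- The distance of a vertex from the root of its tree, or from the top of the code. -/
def depth : {κ : CodeKind} → {c : Code κ} → c.Vert → ℕ
  | _, _, leafTop _ => 0
  | _, _, leafGap x => x.depth
  | _, _, nodeTop _ _ => 0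
  | _, _, nodeIn x => x.depth + 1
  | _, _, head x => x.depth
  | _, _, tail x => x.depth
  | _, _, root _ _ => 0
  | _, _, first x => x.depth + 1
  | _, _, rest x => x.depth

end Vert

instance finite_vert {κ : CodeKind} (c : Code κ) : Finite c.Vert := by
  induction c with
  | leaf g ih =>
    refine Finite.of_surjective (fun x : Option g.Vert => x.elim (leafTop g) leafGap) ?_
    rintro (_ | x)
    exacts [⟨none, rfl⟩, ⟨some x, rfl⟩]
  | node h cs ih =>
    refine Finite.of_surjective (fun x : Option cs.Vert => x.elim (nodeTop h cs) nodeIn) ?_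
    rintro (_ | _ | _ | x)
    exacts [⟨none, rfl⟩, ⟨some x, rfl⟩]
  | lnil => exact Finite.of_injective (β := Fin 0) (fun x => nomatch x) fun x => nomatch x
  | lcons c cs ih1 ih2 =>
    refine Finite.of_surjective (fun x : c.Vert ⊕ cs.Vert => x.elim head tail) ?_
    intro x
    cases x with
    | head x => exact ⟨.inl x, rfl⟩
    | tail x => exact ⟨.inr x, rfl⟩
  | fnil => exact Finite.of_injective (β := Fin 0) (fun x => nomatch x) fun x => nomatch x
  | fcons c g ih1 ih2 =>
    refine Finite.of_surjective
      (fun x : Option (c.Vert ⊕ g.Vert) => x.elim (root c g) fun x => x.elim first rest) ?_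
    intro x
    cases x with
    | root => exact ⟨none, rfl⟩
    | first x => exact ⟨some (.inl x), rfl⟩
    | rest x => exact ⟨some (.inr x), rfl⟩

theorem tops_forest (c : Code .forest) : c.tops = [] := by
  cases c <;> rfl

theorem exists_tops_tree (c : Code .tree) : ∃ t, c.tops = [t] := by
  cases c <;> exact ⟨_, rfl⟩

theorem nodup_tops {κ : CodeKind} (c : Code κ) : c.tops.Nodup := by
  induction c with
  | lcons c cs ih1 ih2 =>
    refine List.nodup_append.2 ⟨ih1.map fun _ _ h => head.inj h, ih2.map fun _ _ h => tail.inj h, ?_⟩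
    simp
  | _ => simp [tops]

namespace Vert

variable {κ : CodeKind} {c : Code κ}

theorem nodup_children (x : c.Vert) : x.children.Nodup := by
  induction x with
  | leafTop g => simp [children]
  | leafGap x ih => exact ih.map fun _ _ h => leafGap.inj h
  | nodeTop h cs => exact cs.nodup_tops.map fun _ _ h => nodeIn.inj h
  | nodeIn x ih => exact ih.map fun _ _ h => nodeIn.inj h
  | head x ih => exact ih.map fun _ _ h => head.inj h
  | tail x ih => exact ih.map fun _ _ h => tail.inj h
  | root c g => exact c.nodup_tops.map fun _ _ h => first.inj h
  | first x ih => exact ih.map fun _ _ h => first.inj h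
  | rest x ih => exact ih.map fun _ _ h => rest.inj h

theorem notMem_tops_of_mem_children {x y : c.Vert} (h : y ∈ x.children) : y ∉ c.tops := by
  induction x with
  | leafTop g => simp [children] at h
  | leafGap x ih => simp only [children, List.mem_map] at h; obtain ⟨a, ha, rfl⟩ := h; simp [tops]
  | nodeTop h cs => simp only [children, List.mem_map] at h; obtain ⟨a, ha, rfl⟩ := h; simp [tops]
  | nodeIn x ih => simp only [children, List.mem_map] at h; obtain ⟨a, ha, rfl⟩ := h; simp [tops]
  | head x ih =>
    simp only [children, List.mem_map] at h; obtain ⟨a, ha, rfl⟩ := h; simpa [tops] using ih ha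
  | tail x ih =>
    simp only [children, List.mem_map] at h; obtain ⟨a, ha, rfl⟩ := h; simpa [tops] using ih ha
  | root c g => simp [tops]
  | first x ih => simp [tops]
  | rest x ih => simp [tops]

theorem eq_of_mem_children {x x' y : c.Vert} (h : y ∈ x.children) (h' : y ∈ x'.children) :
    x = x' := by
  induction x with
  | leafTop g => simp [children] at h
  | leafGap x ih =>
    cases x' <;> simp only [children, List.mem_map, List.not_mem_nil] at h h'
    obtain ⟨a, ha, rfl⟩ := h
    obtain ⟨b, hb, hab⟩ := h'
    cases hab
    rw [ih ha hb]
  | nodeTop h cs =>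
    cases x' with
    | nodeTop => rfl
    | nodeIn x' =>
      simp only [children, List.mem_map] at h h'
      obtain ⟨a, ha, rfl⟩ := h
      obtain ⟨b, hb, hab⟩ := h'
      cases hab
      exact absurd ha (notMem_tops_of_mem_children hb)
  | nodeIn x ih =>
    cases x' <;> simp only [children, List.mem_map] at h h'
    all_goals
      obtain ⟨a, ha, rfl⟩ := h
      obtain ⟨b, hb, hab⟩ := h'
      cases hab
    · exact absurd hb (notMem_tops_of_mem_children ha)
    · rw [ih ha hb]
  | head x ih =>
    cases x' <;> simp only [children, List.mem_map] at h h'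
    all_goals
      obtain ⟨a, ha, rfl⟩ := h
      obtain ⟨b, hb, hab⟩ := h'
      cases hab
    · rw [ih ha hb]
  | tail x ih =>
    cases x' <;> simp only [children, List.mem_map] at h h'
    all_goals
      obtain ⟨a, ha, rfl⟩ := h
      obtain ⟨b, hb, hab⟩ := h'
      cases hab
    · rw [ih ha hb]
  | root c g =>
    cases x' <;> simp only [children, List.mem_map] at h h'
    all_goals
      obtain ⟨a, ha, rfl⟩ := h
      obtain ⟨b, hb, hab⟩ := h'
      cases hab
    · rfl
    · exact absurd ha (notMem_tops_of_mem_children hb)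
  | first x ih =>
    cases x' <;> simp only [children, List.mem_map] at h h'
    all_goals
      obtain ⟨a, ha, rfl⟩ := h
      obtain ⟨b, hb, hab⟩ := h'
      cases hab
    · exact absurd hb (notMem_tops_of_mem_children ha)
    · rw [ih ha hb]
  | rest x ih =>
    cases x' <;> simp only [children, List.mem_map] at h h'
    all_goals
      obtain ⟨a, ha, rfl⟩ := h
      obtain ⟨b, hb, hab⟩ := h'
      cases hab
    · rw [ih ha hb]

theorem depth_lt_of_mem_children {x y : c.Vert} (h : y ∈ x.children) : x.depth < y.depth := by
  induction x with
  | leafTop g => simp [children] at h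
  | leafGap x ih =>
    simp only [children, List.mem_map] at h; obtain ⟨a, ha, rfl⟩ := h; exact ih ha
  | nodeTop h cs =>
    simp only [children, List.mem_map] at h; obtain ⟨a, ha, rfl⟩ := h; simp [depth]
  | nodeIn x ih =>
    simp only [children, List.mem_map] at h; obtain ⟨a, ha, rfl⟩ := h; simpa [depth] using ih ha
  | head x ih => simp only [children, List.mem_map] at h; obtain ⟨a, ha, rfl⟩ := h; exact ih ha
  | tail x ih => simp only [children, List.mem_map] at h; obtain ⟨a, ha, rfl⟩ := h; exact ih ha
  | root c g => simp only [children, List.mem_map] at h; obtain ⟨a, ha, rfl⟩ := h; simp [depth]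
  | first x ih =>
    simp only [children, List.mem_map] at h; obtain ⟨a, ha, rfl⟩ := h; simpa [depth] using ih ha
  | rest x ih => simp only [children, List.mem_map] at h; obtain ⟨a, ha, rfl⟩ := h; exact ih ha

theorem mem_tops_or_exists_parent {x : c.Vert} {h : ℕ} (hx : x.info = .inr h) :
    x ∈ c.tops ∨ ∃ z : c.Vert, x ∈ z.children := by
  induction x with
  | leafTop g => simp [tops]
  | leafGap x ih =>
    rcases ih hx with h | ⟨z, h⟩
    · simp [tops_forest] at h
    · exact .inr ⟨leafGap z, List.mem_map_of_mem h⟩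
  | nodeTop h cs => simp [tops]
  | @nodeIn h' cs x ih =>
    rcases ih hx with h | ⟨z, h⟩
    · exact .inr ⟨nodeTop _ _, List.mem_map_of_mem h⟩
    · exact .inr ⟨nodeIn z, List.mem_map_of_mem h⟩
  | head x ih =>
    rcases ih hx with h | ⟨z, h⟩
    · exact .inl (by simpa [tops] using h)
    · exact .inr ⟨head z, List.mem_map_of_mem h⟩
  | tail x ih =>
    rcases ih (by rcases hy : x.info with a | a <;> simp_all [info]) with h | ⟨z, h⟩
    · exact .inl (by simpa [tops] using h)
    · exact .inr ⟨tail z, List.mem_map_of_mem h⟩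
  | root c g => simp [info] at hx
  | first x ih =>
    rcases ih (by rcases hy : x.info with a | a <;> simp_all [info]) with h | ⟨z, h⟩
    · exact .inr ⟨root _ _, List.mem_map_of_mem h⟩
    · exact .inr ⟨first z, List.mem_map_of_mem h⟩
  | rest x ih =>
    rcases ih (by rcases hy : x.info with a | a <;> simp_all [info]) with h | ⟨z, h⟩
    · simp [tops_forest] at h
    · exact .inr ⟨rest z, List.mem_map_of_mem h⟩

theorem map_info_eq_inl {s : ℕ} {a : ℕ ⊕ ℕ} {j : ℕ} (h : a.map (s + ·) id = .inl j) :
    ∃ i, a = .inl i ∧ s + i = j := by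
  rcases a with a | a <;> simp_all

/-- A boundary vertex is a leaf that hangs from its parent, or a root with a single child. -/
theorem boundary_cases {x : c.Vert} {j : ℕ} (hx : x.info = .inl j) :
    ((x ∈ c.tops ∨ ∃ z : c.Vert, x ∈ z.children) ∧ x.children = []) ∨
      ((∀ z : c.Vert, x ∉ z.children) ∧ x ∉ c.tops ∧ ∃ y, x.children = [y]) := by
  induction x generalizing j with
  | leafTop g => simp [tops, children]
  | leafGap x ih =>
    rcases ih hx with ⟨h | ⟨z, h⟩, h'⟩ | ⟨h1, h2, y, h3⟩
    · simp [tops_forest] at h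
    · exact .inl ⟨.inr ⟨leafGap z, List.mem_map_of_mem h⟩, by simp [children, h']⟩
    · refine .inr ⟨fun z => ?_, by simp [tops], leafGap y, by simp [children, h3]⟩
      cases z <;> simp [children, h1]
  | nodeTop h cs => simp [info] at hx
  | nodeIn x ih =>
    rcases ih hx with ⟨h | ⟨z, h⟩, h'⟩ | ⟨h1, h2, y, h3⟩
    · exact .inl ⟨.inr ⟨nodeTop _ _, List.mem_map_of_mem h⟩, by simp [children, h']⟩
    · exact .inl ⟨.inr ⟨nodeIn z, List.mem_map_of_mem h⟩, by simp [children, h']⟩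
    · refine .inr ⟨fun z => ?_, by simp [tops], nodeIn y, by simp [children, h3]⟩
      cases z <;> simp [children, h1, h2]
  | head x ih =>
    rcases ih hx with ⟨h | ⟨z, h⟩, h'⟩ | ⟨h1, h2, y, h3⟩
    · exact .inl ⟨.inl (by simpa [tops] using h), by simp [children, h']⟩
    · exact .inl ⟨.inr ⟨head z, List.mem_map_of_mem h⟩, by simp [children, h']⟩
    · refine .inr ⟨fun z => ?_, by simp [tops, h2], head y, by simp [children, h3]⟩
      cases z <;> simp [children, h1]
  | tail x ih =>
    obtain ⟨i, hx, -⟩ := map_info_eq_inl hx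
    rcases ih hx with ⟨h | ⟨z, h⟩, h'⟩ | ⟨h1, h2, y, h3⟩
    · exact .inl ⟨.inl (by simpa [tops] using h), by simp [children, h']⟩
    · exact .inl ⟨.inr ⟨tail z, List.mem_map_of_mem h⟩, by simp [children, h']⟩
    · refine .inr ⟨fun z => ?_, by simp [tops, h2], tail y, by simp [children, h3]⟩
      cases z <;> simp [children, h1]
  | root c g =>
    obtain ⟨t, ht⟩ := c.exists_tops_tree
    refine .inr ⟨fun z => ?_, by simp [tops], first t, by simp [children, ht]⟩
    cases z <;> simp [children]
  | first x ih =>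
    obtain ⟨i, hx, -⟩ := map_info_eq_inl hx
    rcases ih hx with ⟨h | ⟨z, h⟩, h'⟩ | ⟨h1, h2, y, h3⟩
    · exact .inl ⟨.inr ⟨root _ _, List.mem_map_of_mem h⟩, by simp [children, h']⟩
    · exact .inl ⟨.inr ⟨first z, List.mem_map_of_mem h⟩, by simp [children, h']⟩
    · refine .inr ⟨fun z => ?_, by simp [tops], first y, by simp [children, h3]⟩
      cases z <;> simp [children, h1, h2]
  | rest x ih =>
    obtain ⟨i, hx, -⟩ := map_info_eq_inl hx
    rcases ih hx with ⟨h | ⟨z, h⟩, h'⟩ | ⟨h1, h2, y, h3⟩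
    · simp [tops_forest] at h
    · exact .inl ⟨.inr ⟨rest z, List.mem_map_of_mem h⟩, by simp [children, h']⟩
    · refine .inr ⟨fun z => ?_, by simp [tops], rest y, by simp [children, h3]⟩
      cases z <;> simp [children, h1]

theorem info_lt {x : c.Vert} {j : ℕ} (hx : x.info = .inl j) : j < c.numBd := by
  induction x generalizing j with
  | leafTop g => simp_all [info, numBd]
  | leafGap x ih => exact (ih hx).trans (Nat.lt_succ_self _)
  | nodeTop h cs => simp [info] at hx
  | nodeIn x ih => exact ih hx
  | head x ih => exact (ih hx).trans_le (Nat.le_add_right _ _)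
  | root c g => simp_all [info, numBd]; omega
  | tail x ih | first x ih | rest x ih =>
    obtain ⟨i, hi, rfl⟩ := map_info_eq_inl hx
    have := ih hi
    simp only [numBd]
    omega

theorem eq_of_info_eq {x y : c.Vert} {j : ℕ} (hx : x.info = .inl j) (hy : y.info = .inl j) :
    x = y := by
  induction x generalizing j with
  | leafTop g =>
    cases y with
    | leafTop => rfl
    | leafGap y =>
      cases hx
      exact absurd (info_lt (x := y) hy) (lt_irrefl _)
  | leafGap x ih =>
    cases y with
    | leafTop =>
      cases hy
      exact absurd (info_lt (x := x) hx) (lt_irrefl _)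
    | leafGap y => rw [ih hx hy]
  | nodeTop h cs => simp [info] at hx
  | nodeIn x ih =>
    cases y with
    | nodeTop => simp [info] at hy
    | nodeIn y => rw [ih hx hy]
  | head x ih =>
    cases y with
    | head y => rw [ih hx hy]
    | tail y =>
      obtain ⟨i, hi, rfl⟩ := map_info_eq_inl hy
      have := info_lt (x := x) hx
      omega
  | tail x ih =>
    obtain ⟨i, hi, rfl⟩ := map_info_eq_inl hx
    cases y with
    | head y =>
      have := info_lt (x := y) hy
      omega
    | tail y =>
      obtain ⟨i', hi', h⟩ := map_info_eq_inl hy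
      rw [ih hi (Nat.add_left_cancel h ▸ hi')]
  | root c g =>
    cases hx
    cases y with
    | root => rfl
    | first y | rest y =>
      obtain ⟨i, hi, h⟩ := map_info_eq_inl hy
      omega
  | first x ih =>
    obtain ⟨i, hi, rfl⟩ := map_info_eq_inl hx
    have := info_lt hi
    cases y with
    | root => simp [info] at hy; omega
    | first y =>
      obtain ⟨i', hi', h⟩ := map_info_eq_inl hy
      rw [ih hi (Nat.add_left_cancel h ▸ hi')]
    | rest y =>
      obtain ⟨i', hi', h⟩ := map_info_eq_inl hy
      omega
  | rest x ih =>
    obtain ⟨i, hi, rfl⟩ := map_info_eq_inl hx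
    cases y with
    | root => simp [info] at hy; omega
    | first y =>
      obtain ⟨i', hi', h⟩ := map_info_eq_inl hy
      have := info_lt hi'
      omega
    | rest y =>
      obtain ⟨i', hi', h⟩ := map_info_eq_inl hy
      rw [ih hi (Nat.add_left_cancel h ▸ hi')]

end Vert

theorem exists_info_eq {κ : CodeKind} (c : Code κ) {j : ℕ} (h : j < c.numBd) :
    ∃ x : c.Vert, x.info = .inl j := by
  induction c generalizing j with
  | leaf g ih =>
    rcases (Nat.lt_succ_iff.1 h).lt_or_eq with h | rfl
    · exact (ih h).imp' leafGap fun x hx => hx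
    · exact ⟨leafTop g, rfl⟩
  | node h' cs ih => exact (ih h).imp' nodeIn fun x hx => hx
  | lnil => simp [numBd] at h
  | lcons c cs ih1 ih2 =>
    by_cases hj : j < c.numBd
    · exact (ih1 hj).imp' head fun x hx => hx
    · obtain ⟨i, rfl⟩ := Nat.exists_eq_add_of_le (not_lt.1 hj)
      exact (ih2 (Nat.lt_of_add_lt_add_left h)).imp' tail fun x hx => by simp [info, hx]
  | fnil => simp [numBd] at h
  | fcons c g ih1 ih2 =>
    simp only [numBd] at h
    rcases j with _ | j
    · exact ⟨root c g, rfl⟩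
    by_cases hj : j < c.numBd
    · exact (ih1 hj).imp' first fun x hx => by simp [info, hx, Nat.add_comm]
    · obtain ⟨i, rfl⟩ := Nat.exists_eq_add_of_le (not_lt.1 hj)
      exact (ih2 (j := i) (by omega)).imp' rest fun x hx => by simp [info, hx]; omega

end Code
end

noncomputable section

/-! ### The forest with a given code -/

theorem List.head?_eq_formPerm_apply {α : Type*} [DecidableEq α] {t x : α} {pre rest : List α}
    (h : (t :: (pre ++ x :: rest)).Nodup) :
    (rest ++ [t]).head? = some ((t :: (pre ++ x :: rest)).formPerm x) := by
  have hx : (t :: (pre ++ x :: rest))[pre.length + 1]'(by simp) = x := by simp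
  rcases rest with _ | ⟨z, rest⟩
  · simp
  · have := List.formPerm_apply_lt_getElem (t :: (pre ++ x :: z :: rest)) h (pre.length + 1)
      (by simp)
    rw [hx] at this
    rw [this]
    simp

theorem List.head?_eq_formPerm_apply_head {α : Type*} [DecidableEq α] {t : α} {l : List α}
    (h : (t :: l).Nodup) : (l ++ [t]).head? = some ((t :: l).formPerm t) := by
  rcases l with _ | ⟨z, rest⟩
  · simp
  · have := List.formPerm_apply_lt_getElem (t :: z :: rest) h 0 (by simp)
    simp at this
    simp [this]

/-- A rooted forest on `n` boundary vertices and `m` internal vertices, whose children are ordered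
and in which every internal vertex has a parent. Acyclicity is ensured by a function `depth` that
increases from parents to children; it need not be the distance from the root. -/
structure OrderedForest (n m : ℕ) where
  children : Fin n ⊕ Fin m → List (Fin n ⊕ Fin m)
  hel : Fin m → ℕ
  depth : Fin n ⊕ Fin m → ℕ
  nodup_children : ∀ x, (children x).Nodup
  eq_of_mem_children : ∀ {x x' y}, y ∈ children x → y ∈ children x' → x = x'
  depth_lt : ∀ {x y}, y ∈ children x → depth x < depth y
  exists_parent : ∀ a, ∃ x, .inr a ∈ children x

namespace OrderedForest

variable {n m : ℕ} (O : OrderedForest n m)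

/-- The parent of an internal vertex. -/
def parent (a : Fin m) : Fin n ⊕ Fin m := (O.exists_parent a).choose

theorem mem_children_parent (a : Fin m) : .inr a ∈ O.children (O.parent a) :=
  (O.exists_parent a).choose_spec

theorem parent_eq {a : Fin m} {x : Fin n ⊕ Fin m} (h : .inr a ∈ O.children x) : O.parent a = x :=
  O.eq_of_mem_children (O.mem_children_parent a) h

/-- The neighbours of an internal vertex in clockwise order. -/
def nbrs (a : Fin m) : List (Fin n ⊕ Fin m) := O.parent a :: O.children (.inr a)

theorem notMem_children_of_mem_children {x y : Fin n ⊕ Fin m} (h : y ∈ O.children x) :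
    x ∉ O.children y := fun h' => (O.depth_lt h).asymm (O.depth_lt h')

theorem nodup_nbrs (a : Fin m) : (O.nbrs a).Nodup :=
  List.nodup_cons.2 ⟨O.notMem_children_of_mem_children (O.mem_children_parent a),
    O.nodup_children _⟩

/-- The underlying graph. -/
def graph : SimpleGraph (Fin n ⊕ Fin m) where
  Adj x y := y ∈ O.children x ∨ x ∈ O.children y
  symm := ⟨fun _ _ h => h.symm⟩
  loopless := ⟨fun _ h => (lt_irrefl _ (O.depth_lt (or_self_iff.1 h)))⟩

theorem graph_adj {x y : Fin n ⊕ Fin m} :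
    O.graph.Adj x y ↔ y ∈ O.children x ∨ x ∈ O.children y := Iff.rfl

theorem graph_adj_inr {a : Fin m} {x : Fin n ⊕ Fin m} :
    O.graph.Adj (.inr a) x ↔ x ∈ O.nbrs a := by
  rw [graph_adj, nbrs, List.mem_cons, or_comm]
  refine or_congr_left ⟨fun h => (O.parent_eq h).symm, ?_⟩
  rintro rfl
  exact O.mem_children_parent a

theorem not_reachable_of_mem_children {x y : Fin n ⊕ Fin m} (h : y ∈ O.children x) :
    ¬ (O.graph.deleteEdges {s(x, y)}).Reachable y x := by
  intro hr
  have hd : ∀ {z}, Relation.ReflTransGen (fun a b => b ∈ O.children a) y z →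
      O.depth y ≤ O.depth z := by
    intro z hz
    induction hz with
    | refl => exact le_rfl
    | tail _ hz ih => exact ih.trans (O.depth_lt hz).le
  have : Relation.ReflTransGen (fun a b => b ∈ O.children a) y x := by
    refine hr.induct (p := fun z => Relation.ReflTransGen (fun a b => b ∈ O.children a) y z)
      .refl ?_
    intro z w hz hzw
    rw [SimpleGraph.deleteEdges_adj, graph_adj] at hzw
    obtain ⟨hw | hw, hne⟩ := hzw
    · exact hz.tail hw
    · cases hz with
      | refl =>
        refine absurd ?_ hne
        rw [O.eq_of_mem_children hw h]
        exact Sym2.eq_swap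
      | tail hz hz' => rwa [O.eq_of_mem_children hw hz']
  exact absurd (hd this) (O.depth_lt h).not_ge

theorem isAcyclic_graph : O.graph.IsAcyclic := by
  rw [SimpleGraph.isAcyclic_iff_forall_adj_isBridge]
  intro x y hxy
  rw [SimpleGraph.isBridge_iff]
  rcases hxy with h | h
  · exact fun hr => O.not_reachable_of_mem_children h hr.symm
  · rw [Sym2.eq_swap]
    exact O.not_reachable_of_mem_children h

/-- The underlying planar forest. -/
def toPreForest : PreForest n where
  numInt := m
  graph := O.graph
  next a := (O.nbrs a).formPerm
  hel := O.hel
  acyclic := O.isAcyclic_graph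
  next_adj a u h := by
    rw [graph_adj_inr] at h ⊢
    exact List.formPerm_apply_mem_of_mem h
  next_cycle a u w hu hw := by
    rw [graph_adj_inr] at hu hw
    obtain ⟨i, hi, rfl⟩ := List.getElem_of_mem hu
    obtain ⟨j, hj, rfl⟩ := List.getElem_of_mem hw
    refine ⟨(O.nbrs a).length - i + j, ?_⟩
    have := List.formPerm_pow_apply_getElem _ (O.nodup_nbrs a) ((O.nbrs a).length - i + j) i hi
    rw [← Equiv.Perm.coe_pow, this]
    congr 1
    rw [show i + ((O.nbrs a).length - i + j) = j + (O.nbrs a).length by omega,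
      Nat.add_mod_right, Nat.mod_eq_of_lt hj]

/-- The list `l` consists of the vertices that are read at a place `p`. -/
def AtTop : {κ : CodeKind} → Loc (Fin n) (Fin m) κ → List (Fin n ⊕ Fin m) → Prop
  | _, .tree u v, l => l = [v] ∧ v ∈ O.children u
  | _, .list a x t, l => t = O.parent a ∧ (∃ pre, O.children (.inr a) = pre ++ l) ∧
      (l ++ [t]).head? = some x
  | _, .forest, _ => True

theorem exists_occ_of_children_eq {κ : CodeKind} (c : Code κ) (ι : c.Vert → Fin n ⊕ Fin m) (s : ℕ)
    (hι : ∀ x, O.children (ι x) = x.children.map ι)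
    (hl : ∀ x j, x.info = .inl j → ∃ i : Fin n, ι x = .inl i ∧ (i : ℕ) = s + j)
    (hh : ∀ x h, x.info = .inr h → ∃ a, ι x = .inr a ∧ O.hel a = h)
    {p : Loc (Fin n) (Fin m) κ} (hp : O.AtTop p (c.tops.map ι)) :
    ∃ L, O.toPreForest.Occ c p s (s + c.numBd) L := by
  induction c generalizing s with
  | leaf g ih =>
    obtain ⟨i, hi, hi'⟩ := hl (.leafTop g) _ rfl
    rcases p with ⟨u, v⟩
    obtain ⟨hp, hv⟩ := hp
    simp only [Code.tops, List.map_cons, hi, List.map_nil, List.cons.injEq, and_true] at hp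
    obtain rfl := hp
    obtain ⟨L, hL⟩ := ih (ι ∘ .leafGap) s (fun x => by simp [hι, Code.Vert.children])
      (fun x => hl (.leafGap x)) (fun x => hh (.leafGap x)) (p := .forest) trivial
    exact ⟨_, .leaf (.inl hv) (by simp only [Code.numBd]; omega) (hi' ▸ hL)⟩
  | node h cs ih =>
    obtain ⟨a, ha, ha'⟩ := hh (.nodeTop h cs) _ rfl
    rcases p with ⟨u, v⟩
    obtain ⟨hp, hv⟩ := hp
    simp only [Code.tops, List.map_cons, ha, List.map_nil, List.cons.injEq, and_true] at hp
    obtain rfl := hp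
    have hu := O.parent_eq hv
    have hc := hι (.nodeTop h cs)
    rw [ha, Code.Vert.children, List.map_map] at hc
    obtain ⟨L, hL⟩ := ih (ι ∘ .nodeIn) s (fun x => by simp [hι, Code.Vert.children])
      (fun x => hl (.nodeIn x)) (fun x => hh (.nodeIn x))
      (p := .list a (O.toPreForest.next a u) u)
      ⟨hu.symm, ⟨[], hc⟩, by
        rw [← hc, ← hu]; exact List.head?_eq_formPerm_apply_head (O.nodup_nbrs a)⟩
    exact ⟨_, .node (.inl hv) ha' hL⟩
  | lnil =>
    rcases p with _ | ⟨a, x, t⟩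
    obtain ⟨-, -, hx⟩ := hp
    simp only [Code.tops, List.map_nil, List.nil_append, List.head?_cons, Option.some.injEq] at hx
    subst hx
    exact ⟨_, .lnil _ _ _⟩
  | lcons c cs ih1 ih2 =>
    rcases p with _ | ⟨a, x, t⟩
    obtain ⟨ht, ⟨pre, hpre⟩, hx⟩ := hp
    obtain ⟨t₀, ht₀⟩ := c.exists_tops_tree
    simp only [Code.tops, ht₀, List.map_cons, List.map_nil, List.cons_append, List.nil_append,
      List.head?_cons, Option.some.injEq, List.map_map] at hx hpre
    subst hx ht
    have hn := O.nodup_nbrs a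
    rw [OrderedForest.nbrs, hpre] at hn
    have hmem : ι (.head t₀) ∈ O.children (.inr a) := by simp [hpre]
    obtain ⟨L₁, h₁⟩ := ih1 (ι ∘ .head) s (fun x => by simp [hι, Code.Vert.children])
      (fun x => hl (.head x)) (fun x => hh (.head x)) (p := .tree (.inr a) (ι (.head t₀)))
      ⟨by simp [ht₀], hmem⟩
    obtain ⟨L₂, h₂⟩ := ih2 (ι ∘ .tail) (s + c.numBd) (fun x => by simp [hι, Code.Vert.children])
      (fun x j hj => by
        obtain ⟨i, h1, h2⟩ := hl (.tail x) (c.numBd + j) (by simp [Code.Vert.info, hj])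
        exact ⟨i, h1, by omega⟩)
      (fun x h hx => hh (.tail x) h (by simp [Code.Vert.info, hx]))
      (p := .list a (O.toPreForest.next a (ι (.head t₀))) (O.parent a))
      ⟨rfl, ⟨pre ++ [ι (.head t₀)], by simp [hpre]⟩, by
        have := List.head?_eq_formPerm_apply hn
        rw [← hpre] at this
        exact this⟩
    refine ⟨_, .lcons ?_ h₁ (Nat.add_assoc .. ▸ h₂)⟩
    intro h
    rw [h] at hmem
    exact O.notMem_children_of_mem_children hmem (O.mem_children_parent a)
  | fnil =>
    rcases p with _ | _ | _
    exact ⟨_, .fnil _⟩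
  | fcons c g ih1 ih2 =>
    rcases p with _ | _ | _
    obtain ⟨i, hi, hi'⟩ := hl (.root c g) _ rfl
    obtain ⟨t₀, ht₀⟩ := c.exists_tops_tree
    have hc := hι (.root c g)
    rw [hi, Code.Vert.children, List.map_map, ht₀] at hc
    have hmem : ι (.first t₀) ∈ O.children (.inl i) := by simp [hc]
    obtain ⟨L₁, h₁⟩ := ih1 (ι ∘ .first) (s + 1) (fun x => by simp [hι, Code.Vert.children])
      (fun x j hj => by
        obtain ⟨i, h1, h2⟩ := hl (.first x) (1 + j) (by simp [Code.Vert.info, hj])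
        exact ⟨i, h1, by omega⟩)
      (fun x h hx => hh (.first x) h (by simp [Code.Vert.info, hx]))
      (p := .tree (.inl i) (ι (.first t₀))) ⟨by simp [ht₀], hmem⟩
    obtain ⟨L₂, h₂⟩ := ih2 (ι ∘ .rest) (s + 1 + c.numBd)
      (fun x => by simp [hι, Code.Vert.children])
      (fun x j hj => by
        obtain ⟨i, h1, h2⟩ := hl (.rest x) (1 + c.numBd + j) (by simp [Code.Vert.info, hj])
        exact ⟨i, h1, by omega⟩)
      (fun x h hx => hh (.rest x) h (by simp [Code.Vert.info, hx])) (p := .forest) trivial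
    rw [show s + 1 + c.numBd + g.numBd = s + (Code.fcons c g).numBd by
      simp only [Code.numBd]; omega] at h₂
    exact ⟨_, .fcons hi' (.inl hmem) h₁ h₂⟩

theorem boundaryDegOne (hO : ∀ i : Fin n,
    ((∃ z, .inl i ∈ O.children z) ∧ O.children (.inl i) = []) ∨
      ((∀ z, .inl i ∉ O.children z) ∧ ∃ y, O.children (.inl i) = [y])) :
    O.toPreForest.BoundaryDegOne := by
  intro i
  rw [PreForest.deg, Set.ncard_eq_one]
  obtain ⟨⟨z, hz⟩, h⟩ | ⟨h, y, hy⟩ := hO i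
  · have key : ∀ w, O.graph.Adj (.inl i) w ↔ w = z := by
      intro w
      rw [graph_adj, h]
      simp only [List.not_mem_nil, false_or]
      exact ⟨fun hw => O.eq_of_mem_children hw hz, fun hw => hw ▸ hz⟩
    exact ⟨z, Set.ext key⟩
  · have key : ∀ w, O.graph.Adj (.inl i) w ↔ w = y := by
      intro w
      rw [graph_adj, hy]
      simp [h]
    exact ⟨y, Set.ext key⟩

theorem reachesBoundary : O.toPreForest.ReachesBoundary := by
  intro a
  induction hd : O.depth (.inr a) using Nat.strong_induction_on generalizing a with
  | _ d ih =>
    have h := O.mem_children_parent a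
    have hadj : O.graph.Adj (.inr a) (O.parent a) := .inr h
    rcases hp : O.parent a with i | b
    · exact ⟨i, hp ▸ hadj.reachable⟩
    · rw [hp] at h hadj
      obtain ⟨i, hi⟩ := ih _ (hd ▸ O.depth_lt h) b rfl
      exact ⟨i, hadj.reachable.trans hi⟩

end OrderedForest

namespace Code

theorem exists_vertEquiv (c : Code .forest) : ∃ m, ∃ e : c.Vert ≃ Fin c.numBd ⊕ Fin m,
    (∀ x i, e x = .inl i ↔ x.info = .inl (i : ℕ)) ∧ ∀ x h, x.info = .inr h → ∃ a, e x = .inr a := by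
  classical
  let I := {x : c.Vert // ∃ h, x.info = .inr h}
  obtain ⟨m, ⟨e⟩⟩ := Finite.exists_equiv_fin I
  choose b hb using fun i : Fin c.numBd => c.exists_info_eq i.2
  let f : Fin c.numBd ⊕ Fin m → c.Vert := Sum.elim b fun a => (e.symm a).1
  have hf : Function.Bijective f := by
    constructor
    · rintro (i | a) (j | a') h
      · have h1 := hb i
        rw [show b i = b j from h, hb j] at h1
        simpa [Fin.ext_iff] using h1.symm
      · obtain ⟨h', h1⟩ := (e.symm a').2
        have h2 := hb i
        rw [show b i = (e.symm a').1 from h, h1] at h2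
        simp at h2
      · obtain ⟨h', h1⟩ := (e.symm a).2
        have h2 := hb j
        rw [← show (e.symm a).1 = b j from h, h1] at h2
        simp at h2
      · have h1 := e.symm.injective (Subtype.ext (show (e.symm a).1 = (e.symm a').1 from h))
        rw [h1]
    · intro x
      rcases hx : x.info with j | h
      · exact ⟨.inl ⟨j, Vert.info_lt hx⟩, Vert.eq_of_info_eq (hb _) hx⟩
      · exact ⟨.inr (e ⟨x, h, hx⟩), by simp [f]⟩
  refine ⟨m, (Equiv.ofBijective f hf).symm, fun x i => ?_, fun x h hx => ?_⟩
  · rw [Equiv.symm_apply_eq]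
    exact ⟨fun h => h ▸ hb i, fun h => Vert.eq_of_info_eq h (hb i)⟩
  · exact ⟨e ⟨x, h, hx⟩, by rw [Equiv.symm_apply_eq]; simp [f]⟩

/-- Every code of a forest is the code of a forest. -/
theorem exists_preForest (c : Code .forest) : ∃ F : PreForest c.numBd,
    F.BoundaryDegOne ∧ F.ReachesBoundary ∧ ∃ L, F.Occ c .forest 0 c.numBd L := by
  obtain ⟨m, e, hl, hr⟩ := c.exists_vertEquiv
  have hinr : ∀ a : Fin m, ∃ h, (e.symm (.inr a)).info = .inr h := by
    intro a
    rcases hx : (e.symm (.inr a)).info with j | h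
    · have := (hl _ ⟨j, Vert.info_lt hx⟩).2 hx
      simp at this
    · exact ⟨h, rfl⟩
  choose hel hhel using hinr
  have hmem : ∀ x y : Fin c.numBd ⊕ Fin m,
      y ∈ (e.symm x).children.map e ↔ e.symm y ∈ (e.symm x).children := by
    intro x y
    simp only [List.mem_map]
    exact ⟨fun ⟨a, h1, h2⟩ => by rwa [← h2, e.symm_apply_apply], fun h => ⟨_, h, by simp⟩⟩
  let O : OrderedForest c.numBd m :=
    { children := fun x => (e.symm x).children.map e
      hel := hel
      depth := fun x => (e.symm x).depth
      nodup_children := fun x => (Vert.nodup_children _).map e.injective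
      eq_of_mem_children := fun {x x' y} h h' => e.symm.injective
        (Vert.eq_of_mem_children ((hmem _ _).1 h) ((hmem _ _).1 h'))
      depth_lt := fun {x y} h => Vert.depth_lt_of_mem_children ((hmem _ _).1 h)
      exists_parent := fun a => by
        rcases Vert.mem_tops_or_exists_parent (hhel a) with h | ⟨z, h⟩
        · simp [tops_forest] at h
        · exact ⟨e z, (hmem _ _).2 (by simpa using h)⟩ }
  refine ⟨O.toPreForest, O.boundaryDegOne fun i => ?_, O.reachesBoundary, ?_⟩
  · have hi : (e.symm (.inl i)).info = .inl (i : ℕ) := (hl _ _).1 (by simp)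
    rcases Vert.boundary_cases hi with ⟨h | ⟨z, h⟩, h'⟩ | ⟨h1, -, y, h2⟩
    · simp [tops_forest] at h
    · exact .inl ⟨⟨e z, (hmem _ _).2 (by simpa using h)⟩, by simp [O, h']⟩
    · exact .inr ⟨fun z hz => h1 _ ((hmem _ _).1 hz), e y, by simp [O, h2]⟩
  · have := O.exists_occ_of_children_eq c e 0 (fun x => by simp [O])
      (fun x j hj => ⟨⟨j, Vert.info_lt hj⟩, (hl _ _).2 hj, by simp⟩)
      (fun x h hx => by
        obtain ⟨a, ha⟩ := hr x h hx
        refine ⟨a, ha, ?_⟩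
        have := hhel a
        rw [← ha, e.symm_apply_apply, hx] at this
        exact (Sum.inr.inj this).symm) (p := .forest) trivial
    rw [Nat.zero_add] at this
    exact this

end Code
end

noncomputable section

/-! ### Codes of contracted Grassmannian forests -/

/-- The colours of internal vertices. -/
inductive Color
  | white
  | black
  | generic

namespace Code

/-- The colour of an internal vertex of helicity `h` with `m` children. -/
def color (h m : ℕ) : Color :=
  if h = 1 then .white else if h = m then .black else .generic

theorem len_eq_zero_iff {cs : Code .list} : cs.len = 0 ↔ cs = lnil := by
  cases cs <;> simp [len]

/-- A lollipop: an internal vertex without children, of helicity `0` or `1`. -/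
def IsLollipop (c : Code .tree) : Prop := ∃ h ≤ 1, c = node h lnil

/-- The codes of contracted Grassmannian forests, and of their planted trees that hang from an
internal vertex of the given colour. (For a planted tree other than a lollipop that hangs from a
boundary vertex, the colour is taken to be `generic`, which does not impose a condition.) -/
def Good : Color → {κ : CodeKind} → Code κ → Prop
  | _, _, leaf g => g.Good .generic
  | col, _, node h cs => 2 ≤ cs.len ∧ 1 ≤ h ∧ h ≤ cs.len ∧
      (color h cs.len = .generic ∨ color h cs.len ≠ col) ∧ cs.Good (color h cs.len)
  | _, _, lnil => True
  | col, _, lcons c cs => c.Good col ∧ cs.Good col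
  | _, _, fnil => True
  | _, _, fcons c g => (c.IsLollipop ∨ c.Good .generic) ∧ g.Good .generic

end Code

namespace PreForest

variable {n : ℕ} {F : PreForest n}

/-- The conditions on the degree and the helicity of an internal vertex. -/
def IsGoodVertex (F : PreForest n) (a : Fin F.numInt) : Prop :=
  F.deg (.inr a) ≠ 2 ∧ (F.IsBoundaryLeaf a → F.hel a = 0 ∨ F.hel a = 1) ∧
    (¬ F.IsBoundaryLeaf a → 1 ≤ F.hel a ∧ F.hel a + 1 ≤ F.deg (.inr a))

/-- Two internal vertices are neither both white nor both black. -/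
def Contrast (F : PreForest n) (a b : Fin F.numInt) : Prop :=
  ¬ (F.IsWhite a ∧ F.IsWhite b) ∧ ¬ (F.IsBlack a ∧ F.IsBlack b)

theorem Contrast.symm {a b : Fin F.numInt} (h : F.Contrast a b) : F.Contrast b a :=
  ⟨fun h' => h.1 h'.symm, fun h' => h.2 h'.symm⟩

/-- The colour of an internal vertex. -/
def color (F : PreForest n) (a : Fin F.numInt) : Color :=
  Code.color (F.hel a) (F.deg (.inr a) - 1)

/-- The condition `Code.Good` for a code that is read at a place of `F`. -/
def GoodAt (F : PreForest n) : {κ : CodeKind} → Loc (Fin n) (Fin F.numInt) κ → Code κ → Prop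
  | _, .tree (.inl _) _, c => c.IsLollipop ∨ c.Good .generic
  | _, .tree (.inr a) _, c => c.Good (F.color a)
  | _, .list a _ _, c => c.Good (F.color a)
  | _, .forest, c => c.Good .generic

theorem contrast_iff {a b : Fin F.numInt} (ha : 3 ≤ F.deg (.inr a)) (hb : 3 ≤ F.deg (.inr b)) :
    F.Contrast a b ↔ F.color b = .generic ∨ F.color b ≠ F.color a := by
  simp only [Contrast, IsWhite, IsBlack, color, Code.color]
  split_ifs <;> simp <;> omega

namespace Occ

variable {κ : CodeKind} {c : Code κ} {p : Loc (Fin n) (Fin F.numInt) κ} {s e : ℕ}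
  {L : List (Fin n ⊕ Fin F.numInt)}

theorem three_le_deg (hF : ∀ a, F.IsGoodVertex a) {a b : Fin F.numInt}
    (h : F.graph.Adj (.inr a) (.inr b)) : 3 ≤ F.deg (.inr a) := by
  obtain ⟨h1, h2, h3⟩ := hF a
  have h4 : ¬ F.IsBoundaryLeaf a := by
    rintro ⟨h5, i, hi⟩
    obtain ⟨x, hx⟩ := Set.ncard_eq_one.1 h5
    have h6 : Sum.inr b ∈ ({x} : Set _) := hx ▸ h
    have h7 : Sum.inl i ∈ ({x} : Set _) := hx ▸ hi
    rw [Set.mem_singleton_iff] at h6 h7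
    rw [← h6] at h7
    cases h7
  have := h3 h4
  omega

/-- The code of a contracted Grassmannian forest is good. -/
theorem goodAt (hF : ∀ a, F.IsGoodVertex a)
    (hc : ∀ a b, F.graph.Adj (.inr a) (.inr b) → F.Contrast a b) (h : F.Occ c p s e L) :
    F.GoodAt p c := by
  induction h with
  | @leaf u i g s e L hadj he hg ih =>
    rcases u with u | u
    · exact .inr ih
    · exact ih
  | @node u a h cs s e L hadj hh hcs ih =>
    have hdeg := hcs.deg_eq hadj.symm
    have hcol : F.color a = Code.color h cs.len := by simp [color, hdeg, hh]
    obtain ⟨h1, h2, h3⟩ := hF a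
    have ih' : cs.Good (Code.color h cs.len) := hcol ▸ ih
    have hgood : 3 ≤ F.deg (.inr a) → 2 ≤ cs.len ∧ 1 ≤ h ∧ h ≤ cs.len := by
      intro hd
      have := h3 fun h' => by have := h'.1; omega
      omega
    rcases u with i | b
    · by_cases hlen : cs.len = 0
      · left
        have := h2 ⟨by omega, i, hadj.symm⟩
        exact ⟨h, by omega, by rw [Code.len_eq_zero_iff.1 hlen]⟩
      · right
        have h4 := hgood (by omega)
        refine ⟨h4.1, h4.2.1, h4.2.2, ?_, ih'⟩
        generalize Code.color h cs.len = col
        cases col <;> simp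
    · have hd := three_le_deg hF hadj.symm
      have h4 := hgood hd
      exact ⟨h4.1, h4.2.1, h4.2.2, hcol ▸ (contrast_iff (three_le_deg hF hadj) hd).1 (hc _ _ hadj),
        ih'⟩
  | lnil a t s => trivial
  | lcons hx hc hcs ih1 ih2 => exact ⟨ih1, ih2⟩
  | fnil s => trivial
  | fcons hi hadj hc hg ih1 ih2 => exact ⟨ih1, ih2⟩

theorem isGoodVertex_of_goodAt (h : F.Occ c p s e L) (hg : F.GoodAt p c) :
    ∀ a, .inr a ∈ L → F.IsGoodVertex a := by
  induction h with
  | @leaf u i g s e L hadj he hg' ih =>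
    have hg : g.Good .generic := by
      rcases u with u | u
      · rcases hg with ⟨h, -, hg⟩ | hg
        · cases hg
        · exact hg
      · exact hg
    intro a ha
    exact ih hg a (by simpa using ha)
  | @node u a h cs s e L hadj hh hcs ih =>
    have hdeg := hcs.deg_eq hadj.symm
    have hcol : F.color a = Code.color h cs.len := by simp [color, hdeg, hh]
    have key : (∃ i, u = .inl i) ∧ (Code.node h cs).IsLollipop ∨ (2 ≤ cs.len ∧ 1 ≤ h ∧ h ≤ cs.len) ∧
        cs.Good (Code.color h cs.len) := by
      rcases u with u | u
      · rcases hg with hg | ⟨h1, h2, h3, -, h4⟩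
        · exact .inl ⟨⟨u, rfl⟩, hg⟩
        · exact .inr ⟨⟨h1, h2, h3⟩, h4⟩
      · obtain ⟨h1, h2, h3, -, h4⟩ := hg
        exact .inr ⟨⟨h1, h2, h3⟩, h4⟩
    intro b hb
    rcases key with ⟨⟨i, rfl⟩, h', hle, heq⟩ | ⟨⟨h1, h2, h3⟩, h4⟩
    · cases heq
      obtain rfl := List.length_eq_zero_iff.1 hcs.length_eq
      obtain rfl : b = a := by simpa using hb
      have hd : F.deg (.inr b) = 1 := hdeg
      refine ⟨by omega, fun _ => by omega, fun h => absurd ⟨hd, i, hadj.symm⟩ h⟩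
    · rcases List.mem_cons.1 hb with hb | hb
      · cases hb
        exact ⟨by omega, fun h => by have := h.1; omega, fun _ => by omega⟩
      · exact ih (hcol ▸ h4 : cs.Good (F.color a)) b hb
  | lnil a t s => simp
  | lcons hx hc hcs ih1 ih2 =>
    intro a ha
    rcases List.mem_append.1 ha with ha | ha
    exacts [ih1 hg.1 a ha, ih2 hg.2 a ha]
  | fnil s => simp
  | fcons hi hadj hc hg' ih1 ih2 =>
    intro a ha
    rcases List.mem_append.1 (show _ ∈ _ ++ _ by simpa using ha) with ha | ha
    exacts [ih1 hg.1 a ha, ih2 hg.2 a ha]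

/-- Every edge between internal vertices joins a vertex to its parent, which is the anchor if the
vertex is the top of the code; so the condition on colours in `Code.Good` covers all edges. -/
theorem contrast_of_goodAt (hb : F.BoundaryDegOne) (hF : ∀ a, F.IsGoodVertex a)
    (h : F.Occ c p s e L) (hg : F.GoodAt p c) :
    ∀ a b, .inr a ∈ L → F.graph.Adj (.inr a) (.inr b) → F.Contrast a b := by
  induction h with
  | @leaf u i g s e L hadj he hg' ih =>
    have hg : g.Good .generic := by
      rcases u with u | u
      · rcases hg with ⟨h, -, hg⟩ | hg
        · cases hg
        · exact hg
      · exact hg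
    intro a b ha
    exact ih hg a b (by simpa using ha)
  | @node u a h cs s e L hadj hh hcs ih =>
    have hdeg := hcs.deg_eq hadj.symm
    have hcol : F.color a = Code.color h cs.len := by simp [color, hdeg, hh]
    have hcs' : cs.Good (F.color a) := by
      rw [hcol]
      rcases u with u | u
      · rcases hg with ⟨h, -, hg⟩ | hg
        · cases hg
          trivial
        · exact hg.2.2.2.2
      · exact hg.2.2.2.2
    intro a' b ha' hab
    rcases List.mem_cons.1 ha' with ha' | ha'
    · cases ha'
      rcases mem_or_anchor_of_adj hb (.node hadj hh hcs) (List.mem_cons_self ..) hab with hm | hm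
      · rcases List.mem_cons.1 hm with hm | hm
        · exact absurd hm hab.ne'
        · exact (ih hcs' b a hm hab.symm).symm
      · cases hm
        refine Contrast.symm ((contrast_iff (three_le_deg hF hab.symm) (three_le_deg hF hab)).2 ?_)
        rw [hcol]
        exact hg.2.2.2.1
    · exact ih hcs' a' b ha' hab
  | lnil a t s => simp
  | lcons hx hc hcs ih1 ih2 =>
    intro a b ha
    rcases List.mem_append.1 ha with ha | ha
    exacts [ih1 hg.1 a b ha, ih2 hg.2 a b ha]
  | fnil s => simp
  | fcons hi hadj hc hg' ih1 ih2 =>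
    intro a b ha
    rcases List.mem_append.1 (show _ ∈ _ ++ _ by simpa using ha) with ha | ha
    exacts [ih1 hg.1 a b ha, ih2 hg.2 a b ha]

end Occ

end PreForest
end

noncomputable section

/-! ### The statistics of a Grassmannian forest, read off its code -/

namespace Code

/-- The contribution of the root of a tree to the helicity, corrected for the truncated subtraction
in `Code.kStat` if the tree is a lollipop. -/
def rootK : Code .tree → ℕ
  | node h lnil => h
  | _ => 1

/-- The contribution of the root of a tree to the mom-dimension, corrected for the truncated
subtraction in `Code.rStat` if the tree is a lollipop. -/
def rootR : Code .tree → ℕ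
  | node _ lnil => 0
  | _ => 1

/-- The helicity of a forest. -/
def kStat : {κ : CodeKind} → Code κ → ℕ
  | _, leaf g => g.kStat
  | _, node h cs => h - 1 + cs.kStat
  | _, lnil => 0
  | _, lcons c cs => c.kStat + cs.kStat
  | _, fnil => 0
  | _, fcons c g => c.rootK + c.kStat + g.kStat

/-- The contribution to the mom-dimension of an internal vertex with `m` children. -/
def mStat : Color → ℕ → ℕ
  | .generic, m => 2 * m - 3
  | _, m => m - 1

/-- The mom-dimension of a forest. -/
def rStat : {κ : CodeKind} → Code κ → ℕ
  | _, leaf g => g.rStat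
  | _, node h cs => mStat (color h cs.len) cs.len + cs.rStat
  | _, lnil => 0
  | _, lcons c cs => c.rStat + cs.rStat
  | _, fnil => 0
  | _, fcons c g => c.rootR + c.rStat + g.rStat

theorem Good.rootK_eq {col : Color} {c : Code .tree} (h : c.Good col) : c.rootK = 1 := by
  cases c with
  | leaf g => rfl
  | node h' cs =>
    cases cs with
    | lnil => simp [Good, len] at h
    | lcons => rfl

theorem Good.rootR_eq {col : Color} {c : Code .tree} (h : c.Good col) : c.rootR = 1 := by
  cases c with
  | leaf g => rfl
  | node h' cs =>
    cases cs with
    | lnil => simp [Good, len] at h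
    | lcons => rfl

theorem Good.kStat_eq {col : Color} {κ : CodeKind} {c : Code κ} (h : c.Good col) :
    (c.kStat : ℤ) = c.numRoots + c.wsum 0 fun h _ => (h : ℤ) - 1 := by
  induction c generalizing col with
  | leaf g ih => simp [kStat, numRoots, wsum, ih h]
  | node h' cs ih =>
    obtain ⟨-, h1, -, -, h2⟩ := h
    simp only [kStat, numRoots, wsum, Nat.cast_add, ih h2]
    push_cast [h1]
    ring
  | lnil => simp [kStat, numRoots, wsum]
  | lcons c cs ih1 ih2 =>
    simp only [kStat, numRoots, wsum, Nat.cast_add, ih1 h.1, ih2 h.2]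
    ring
  | fnil => simp [kStat, numRoots, wsum]
  | fcons c g ih1 ih2 =>
    obtain ⟨⟨h', hle, rfl⟩ | h1, h2⟩ := h
    · simp only [kStat, numRoots, wsum, Nat.cast_add, ih2 h2, rootK, Nat.sub_eq_zero_of_le hle]
      push_cast
      ring
    · simp only [kStat, numRoots, wsum, Nat.cast_add, ih1 h1, ih2 h2, h1.rootK_eq]
      push_cast
      ring

/-- The number `m(v) - 1` for a vertex of helicity `h` and degree `d`. -/
def mdimSubOne (h d : ℕ) : ℤ :=
  (if h ≠ 1 ∧ h + 1 ≠ d then 2 * (d : ℤ) - 4 else (d : ℤ) - 1) - 1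

theorem Good.rStat_eq {col : Color} {κ : CodeKind} {c : Code κ} (h : c.Good col) :
    (c.rStat : ℤ) = c.numRoots + c.wsum 0 mdimSubOne := by
  induction c generalizing col with
  | leaf g ih => simp [rStat, numRoots, wsum, ih h]
  | node h' cs ih =>
    obtain ⟨h0, h1, h3, -, h2⟩ := h
    have key : (mStat (color h' cs.len) cs.len : ℤ) = mdimSubOne h' (cs.len + 1) := by
      simp only [color, mdimSubOne]
      split_ifs <;> simp only [mStat] <;> omega
    simp only [rStat, numRoots, wsum, Nat.cast_add, ih h2, key]
    ring
  | lnil => simp [rStat, numRoots, wsum]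
  | lcons c cs ih1 ih2 =>
    simp only [rStat, numRoots, wsum, Nat.cast_add, ih1 h.1, ih2 h.2]
    ring
  | fnil => simp [rStat, numRoots, wsum]
  | fcons c g ih1 ih2 =>
    obtain ⟨⟨h', hle, rfl⟩ | h1, h2⟩ := h
    · have key : mdimSubOne h' 1 = -1 := by
        rw [mdimSubOne, if_neg (by omega)]
        norm_num
      have key' : mStat (color h' 0) 0 = 0 := by
        simp only [color]
        split_ifs <;> rfl
      simp only [rStat, numRoots, wsum, Nat.cast_add, ih2 h2, rootR, len, key, key']
      push_cast
      ring
    · simp only [rStat, numRoots, wsum, Nat.cast_add, ih1 h1, ih2 h2, h1.rootR_eq]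
      push_cast
      ring

theorem wsum_half {κ : CodeKind} (c : Code κ) :
    c.wsum (1 / 2 : ℚ) (fun h d => (h : ℚ) - (d : ℚ) / 2) =
      c.numRoots + ((c.wsum 0 fun h _ => (h : ℤ) - 1 : ℤ) : ℚ) +
        (match κ with | .tree => 1 / 2 | .list => (c.len : ℚ) / 2 | .forest => 0) := by
  induction c <;> simp_all [wsum, numRoots, len] <;> ring

end Code

namespace PreForest.Occ

variable {n : ℕ} {F : PreForest n} {κ : CodeKind} {c : Code κ}
  {p : Loc (Fin n) (Fin F.numInt) κ} {s e : ℕ} {L : List (Fin n ⊕ Fin F.numInt)}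

/-- The tree of every root can be read. -/
theorem exists_occ_of_mem_roots (h : F.Occ c p s e L) (hg : F.GoodAt p c) {i : Fin n}
    (hi : (i : ℕ) ∈ c.roots s) :
    ∃ t v s' e' L', F.Occ t (.tree (.inl i) v) s' e' L' ∧ (i : ℕ) < s' ∧
      (t.IsLollipop ∨ t.Good .generic) := by
  induction h with
  | @leaf u i g s e L hadj he hg' ih =>
    refine ih ?_ hi
    rcases u with u | u
    · rcases hg with ⟨h, -, hg⟩ | hg
      · cases hg
      · exact hg
    · exact hg
  | @node u a h cs s e L hadj hh hcs ih =>
    have hdeg := hcs.deg_eq hadj.symm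
    have hcol : F.color a = Code.color h cs.len := by simp [color, hdeg, hh]
    refine ih (show cs.Good (F.color a) from ?_) hi
    rw [hcol]
    rcases u with u | u
    · rcases hg with ⟨h, -, hg⟩ | hg
      · cases hg
        trivial
      · exact hg.2.2.2.2
    · exact hg.2.2.2.2
  | lnil a t s => cases hi
  | lcons hx hc hcs ih1 ih2 =>
    rcases List.mem_append.1 hi with hi | hi
    · exact ih1 hg.1 hi
    · exact ih2 hg.2 (hc.end_eq ▸ hi)
  | fnil s => cases hi
  | @fcons i v c g s m e L₁ L₂ his hadj hc hg' ih1 ih2 =>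
    rcases List.mem_cons.1 hi with hi | hi
    · obtain rfl := Fin.ext (hi.trans his.symm)
      exact ⟨c, v, _, _, _, hc, by omega, hg.1⟩
    rcases List.mem_append.1 hi with hi | hi
    · exact ih1 hg.1 hi
    · exact ih2 hg.2 (hc.end_eq ▸ hi)

/-- Beyond an internal vertex, every planted tree reaches the boundary. -/
theorem exists_boundary_reachable {c : Code .tree} {u v : Fin n ⊕ Fin F.numInt}
    (h : F.Occ c (.tree u v) s e L) {col : Color} (hg : c.Good col) :
    ∃ j, .inl j ∈ L ∧ F.graph.Reachable u (.inl j) := by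
  have main : ∀ {κ : CodeKind} {c : Code κ} {p : Loc (Fin n) (Fin F.numInt) κ} {s e : ℕ}
      {L : List (Fin n ⊕ Fin F.numInt)}, F.Occ c p s e L → ∀ {col : Color}, c.Good col →
      ∀ {u}, p.anchor = some u → (κ = .list → 1 ≤ c.len) →
      ∃ j, .inl j ∈ L ∧ F.graph.Reachable u (.inl j) := by
    intro κ c p s e L h
    induction h with
    | @leaf u i g s e L hadj he hg' ih =>
      intro _ _ _ hu _
      cases hu
      exact ⟨i, by simp, hadj.reachable⟩
    | @node u a h cs s e L hadj hh hcs ih =>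
      intro _ hg _ hu _
      cases hu
      obtain ⟨j, h1, h2⟩ := ih hg.2.2.2.2 rfl fun _ => by have := hg.1; omega
      exact ⟨j, List.mem_cons_of_mem _ h1, hadj.reachable.trans h2⟩
    | lnil a t s =>
      intro _ _ _ _ h
      exact absurd (h rfl) (by simp [Code.len])
    | lcons hx hc hcs ih1 ih2 =>
      intro _ hg _ hu _
      obtain ⟨j, h1, h2⟩ := ih1 hg.1 hu nofun
      exact ⟨j, List.mem_append_left _ h1, h2⟩
    | fnil s => exact nofun
    | fcons hi hadj hc hg' ih1 ih2 => exact nofun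
  exact main h hg rfl nofun

end PreForest.Occ

namespace GrassmannianForest

open PreForest

variable {n : ℕ} (F : GrassmannianForest n) {c : Code .forest}
  {L : List (Fin n ⊕ Fin F.numInt)}

theorem isGoodVertex (a : Fin F.numInt) : F.IsGoodVertex a :=
  ⟨F.deg_ne_two a, F.hel_leaf a, F.hel_internal a⟩

theorem mdim_sub_one (v : Fin F.numInt) :
    F.mdim v - 1 = Code.mdimSubOne (F.hel v) (F.deg (.inr v)) := by
  simp only [mdim, Code.mdimSubOne, IsGeneric, IsWhite, IsBlack, ne_eq]
  congr

theorem helicity_eq (h : F.Occ c .forest 0 n L) (hg : c.Good .generic) :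
    F.helicity = c.kStat := by
  have h1 := h.sum_eq (f := Sum.elim (fun _ => (1 / 2 : ℚ))
    fun v => (F.hel v : ℚ) - (F.deg (.inr v) : ℚ) / 2) F.deg_boundary F.reachable_boundary
    (β := 1 / 2) (φ := fun h d => (h : ℚ) - (d : ℚ) / 2) (fun _ => rfl) fun _ => rfl
  rw [Code.wsum_half, Fintype.sum_sum_type] at h1
  have h2 : (c.kStat : ℚ) = ((c.kStat : ℤ) : ℚ) := by simp
  rw [h2, hg.kStat_eq, helicity]
  simp at h1 ⊢
  linarith

theorem sum_mdim_eq (h : F.Occ c .forest 0 n L) :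
    ∑ v, (F.mdim v - 1) = c.wsum 0 Code.mdimSubOne := by
  have h1 := h.sum_eq (f := Sum.elim (fun _ => 0) fun v => F.mdim v - 1) F.deg_boundary
    F.reachable_boundary (β := 0) (φ := Code.mdimSubOne) (fun _ => rfl) F.mdim_sub_one
  simpa [Fintype.sum_sum_type] using h1

theorem eq_or_eq_of_reachable {i : Fin n} {v x : Fin n ⊕ Fin F.numInt}
    (hi : F.graph.Adj (.inl i) v) (hv : ∀ w, F.graph.Adj v w → w = .inl i)
    (hx : F.graph.Reachable (.inl i) x) : x = .inl i ∨ x = v := by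
  refine hx.induct (p := fun x => x = .inl i ∨ x = v) (.inl rfl) ?_
  rintro y z (rfl | rfl) hyz
  · exact .inr (((BoundaryDegOne.adj_iff F.deg_boundary).1 hyz).trans
      ((BoundaryDegOne.adj_iff F.deg_boundary).1 hi).symm)
  · exact .inl (hv z hyz)

open Classical in
/-- The formula for the mom-dimension of a tree with at least three boundary vertices holds for the
others, too: these are lollipops, and edges between two boundary vertices. -/
theorem treeMomDim_eq (h : F.Occ c .forest 0 n L) (hg : c.Good .generic)
    (C : F.graph.ConnectedComponent) :
    F.treeMomDim C = 1 +
      ∑ v : Fin F.numInt with F.graph.connectedComponentMk (.inr v) = C, (F.mdim v - 1) := by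
  obtain ⟨x, rfl⟩ := C.exists_rep
  obtain ⟨i, hi, hxi⟩ : ∃ i : Fin n, (i : ℕ) ∈ c.roots 0 ∧ F.graph.Reachable x (.inl i) := by
    rcases h.exists_root_reachable (h.mem_of_forest F.deg_boundary F.reachable_boundary x) with
      h' | ⟨u, h', -⟩
    · exact h'
    · cases h'
  have hmk : ∀ y, F.graph.connectedComponentMk y = F.graph.connectedComponentMk x ↔
      F.graph.Reachable (.inl i) y := fun y => by
    rw [SimpleGraph.ConnectedComponent.eq]
    exact ⟨fun h => (h.trans hxi).symm, fun h => (hxi.trans h).symm⟩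
  change F.treeMomDim (F.graph.connectedComponentMk x) = 1 + ∑ v : Fin F.numInt with
    F.graph.connectedComponentMk (.inr v) = F.graph.connectedComponentMk x, (F.mdim v - 1)
  obtain ⟨t, v, s', e', L', ht, his, htg⟩ := h.exists_occ_of_mem_roots (p := .forest) hg hi
  rw [treeMomDim]
  split_ifs with hn
  · simp only [numBoundary, hmk] at hn ⊢
    cases ht with
    | @leaf _ j g _ _ L hadj he hg' =>
      have hC : ∀ x, F.graph.Reachable (.inl i) x ↔ x = .inl i ∨ x = .inl j := fun x => by
        refine ⟨F.eq_or_eq_of_reachable hadj fun w hw => ?_, ?_⟩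
        · exact ((BoundaryDegOne.adj_iff F.deg_boundary).1 hw).trans
            ((BoundaryDegOne.adj_iff F.deg_boundary).1 hadj.symm).symm
        · rintro (rfl | rfl)
          exacts [.refl _, hadj.reachable]
      have hij : i ≠ j := fun h => hadj.ne (congrArg _ h)
      have : {k : Fin n | k = i ∨ k = j} = {i, j} := rfl
      simp [hC, this, Set.ncard_pair hij]
    | @node _ a h' cs _ _ L hadj hh hcs =>
      rcases htg with ⟨h', hle, heq⟩ | htg
      · cases heq
        have hd : F.deg (.inr a) = 1 := hcs.deg_eq hadj.symm
        have hC : ∀ x, F.graph.Reachable (.inl i) x ↔ x = .inl i ∨ x = .inr a := fun x => by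
          refine ⟨F.eq_or_eq_of_reachable hadj fun w hw => ?_, ?_⟩
          · obtain ⟨z, hz⟩ := Set.ncard_eq_one.1 hd
            have h1 : w ∈ ({z} : Set _) := hz ▸ hw
            have h2 : .inl i ∈ ({z} : Set _) := hz ▸ hadj.symm
            rw [Set.mem_singleton_iff] at h1 h2
            rw [h1, h2]
          · rintro (rfl | rfl)
            exacts [.refl _, hadj.reachable]
        have hm : F.mdim a - 1 = -1 := by
          rw [mdim_sub_one, hd, hh, Code.mdimSubOne, if_neg (by omega)]
          norm_num
        simp [hC, Finset.filter_eq', hm]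
      · -- a tree with a vertex of degree at least three has at least three boundary vertices
        exfalso
        obtain ⟨h2, -, -, -, hgs⟩ := htg
        match cs, h2, hgs, hcs with
        | .lcons c₁ (.lcons c₂ cs), _, hgs, .lcons _ h₁ (.lcons _ h₂ _) =>
          obtain ⟨j₁, hj₁, hr₁⟩ := h₁.exists_boundary_reachable hgs.1
          obtain ⟨j₂, hj₂, hr₂⟩ := h₂.exists_boundary_reachable hgs.2.1
          rw [Occ.inl_mem_iff (by assumption)] at hj₁ hj₂
          have hsub : (({i, j₁, j₂} : Finset (Fin n)) : Set (Fin n)) ⊆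
              {k | F.graph.Reachable (.inl i) (.inl k)} := by
            intro k hk
            simp only [Finset.coe_insert, Finset.coe_singleton, Set.mem_insert_iff,
              Set.mem_singleton_iff] at hk
            rcases hk with rfl | rfl | rfl
            exacts [.refl _, hadj.reachable.trans hr₁, hadj.reachable.trans hr₂]
          have h3 := Set.ncard_le_ncard hsub
          rw [Set.ncard_coe_finset, Finset.card_insert_of_notMem, Finset.card_pair] at h3
          · omega
          · rw [ne_eq, Fin.ext_iff]
            omega
          · simp only [Finset.mem_insert, Finset.mem_singleton, Fin.ext_iff]
            omega
  · rfl

theorem card_connectedComponent (h : F.Occ c .forest 0 n L) :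
    Nat.card F.graph.ConnectedComponent = c.numRoots := by
  classical
  have hlt : ∀ j ∈ (c.roots 0).toFinset, j < n := fun j hj => by
    have h1 := h.end_eq
    have h2 := Code.mem_roots_bounds (List.mem_toFinset.1 hj)
    omega
  let f : {j // j ∈ (c.roots 0).toFinset} → F.graph.ConnectedComponent := fun j =>
    F.graph.connectedComponentMk (.inl ⟨j, hlt j j.2⟩)
  have hf : Function.Bijective f := by
    constructor
    · intro j j' hjj
      have := h.root_eq_of_reachable F.deg_boundary (i := ⟨j, hlt j j.2⟩) (j := ⟨j', hlt j' j'.2⟩)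
        (List.mem_toFinset.1 j.2) (List.mem_toFinset.1 j'.2) (SimpleGraph.ConnectedComponent.eq.1 hjj)
      exact Subtype.ext (Fin.ext_iff.1 this)
    · intro C
      obtain ⟨x, rfl⟩ := C.exists_rep
      rcases h.exists_root_reachable (h.mem_of_forest F.deg_boundary F.reachable_boundary x) with
        ⟨i, hi, hxi⟩ | ⟨u, h', -⟩
      · exact ⟨⟨i, List.mem_toFinset.2 hi⟩, SimpleGraph.ConnectedComponent.eq.2 hxi.symm⟩
      · cases h'
  rw [← Nat.card_eq_of_bijective f hf, Nat.card_eq_fintype_card, Fintype.card_coe,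
    List.toFinset_card_of_nodup (c.nodup_roots 0), c.length_roots]

theorem momDim_eq (h : F.Occ c .forest 0 n L) (hg : c.Good .generic) : F.momDim = c.rStat := by
  classical
  rw [momDim, finsum_eq_sum_of_fintype]
  simp only [F.treeMomDim_eq h hg, Finset.sum_add_distrib]
  have := Finset.sum_fiberwise Finset.univ
    (fun v : Fin F.numInt => F.graph.connectedComponentMk (.inr v)) fun v => F.mdim v - 1
  rw [F.sum_mdim_eq h] at this
  rw [hg.rStat_eq, ← F.card_connectedComponent h, ← this]
  simp

theorem isTree_iff (h : F.Occ c .forest 0 n L) : F.IsTree ↔ c.numRoots = 1 := by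
  rw [← F.card_connectedComponent h, IsTree, Nat.card_eq_one_iff_unique,
    SimpleGraph.connected_iff]
  constructor
  · rintro ⟨h1, ⟨x⟩⟩
    refine ⟨⟨fun C C' => ?_⟩, ⟨F.graph.connectedComponentMk x⟩⟩
    obtain ⟨y, rfl⟩ := C.exists_rep
    obtain ⟨z, rfl⟩ := C'.exists_rep
    exact SimpleGraph.ConnectedComponent.eq.2 (h1 y z)
  · rintro ⟨h1, ⟨C⟩⟩
    exact ⟨fun x y => SimpleGraph.ConnectedComponent.eq.1 (Subsingleton.elim _ _),
      ⟨C.exists_rep.choose⟩⟩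

end GrassmannianForest
end

noncomputable section

/-! ### Forests up to homeomorphism and their codes -/

namespace GrassmannianForest

open PreForest

variable {n : ℕ}

/-- The code of a Grassmannian forest. -/
def code (F : GrassmannianForest n) : Code .forest :=
  (F.exists_occ F.planar F.deg_boundary F.reachable_boundary).choose

theorem exists_occ_code (F : GrassmannianForest n) : ∃ L, F.Occ F.code .forest 0 n L :=
  (F.exists_occ F.planar F.deg_boundary F.reachable_boundary).choose_spec

theorem code_eq {F : GrassmannianForest n} {c : Code .forest} {L : List (Fin n ⊕ Fin F.numInt)}
    (h : F.Occ c .forest 0 n L) : F.code = c := by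
  obtain ⟨L', h'⟩ := F.exists_occ_code
  exact (h'.unique F.deg_boundary h fun _ => rfl).1

theorem iso_iff {F F' : GrassmannianForest n} : Iso F F' ↔ F.code = F'.code := by
  obtain ⟨L, h⟩ := F.exists_occ_code
  obtain ⟨L', h'⟩ := F'.exists_occ_code
  constructor
  · rintro ⟨f, h1, h2, h3⟩
    exact (code_eq (h.map f (fun u w => (h1 u w).2) h2 h3)).symm
  · intro heq
    rw [← heq] at h'
    exact exists_equiv_of_occ F.deg_boundary F.reachable_boundary F'.deg_boundary
      F'.reachable_boundary h h'

/-- The code of a Grassmannian forest up to homeomorphism. -/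
def codeClass (n : ℕ) : Quotient (isoSetoid n) → Code .forest :=
  Quotient.lift code fun _ _ h => iso_iff.1 h

theorem codeClass_injective : Function.Injective (codeClass n) := by
  rintro ⟨F⟩ ⟨F'⟩ h
  exact Quotient.sound (iso_iff.2 h)

theorem good_code {F : GrassmannianForest n} (hF : F.IsContracted) : F.code.Good .generic := by
  obtain ⟨L, h⟩ := F.exists_occ_code
  exact h.goodAt F.isGoodVertex hF

theorem numBd_code (F : GrassmannianForest n) : F.code.numBd = n := by
  obtain ⟨L, h⟩ := F.exists_occ_code
  simpa using h.end_eq.symm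

/-- Every good code is the code of a contracted Grassmannian forest. -/
theorem exists_code_eq {c : Code .forest} (hc : c.Good .generic) (hn : c.numBd = n) :
    ∃ F : GrassmannianForest n, F.IsContracted ∧ F.code = c := by
  subst hn
  obtain ⟨F, hb, hr, L, h⟩ := c.exists_preForest
  have hgood : ∀ a, F.IsGoodVertex a := fun a =>
    h.isGoodVertex_of_goodAt hc a (h.mem_of_forest hb hr _)
  let G : GrassmannianForest c.numBd :=
    { F with
      planar := h.isPlanar hb hr
      deg_boundary := hb
      reachable_boundary := hr
      deg_ne_two := fun a => (hgood a).1
      hel_leaf := fun a => (hgood a).2.1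
      hel_internal := fun a => (hgood a).2.2 }
  exact ⟨G, fun v w hvw => h.contrast_of_goodAt hb hgood hc v w (h.mem_of_forest hb hr _) hvw,
    code_eq (F := G) h⟩

theorem image_contractedForests (n k r : ℕ) : codeClass n '' contractedForests n k r =
    {c | c.Good .generic ∧ c.numBd = n ∧ c.kStat = k ∧ c.rStat = r} := by
  ext c
  constructor
  · rintro ⟨-, ⟨F, rfl, h1, h2, h3⟩, rfl⟩
    obtain ⟨L, h⟩ := F.exists_occ_code
    have hg := good_code h1
    rw [F.helicity_eq h hg] at h2
    rw [F.momDim_eq h hg] at h3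
    exact ⟨hg, F.numBd_code, by exact_mod_cast h2, by exact_mod_cast h3⟩
  · rintro ⟨hg, hn, rfl, rfl⟩
    obtain ⟨F, hF, rfl⟩ := exists_code_eq hg hn
    obtain ⟨L, h⟩ := F.exists_occ_code
    exact ⟨⟦F⟧, ⟨F, rfl, hF, F.helicity_eq h hg, F.momDim_eq h hg⟩, rfl⟩

theorem image_contractedTrees (n k r : ℕ) : codeClass n '' contractedTrees n k r =
    {c | c.Good .generic ∧ c.numBd = n ∧ c.kStat = k ∧ c.rStat = r ∧ c.numRoots = 1} := by
  ext c
  constructor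
  · rintro ⟨-, ⟨F, rfl, h0, h1, h2, h3⟩, rfl⟩
    obtain ⟨L, h⟩ := F.exists_occ_code
    have hg := good_code h1
    rw [F.helicity_eq h hg] at h2
    rw [F.momDim_eq h hg] at h3
    exact ⟨hg, F.numBd_code, by exact_mod_cast h2, by exact_mod_cast h3, (F.isTree_iff h).1 h0⟩
  · rintro ⟨hg, hn, rfl, rfl, h0⟩
    obtain ⟨F, hF, rfl⟩ := exists_code_eq hg hn
    obtain ⟨L, h⟩ := F.exists_occ_code
    exact ⟨⟦F⟧, ⟨F, rfl, (F.isTree_iff h).2 h0, hF, F.helicity_eq h hg, F.momDim_eq h hg⟩, rfl⟩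

end GrassmannianForest
end

noncomputable section

theorem HasSum.congr_apply {ι A : Type*} [AddCommMonoid A] [TopologicalSpace A] {f g : ι → A} {a : A}
    (hf : HasSum f a) (h : ∀ i, g i = f i) : HasSum g a :=
  (funext h : g = f) ▸ hf

/-! ### Finiteness of the number of codes -/

namespace Code

/-- The number of constructors, with the helicities added. -/
def cpx : {κ : CodeKind} → Code κ → ℕ
  | _, leaf g => g.cpx + 1
  | _, node h cs => cs.cpx + h + 1
  | _, lnil => 1
  | _, lcons c cs => c.cpx + cs.cpx + 1
  | _, fnil => 1
  | _, fcons c g => c.cpx + g.cpx + 1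

theorem finite_cpx_le (N : ℕ) (κ : CodeKind) : {c : Code κ | c.cpx ≤ N}.Finite := by
  induction N generalizing κ with
  | zero =>
    convert Set.finite_empty
    ext c
    cases c <;> simp [cpx]
  | succ N ih =>
    cases κ with
    | tree =>
      refine (((ih .forest).image leaf).union
        ((Set.finite_Iic N).image2 node (ih .list))).subset fun c hc => ?_
      cases c with
      | leaf g =>
        simp only [cpx, Set.mem_ofPred_eq] at hc
        exact .inl ⟨g, by simp only [Set.mem_ofPred_eq]; omega, rfl⟩
      | node h cs =>
        simp only [cpx, Set.mem_ofPred_eq] at hc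
        exact .inr ⟨h, by simp only [Set.mem_Iic]; omega, cs, by simp only [Set.mem_ofPred_eq]; omega,
          rfl⟩
    | list =>
      refine ((Set.finite_singleton lnil).union
        ((ih .tree).image2 lcons (ih .list))).subset fun c hc => ?_
      cases c with
      | lnil => exact .inl rfl
      | lcons c cs =>
        simp only [cpx, Set.mem_ofPred_eq] at hc
        exact .inr ⟨c, by simp only [Set.mem_ofPred_eq]; omega, cs,
          by simp only [Set.mem_ofPred_eq]; omega, rfl⟩
    | forest =>
      refine ((Set.finite_singleton fnil).union
        ((ih .tree).image2 fcons (ih .forest))).subset fun c hc => ?_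
      cases c with
      | fnil => exact .inl rfl
      | fcons c cs =>
        simp only [cpx, Set.mem_ofPred_eq] at hc
        exact .inr ⟨c, by simp only [Set.mem_ofPred_eq]; omega, cs,
          by simp only [Set.mem_ofPred_eq]; omega, rfl⟩

/-- A good code is not much longer than its number of boundary vertices. The constants leave room
for the helicity of a vertex, which is at most the number of its children. -/
theorem Good.cpx_le {col : Color} {κ : CodeKind} {c : Code κ} (h : c.Good col) :
    match κ with
    | .tree => c.cpx + 6 ≤ 8 * c.numBd
    | .list => c.cpx + 5 * c.len ≤ 8 * c.numBd + 1
    | .forest => c.cpx ≤ 8 * c.numBd + 1 := by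
  induction c generalizing col with
  | leaf g ih =>
    have := ih h
    simp only [cpx, numBd] at this ⊢
    omega
  | node h' cs ih =>
    obtain ⟨h1, h2, h3, -, h4⟩ := h
    have := ih h4
    simp only [cpx, numBd] at this ⊢
    omega
  | lnil => simp [cpx, len]
  | lcons c cs ih1 ih2 =>
    have := ih1 h.1
    have := ih2 h.2
    simp only [cpx, numBd, len] at *
    omega
  | fnil => simp [cpx]
  | fcons c g ih1 ih2 =>
    have h2 := ih2 h.2
    rcases h.1 with ⟨h', hle, rfl⟩ | h1
    · simp only [cpx, numBd] at *
      omega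
    · have := ih1 h1
      simp only [cpx, numBd] at *
      omega

theorem Good.cpx_le' {col : Color} {κ : CodeKind} {c : Code κ} (h : c.Good col) :
    c.cpx ≤ 8 * c.numBd + 1 := by
  have := h.cpx_le
  cases κ <;> simp only at this <;> omega

/-! ### Generating functions of codes -/

section GeneratingFunction

open scoped PowerSeries.WithPiTopology
open PowerSeries

variable {R : Type*} [CommRing R] (y q z : R)

open Classical in
/-- The weight of a good code: `x`, `y`, `q` and `z` mark the boundary vertices, the helicity, the
mom-dimension and the trees. With `z = 0` only planted trees without gap forests are left. -/
def wt (col : Color) {κ : CodeKind} (c : Code κ) : R⟦X⟧ :=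
  if c.Good col then monomial c.numBd (z ^ c.numRoots * y ^ c.kStat * q ^ c.rStat) else 0

theorem wt_of_good {col : Color} {κ : CodeKind} {c : Code κ} (h : c.Good col) :
    wt y q z col c = monomial c.numBd (z ^ c.numRoots * y ^ c.kStat * q ^ c.rStat) := if_pos h

theorem wt_of_not_good {col : Color} {κ : CodeKind} {c : Code κ} (h : ¬ c.Good col) :
    wt y q z col c = 0 := if_neg h

theorem wt_leaf (col : Color) (g : Code .forest) :
    wt y q z col (leaf g) = X * wt y q z .generic g := by
  by_cases h : g.Good .generic
  · rw [wt_of_good y q z h, wt_of_good y q z (show (leaf g).Good col from h), X_eq,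
      monomial_mul_monomial, one_mul, Nat.add_comm]
    rfl
  · rw [wt_of_not_good y q z h, wt_of_not_good y q z (show ¬ (leaf g).Good col from h), mul_zero]

open Classical in
/-- The weight of an internal vertex of helicity `h` with `m` children. -/
def nodeWt (col : Color) (h m : ℕ) : R⟦X⟧ :=
  if 2 ≤ m ∧ 1 ≤ h ∧ h ≤ m ∧ (color h m = .generic ∨ color h m ≠ col) then
    C (y ^ (h - 1) * q ^ mStat (color h m) m) else 0

theorem wt_node (col : Color) (h : ℕ) (cs : Code .list) : wt y q z col (node h cs) =
    nodeWt y q col h cs.len * wt y q z (color h cs.len) cs := by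
  by_cases h1 : 2 ≤ cs.len ∧ 1 ≤ h ∧ h ≤ cs.len ∧
      (color h cs.len = .generic ∨ color h cs.len ≠ col)
  · rw [nodeWt, if_pos h1]
    by_cases h2 : cs.Good (color h cs.len)
    · rw [wt_of_good y q z h2, wt_of_good y q z (show (node h cs).Good col from
        ⟨h1.1, h1.2.1, h1.2.2.1, h1.2.2.2, h2⟩), ← monomial_zero_eq_C_apply,
        monomial_mul_monomial, zero_add]
      congr 1
      simp only [numRoots, kStat, rStat]
      ring
    · rw [wt_of_not_good y q z h2, wt_of_not_good y q z fun h' : (node h cs).Good col => h2 h'.2.2.2.2, mul_zero]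
  · rw [nodeWt, if_neg h1, zero_mul, wt_of_not_good]
    exact fun h' => h1 ⟨h'.1, h'.2.1, h'.2.2.1, h'.2.2.2.1⟩

theorem wt_lnil (col : Color) : wt y q z col lnil = 1 := by
  rw [wt_of_good y q z (show lnil.Good col from trivial)]
  simp [numBd, numRoots, kStat, rStat]

theorem wt_lcons (col : Color) (c : Code .tree) (cs : Code .list) :
    wt y q z col (lcons c cs) = wt y q z col c * wt y q z col cs := by
  by_cases h1 : c.Good col
  · by_cases h2 : cs.Good col
    · rw [wt_of_good y q z h1, wt_of_good y q z h2,
        wt_of_good y q z (show (lcons c cs).Good col from ⟨h1, h2⟩), monomial_mul_monomial]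
      simp only [numBd, numRoots, kStat, rStat]
      congr 1
      ring
    · rw [wt_of_not_good y q z h2, wt_of_not_good y q z fun h' : (lcons c cs).Good col => h2 h'.2,
        mul_zero]
  · rw [wt_of_not_good y q z h1,
      wt_of_not_good y q z fun h' : (lcons c cs).Good col => h1 h'.1, zero_mul]

theorem wt_fnil (col : Color) : wt y q z col fnil = 1 := by
  rw [wt_of_good y q z (show fnil.Good col from trivial)]
  simp [numBd, numRoots, kStat, rStat]

open Classical in
/-- The weight of a lollipop. -/
def lollipopWt (c : Code .tree) : R⟦X⟧ := if c.IsLollipop then C (y ^ c.rootK) else 0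

/-- The weight of a planted tree that hangs from a boundary vertex, without the factor `x * z` of
this vertex. -/
def rootedWt (c : Code .tree) : R⟦X⟧ := C (y * q) * wt y q z .generic c + lollipopWt y c

theorem wt_fcons (col : Color) (c : Code .tree) (g : Code .forest) :
    wt y q z col (fcons c g) = X * C z * rootedWt y q z c * wt y q z .generic g := by
  have hgood : (fcons c g).Good col ↔ (c.IsLollipop ∨ c.Good .generic) ∧ g.Good .generic := Iff.rfl
  by_cases h2 : g.Good .generic
  · by_cases h0 : c.IsLollipop
    · have h1 : ¬ c.Good .generic := by
        obtain ⟨h, hle, rfl⟩ := h0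
        simp [Good, len]
      rw [rootedWt, lollipopWt, if_pos h0, wt_of_not_good y q z h1, wt_of_good y q z h2,
        wt_of_good y q z (hgood.2 ⟨.inl h0, h2⟩)]
      obtain ⟨h, hle, rfl⟩ := h0
      have h3 : h - 1 = 0 := by omega
      have h4 : mStat (color h 0) 0 = 0 := by
        simp only [color]
        split_ifs <;> rfl
      simp only [X_eq, ← monomial_zero_eq_C_apply, monomial_mul_monomial, mul_zero, zero_add,
        numBd, numRoots, kStat, rStat, rootK, rootR, len, h3, h4]
      rw [show 1 + 0 + 0 + g.numBd = g.numBd + 1 by omega]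
      congr 1
      ring
    · by_cases h1 : c.Good .generic
      · rw [rootedWt, lollipopWt, if_neg h0, wt_of_good y q z h1, wt_of_good y q z h2,
          wt_of_good y q z (hgood.2 ⟨.inr h1, h2⟩)]
        simp only [X_eq, ← monomial_zero_eq_C_apply, monomial_mul_monomial, add_zero,
          numBd, numRoots, kStat, rStat, h1.rootK_eq, h1.rootR_eq]
        rw [show c.numBd + g.numBd + 1 = 1 + (0 + c.numBd) + g.numBd by omega]
        congr 1
        ring
      · rw [rootedWt, lollipopWt, if_neg h0, wt_of_not_good y q z h1, wt_of_not_good y q z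
          fun h' => (hgood.1 h').1.elim h0 h1]
        simp
  · rw [wt_of_not_good y q z h2, wt_of_not_good y q z fun h' => h2 (hgood.1 h').2, mul_zero]

theorem good_of_coeff_wt_ne_zero {col : Color} {κ : CodeKind} {c : Code κ} {n : ℕ}
    (h : coeff n (wt y q z col c) ≠ 0) : c.Good col ∧ c.numBd = n := by
  by_cases hc : c.Good col
  · rw [wt_of_good y q z hc, coeff_monomial] at h
    exact ⟨hc, by_contra fun h' => h (if_neg (Ne.symm h'))⟩
  · simp [wt_of_not_good y q z hc] at h

variable [UniformSpace R]

theorem summable_of_coeff_ne_zero {κ : CodeKind} {f : Code κ → R⟦X⟧}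
    (h : ∀ c n, coeff n (f c) ≠ 0 → c.cpx ≤ 8 * n + 1) : Summable f := by
  rw [PowerSeries.WithPiTopology.summable_iff_summable_coeff]
  intro n
  exact summable_of_hasFiniteSupport ((finite_cpx_le (8 * n + 1) κ).subset fun c hc => h c n hc)

theorem summable_wt (col : Color) (κ : CodeKind) :
    Summable (fun c : Code κ => wt y q z col c) := by
  refine summable_of_coeff_ne_zero fun c n h => ?_
  obtain ⟨h1, rfl⟩ := good_of_coeff_wt_ne_zero y q z h
  exact h1.cpx_le'

/-- The generating function of planted trees that hang from an internal vertex. -/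
def treeGF (col : Color) : R⟦X⟧ := ∑' c : Code .tree, wt y q z col c

/-- The generating function of forests. -/
def forestGF : R⟦X⟧ := ∑' c : Code .forest, wt y q z .generic c

theorem hasSum_treeGF (col : Color) :
    HasSum (fun c : Code .tree => wt y q z col c) (treeGF y q z col) :=
  (summable_wt y q z col .tree).hasSum

theorem hasSum_forestGF :
    HasSum (fun c : Code .forest => wt y q z .generic c) (forestGF y q z) :=
  (summable_wt y q z .generic .forest).hasSum

/-- The generating function of lollipops: one has helicity `0`, the other `1`. -/
theorem hasSum_lollipopWt : HasSum (lollipopWt (R := R) y) (1 + C y) := by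
  have hinj : Function.Injective fun h : ℕ => node h lnil := by
    intro h h' heq
    cases heq
    rfl
  rw [← hinj.hasSum_iff]
  · have hsum := hasSum_sum_of_ne_finset_zero (s := Finset.range 2) (f := (lollipopWt (R := R) y) ∘
      fun h : ℕ => node h lnil) (L := .unconditional ℕ) ?_
    · convert hsum using 1
      have h0 : (node 0 lnil).IsLollipop := ⟨0, by omega, rfl⟩
      have h1 : (node 1 lnil).IsLollipop := ⟨1, by omega, rfl⟩
      simp [Finset.sum_range_succ, lollipopWt, h0, h1, rootK]
    · intro h hh
      refine if_neg ?_
      rintro ⟨h', hle, heq⟩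
      cases heq
      simp at hh
      omega
  · intro c hc
    refine if_neg ?_
    rintro ⟨h', hle, rfl⟩
    exact hc ⟨h', rfl⟩

variable [DiscreteUniformity R]

theorem constantCoeff_treeGF (col : Color) : constantCoeff (treeGF y q z col) = 0 := by
  have h := (WithPiTopology.hasSum_iff_hasSum_coeff R).1 (hasSum_treeGF y q z col) 0
  rw [coeff_zero_eq_constantCoeff_apply] at h
  refine h.unique ?_
  convert hasSum_zero using 1
  funext c
  by_contra hc
  obtain ⟨h1, h2⟩ := good_of_coeff_wt_ne_zero y q z hc
  have := h1.cpx_le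
  simp only at this
  omega

theorem hasSum_list (col : Color) (m : ℕ) :
    HasSum (fun cs : Code .list => if cs.len = m then wt y q z col cs else 0)
      (treeGF y q z col ^ m) := by
  have hs : ∀ m, Summable fun cs : Code .list => if cs.len = m then wt y q z col cs else 0 := by
    intro m
    refine summable_of_coeff_ne_zero fun c n h => ?_
    by_cases hc : c.len = m
    · rw [if_pos hc] at h
      obtain ⟨h1, rfl⟩ := good_of_coeff_wt_ne_zero y q z h
      exact h1.cpx_le'
    · simp [hc] at h
  induction m with
  | zero =>
    rw [pow_zero, ← wt_lnil y q z col]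
    refine hasSum_single (f := fun cs : Code .list => if cs.len = 0 then wt y q z col cs else 0)
      lnil fun cs hcs => ?_
    cases cs with
    | lnil => exact absurd rfl hcs
    | lcons c cs => simp [len]
  | succ m ih =>
    have hinj : Function.Injective fun p : Code .tree × Code .list => lcons p.1 p.2 := by
      rintro ⟨a, b⟩ ⟨a', b'⟩ h
      cases h
      rfl
    have hcomp : (fun cs : Code .list => if cs.len = m + 1 then wt y q z col cs else 0) ∘
        (fun p : Code .tree × Code .list => lcons p.1 p.2) =
        fun p => wt y q z col p.1 * if p.2.len = m then wt y q z col p.2 else 0 := by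
      funext p
      simp [len, wt_lcons]
    have h1 := (hasSum_treeGF y q z col).mul ih (hcomp ▸ (hs (m + 1)).comp_injective hinj)
    rw [← hcomp] at h1
    rw [pow_succ', ← hinj.hasSum_iff]
    · exact h1
    · intro cs hcs
      cases cs with
      | lnil => simp [len]
      | lcons c cs => exact absurd ⟨(c, cs), rfl⟩ hcs

theorem hasSum_rootedWt :
    HasSum (rootedWt y q z) (C (y * q) * treeGF y q z .generic + (1 + C y)) :=
  ((hasSum_treeGF y q z .generic).mul_left _).add (hasSum_lollipopWt y)

/-- A forest is empty, or consists of a root with its tree and the rest of the forest. -/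
theorem forestGF_eq : forestGF y q z =
    1 + X * C z * (C (y * q) * treeGF y q z .generic + (1 + C y)) * forestGF y q z := by
  have hinj : Function.Injective fun p : Code .tree × Code .forest => fcons p.1 p.2 := by
    rintro ⟨a, b⟩ ⟨a', b'⟩ h
    cases h
    rfl
  have hcomp : (fun c : Code .forest => wt y q z .generic c) ∘
      (fun p : Code .tree × Code .forest => fcons p.1 p.2) =
      fun p => (X * C z * rootedWt y q z p.1) * wt y q z .generic p.2 := by
    funext p
    simp [wt_fcons]
  have h1 := ((hasSum_rootedWt y q z).mul_left (X * C z)).mul (hasSum_forestGF y q z)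
    (hcomp ▸ (summable_wt y q z .generic .forest).comp_injective hinj)
  rw [← hcomp] at h1
  -- the sum over non-empty forests, extended by zero
  have h2 : HasSum (fun c : Code .forest => wt y q z .generic c - if c.size = 0 then 1 else 0)
      (X * C z * (C (y * q) * treeGF y q z .generic + (1 + C y)) * forestGF y q z) := by
    rw [← hinj.hasSum_iff]
    · exact h1.congr_apply fun p => by simp [size]
    · intro c hc
      cases c with
      | fnil => simp [size, wt_fnil]
      | fcons c g => exact absurd ⟨(c, g), rfl⟩ hc
  have h3 : HasSum (fun c : Code .forest => if c.size = 0 then (1 : R⟦X⟧) else 0) 1 := by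
    refine hasSum_single (f := fun c : Code .forest => if c.size = 0 then (1 : R⟦X⟧) else 0)
      fnil fun c hc => ?_
    cases c with
    | fnil => exact absurd rfl hc
    | fcons c g => simp [size]
  refine (hasSum_forestGF y q z).unique ?_
  exact (h3.add h2).congr_apply fun c => by ring

/-- Whether a planted tree is a boundary vertex. -/
def isLeaf : Code .tree → Bool
  | leaf _ => true
  | node _ _ => false

/-- Planted trees are boundary vertices with a forest in the gap before them, or have an internal
vertex as top, from which a list of planted trees hangs. -/
theorem treeGF_eq_add (col : Color) : ∃ N : R⟦X⟧, treeGF y q z col = X * forestGF y q z + N ∧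
    HasSum (fun p : ℕ × ℕ => nodeWt y q col p.1 p.2 * treeGF y q z (color p.1 p.2) ^ p.2) N := by
  have hinj : Function.Injective fun p : ℕ × Code .list => node p.1 p.2 := by
    rintro ⟨a, b⟩ ⟨a', b'⟩ h
    cases h
    rfl
  have hinj' : Function.Injective leaf := by
    intro a b h
    cases h
    rfl
  have hinj'' : Function.Injective fun p : ℕ × Code .list => ((p.1, p.2.len), p.2) := by
    rintro ⟨a, b⟩ ⟨a', b'⟩ h
    simp only [Prod.mk.injEq] at h ⊢
    exact ⟨h.1.1, h.2⟩
  obtain ⟨N, hN⟩ := (summable_wt y q z col .tree).comp_injective hinj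
  refine ⟨N, ?_, ?_⟩
  · have h1 : HasSum (fun c : Code .tree => wt y q z col c * if c.isLeaf then 1 else 0)
        (X * forestGF y q z) := by
      rw [← hinj'.hasSum_iff]
      · exact ((hasSum_forestGF y q z).mul_left X).congr_apply fun g => by simp [isLeaf, wt_leaf]
      · intro c hc
        cases c with
        | leaf g => exact absurd ⟨g, rfl⟩ hc
        | node h cs => simp [isLeaf]
    have h2 : HasSum (fun c : Code .tree => wt y q z col c * if c.isLeaf then 0 else 1) N := by
      rw [← hinj.hasSum_iff]
      · exact hN.congr_apply fun p => by simp [isLeaf]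
      · intro c hc
        cases c with
        | leaf g => simp [isLeaf]
        | node h cs => exact absurd ⟨(h, cs), rfl⟩ hc
    refine (hasSum_treeGF y q z col).unique ?_
    exact (h1.add h2).congr_apply fun c => by cases c <;> simp [isLeaf]
  · have hcomp : (fun c : Code .tree => wt y q z col c) ∘
        (fun p : ℕ × Code .list => node p.1 p.2) =
        (fun t : (ℕ × ℕ) × Code .list => nodeWt y q col t.1.1 t.1.2 *
          if t.2.len = t.1.2 then wt y q z (color t.1.1 t.1.2) t.2 else 0) ∘
        fun p : ℕ × Code .list => ((p.1, p.2.len), p.2) := by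
      funext p
      simp [wt_node]
    rw [hcomp, hinj''.hasSum_iff] at hN
    · have h1 : ∀ p : ℕ × ℕ, HasSum (fun cs : Code .list => nodeWt y q col p.1 p.2 *
          if cs.len = p.2 then wt y q z (color p.1 p.2) cs else 0)
          (nodeWt y q col p.1 p.2 * treeGF y q z (color p.1 p.2) ^ p.2) := fun p =>
        HasSum.mul_left (nodeWt y q col p.1 p.2) (hasSum_list y q z (color p.1 p.2) p.2)
      exact HasSum.prod_fiberwise hN h1
    · rintro ⟨⟨h, m⟩, cs⟩ hm
      simp only
      rw [if_neg, mul_zero]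
      rintro rfl
      exact hm ⟨(h, cs), rfl⟩

end GeneratingFunction

end Code
end

noncomputable section

namespace Code

/-! ### The equations for the generating functions of codes -/

section System

open scoped PowerSeries.WithPiTopology
open PowerSeries

variable {R : Type*} [CommRing R] (y q z : R)

open Classical in
/-- The generating function of the planted trees whose top has colour `k`, helicity `p.1` and `p.2`
children, where `P` is the generating function of the planted trees that may hang from such a
top. -/
def kindWt (P : R⟦X⟧) (k : Color) (p : ℕ × ℕ) : R⟦X⟧ :=
  if 2 ≤ p.2 ∧ 1 ≤ p.1 ∧ p.1 ≤ p.2 ∧ color p.1 p.2 = k then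
    C (y ^ (p.1 - 1) * q ^ mStat k p.2) * P ^ p.2 else 0

open Classical in
/-- The colour of the parent excludes only white tops, or only black tops, or no tops. -/
theorem nodeWt_mul (T : Color → R⟦X⟧) (col : Color) (p : ℕ × ℕ) :
    nodeWt y q col p.1 p.2 * T (color p.1 p.2) ^ p.2 =
      (if col = .white then 0 else kindWt y q (T .white) .white p) +
      (if col = .black then 0 else kindWt y q (T .black) .black p) +
      kindWt y q (T .generic) .generic p := by
  by_cases h : 2 ≤ p.2 ∧ 1 ≤ p.1 ∧ p.1 ≤ p.2
  · obtain ⟨h1, h2, h3⟩ := h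
    simp only [nodeWt, kindWt, h1, h2, h3, true_and]
    generalize color p.1 p.2 = k
    cases k <;> cases col <;> simp
  · have h1 : ∀ Q : Prop, ¬ (2 ≤ p.2 ∧ 1 ≤ p.1 ∧ p.1 ≤ p.2 ∧ Q) := fun Q h' =>
      h ⟨h'.1, h'.2.1, h'.2.2.1⟩
    simp [nodeWt, kindWt, h1]

variable [UniformSpace R] [DiscreteUniformity R]

theorem exists_hasSum_pow {u : R⟦X⟧} (hu : constantCoeff u = 0) :
    ∃ S, HasSum (fun i : ℕ => u ^ i) S ∧ S * (1 - u) = 1 :=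
  ⟨_, (WithPiTopology.summable_pow_of_constantCoeff_eq_zero hu).hasSum,
    WithPiTopology.tsum_pow_mul_one_sub_of_constantCoeff_eq_zero hu⟩

/-- White vertices have helicity `1`, and the sum over the number of children is geometric. -/
theorem exists_hasSum_white {P : R⟦X⟧} (hP : constantCoeff P = 0) :
    ∃ W, HasSum (kindWt y q P .white) W ∧ W * (1 - C q * P) = C q * P ^ 2 := by
  obtain ⟨S, hS, hS'⟩ := exists_hasSum_pow (u := C q * P) (by simp [hP])
  have hinj : Function.Injective fun i : ℕ => (1, i + 2) := fun i j h => by simpa using h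
  refine ⟨C q * P ^ 2 * S, ?_, by rw [mul_assoc, hS', mul_one]⟩
  rw [← hinj.hasSum_iff]
  · refine (hS.mul_left (C q * P ^ 2)).congr_apply fun i => ?_
    have : mStat .white (i + 2) = i + 1 := rfl
    simp [kindWt, color, this]
    ring
  · rintro ⟨h, m⟩ hm
    refine if_neg ?_
    rintro ⟨h1, h2, h3, h4⟩
    simp only at h1 h2 h3 h4
    rw [color] at h4
    split_ifs at h4 with h5
    exact hm ⟨m - 2, by simp only [Prod.mk.injEq]; omega⟩

/-- Black vertices have as helicity the number of children, and the sum over it is geometric. -/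
theorem exists_hasSum_black {P : R⟦X⟧} (hP : constantCoeff P = 0) :
    ∃ B, HasSum (kindWt y q P .black) B ∧ B * (1 - C y * C q * P) = C y * C q * P ^ 2 := by
  obtain ⟨S, hS, hS'⟩ := exists_hasSum_pow (u := C y * C q * P) (by simp [hP])
  have hinj : Function.Injective fun i : ℕ => (i + 2, i + 2) := fun i j h => by simpa using h
  refine ⟨C y * C q * P ^ 2 * S, ?_, by rw [mul_assoc, hS', mul_one]⟩
  rw [← hinj.hasSum_iff]
  · refine (hS.mul_left (C y * C q * P ^ 2)).congr_apply fun i => ?_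
    have : mStat .black (i + 2) = i + 1 := rfl
    simp [kindWt, color, this]
    ring
  · rintro ⟨h, m⟩ hm
    refine if_neg ?_
    rintro ⟨h1, h2, h3, h4⟩
    simp only at h1 h2 h3 h4
    rw [color] at h4
    split_ifs at h4 with h5 h6
    exact hm ⟨m - 2, by simp only [Prod.mk.injEq]; omega⟩

/-- For generic vertices, the sum over the helicity and over its difference to the number of children
is a product of two geometric series. -/
theorem eq_of_hasSum_generic {P G : R⟦X⟧} (hP : constantCoeff P = 0)
    (hG : HasSum (kindWt y q P .generic) G) :
    G * ((1 - C y * C q ^ 2 * P) * (1 - C q ^ 2 * P)) = C y * C q ^ 3 * P ^ 3 := by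
  obtain ⟨S, hS, hS'⟩ := exists_hasSum_pow (u := C y * C q ^ 2 * P) (by simp [hP])
  obtain ⟨T, hT, hT'⟩ := exists_hasSum_pow (u := C q ^ 2 * P) (by simp [hP])
  have hinj : Function.Injective fun p : ℕ × ℕ => (p.1 + 2, p.1 + p.2 + 3) := by
    rintro ⟨i, j⟩ ⟨i', j'⟩ h
    simp only [Prod.mk.injEq] at h ⊢
    omega
  have hcomp : kindWt y q P .generic ∘ (fun p : ℕ × ℕ => (p.1 + 2, p.1 + p.2 + 3)) =
      fun p => (C y * C q ^ 3 * P ^ 3 * (C y * C q ^ 2 * P) ^ p.1) * (C q ^ 2 * P) ^ p.2 := by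
    funext ⟨i, j⟩
    have h1 : color (i + 2) (i + j + 3) = .generic := by
      rw [color, if_neg (by omega), if_neg (by omega)]
    have h2 : mStat .generic (i + j + 3) = 2 * i + 2 * j + 3 := by
      simp only [mStat]
      omega
    have h3 : 2 ≤ i + j + 3 ∧ 1 ≤ i + 2 ∧ i + 2 ≤ i + j + 3 := by omega
    simp only [Function.comp_apply, kindWt, h1, h2, h3, and_self, if_true, map_mul, map_pow]
    rw [show i + 2 - 1 = i + 1 by omega]
    ring
  have h1 := hcomp ▸ hG.summable.comp_injective hinj
  have h2 := (hS.mul_left (C y * C q ^ 3 * P ^ 3)).mul hT h1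
  rw [← hcomp, hinj.hasSum_iff] at h2
  · rw [hG.unique h2]
    calc _ = C y * C q ^ 3 * P ^ 3 * (S * (1 - C y * C q ^ 2 * P)) * (T * (1 - C q ^ 2 * P)) := by
          ring
      _ = _ := by rw [hS', hT']; ring
  · rintro ⟨h, m⟩ hm
    refine if_neg ?_
    rintro ⟨h1, h2, h3, h4⟩
    simp only at h1 h2 h3 h4
    rw [color] at h4
    split_ifs at h4 with h5 h6
    exact hm ⟨(h - 2, m - h - 1), by simp only [Prod.mk.injEq]; omega⟩

/-- The equation between the generating functions of planted trees and of forests. The terms of the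
sum of the planted trees whose top is an internal vertex are split by its colour; a planted tree
with white top has children without white top, so that its generating function `W` satisfies
`W * (1 - q * (P - W)) = q * (P - W) ^ 2`, whence `W * (1 + q * P) = q * P ^ 2`, and similarly for
black. -/
theorem treeGF_eq {P : R⟦X⟧} (hP : treeGF y q z .generic = P) :
    X * forestGF y q z * ((1 + P * C q) * (1 + P * C y * C q) * (1 - P * C q ^ 2) *
      (1 - P * C y * C q ^ 2)) =
    P * (1 - P * (1 + C y) * C q ^ 2 - P ^ 2 * C y * C q ^ 2 * (1 + C q - C q ^ 2) -
      P ^ 4 * C y ^ 2 * C q ^ 5 * (1 + C q)) := by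
  classical
  have hc := constantCoeff_treeGF y q z
  obtain ⟨W, hW, hW'⟩ := exists_hasSum_white y q (hc .white)
  obtain ⟨B, hB, hB'⟩ := exists_hasSum_black y q (hc .black)
  obtain ⟨N₁, h1, h1'⟩ := treeGF_eq_add y q z .white
  obtain ⟨N₂, h2, h2'⟩ := treeGF_eq_add y q z .black
  obtain ⟨N₃, h3, h3'⟩ := treeGF_eq_add y q z .generic
  simp only [nodeWt_mul y q (treeGF y q z)] at h1' h2' h3'
  simp only [if_true, reduceCtorEq, if_false, zero_add, add_zero] at h1' h2' h3'
  have hG : HasSum (kindWt y q (treeGF y q z .generic) .generic) (N₃ - (W + B)) :=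
    (h3'.sub (hW.add hB)).congr_apply fun p => by ring
  have hG' := eq_of_hasSum_generic y q (hc .generic) hG
  have e1 := h1'.unique (hB.add hG)
  have e2 := h2'.unique (hW.add hG)
  rw [h1, e1] at hW'
  rw [h2, e2] at hB'
  rw [hP] at h3 hG'
  obtain ⟨G, hGdef⟩ : ∃ G, N₃ = W + B + G := ⟨N₃ - (W + B), by ring⟩
  subst hGdef
  generalize X * forestGF y q z = x at *
  have kW : W * (1 + C q * P) = C q * P ^ 2 := by
    rw [h3]
    linear_combination hW'
  have kB : B * (1 + C y * C q * P) = C y * C q * P ^ 2 := by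
    rw [h3]
    linear_combination hB'
  have kG : G * ((1 - C y * C q ^ 2 * P) * (1 - C q ^ 2 * P)) = C y * C q ^ 3 * P ^ 3 := by
    linear_combination hG'
  have hx : x = P - W - B - G := by rw [h3]; ring
  rw [hx]
  linear_combination (- (1 + P * C y * C q) * (1 - P * C q ^ 2) * (1 - P * C y * C q ^ 2)) * kW -
    (1 + P * C q) * (1 - P * C q ^ 2) * (1 - P * C y * C q ^ 2) * kB -
    (1 + P * C q) * (1 + P * C y * C q) * kG

end System

end Code
end

noncomputable section

/-! ### Lagrange inversion -/

namespace PowerSeries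

variable {R : Type*} [CommRing R]

theorem eq_substInvOfIsUnit {f g : R⟦X⟧} (hf : constantCoeff f = 0) (hf' : IsUnit (coeff 1 f))
    (hg : constantCoeff g = 0) (h : f.subst g = X) : g = f.substInvOfIsUnit hf' := by
  have hg' : HasSubst g := .of_constantCoeff_zero' hg
  have hf'' : HasSubst f := .of_constantCoeff_zero' hf
  have h1 := subst_comp_subst_apply hf'' hg' (f.substInvOfIsUnit hf')
  rw [h, subst_substInvOfIsUnit_left f hf hf', X_subst] at h1
  exact (subst_X hg').symm.trans h1

/-- The derivative of `g ^ k` times `φ ^ n` has no term of degree `n - 1` if `0 < k < n`; this is the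
vanishing of the residue of the derivative of `g ^ (k - n)`. With `j = n - k` only the factor below
is left, up to a power of `x`. -/
theorem coeff_derivative_mul_pow_succ [IsDomain R] [CharZero R] {g φ : R⟦X⟧} (h : g * φ = X) {j : ℕ}
    (hj : j ≠ 0) : coeff j (derivative R g * φ ^ (j + 1)) = 0 := by
  have h1 : derivative R g * φ + g * derivative R φ = 1 := by
    have := congrArg (derivative R) h
    rw [Derivation.leibniz, derivative_X, smul_eq_mul, smul_eq_mul] at this
    linear_combination this
  obtain ⟨i, rfl⟩ := Nat.exists_eq_succ_of_ne_zero hj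
  have h2 : ((i + 1 : ℕ) : R⟦X⟧) * (derivative R g * φ ^ (i + 1 + 1)) =
      ((i + 1 : ℕ) : R⟦X⟧) * φ ^ (i + 1) - X * derivative R (φ ^ (i + 1)) := by
    rw [derivative_pow, Nat.add_sub_cancel, ← h]
    push_cast
    linear_combination ((i : R⟦X⟧) + 1) * φ ^ (i + 1) * h1
  have h3 := congrArg (coeff (i + 1)) h2
  rw [map_sub, coeff_succ_X_mul, coeff_derivative, ← map_natCast C, coeff_C_mul, coeff_C_mul] at h3
  have h4 : ((i + 1 : ℕ) : R) ≠ 0 := Nat.cast_ne_zero.2 (Nat.succ_ne_zero i)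
  refine (mul_eq_zero.1 (h3.trans ?_)).resolve_left h4
  push_cast
  ring

/-- Lagrange inversion: if `f` is the compositional inverse of `g = x / φ`, then `n [xⁿ] f` is the
coefficient `[xⁿ⁻¹] φⁿ`. -/
theorem lagrange [IsDomain R] [CharZero R] {f g φ : R⟦X⟧} (h : g * φ = X)
    (hg : constantCoeff g = 0) (hf : f.subst g = X) (n : ℕ) :
    ((n + 1 : ℕ) : R) * coeff (n + 1) f = coeff n (φ ^ (n + 1)) := by
  have hg' : HasSubst g := .of_constantCoeff_zero' hg
  obtain ⟨a, hgdef⟩ : X ∣ g := X_dvd_iff.2 hg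
  have ha : a * φ = 1 := by
    refine mul_left_cancel₀ (X_ne_zero (R := R)) ?_
    rw [← mul_assoc, ← hgdef, h, mul_one]
  -- split off the terms of degree greater than `n + 1`
  set p := trunc (n + 2) f with hp
  obtain ⟨r, hr⟩ : ∃ r : R⟦X⟧, f = (p : R⟦X⟧) + X ^ (n + 2) * r := by
    obtain ⟨r, hr⟩ : (X : R⟦X⟧) ^ (n + 2) ∣ f - p := by
      rw [X_pow_dvd_iff]
      intro m hm
      rw [map_sub, hp, Polynomial.coeff_coe, coeff_trunc, if_pos hm, sub_self]
    exact ⟨r, by rw [← hr]; ring⟩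
  have h1 : ∑ k ∈ Finset.range (n + 2), C (coeff k f) * g ^ k + X ^ (n + 2) * (a ^ (n + 2) *
      r.subst g) = X := by
    have h2 : (p : R⟦X⟧).subst g = ∑ k ∈ Finset.range (n + 2), C (coeff k f) * g ^ k := by
      rw [subst_coe hg', Polynomial.aeval_eq_sum_range' (n := n + 2) (natDegree_trunc_lt f (n + 1))]
      refine Finset.sum_congr rfl fun k hk => ?_
      rw [coeff_trunc, if_pos (Finset.mem_range.1 hk), smul_eq_C_mul]
    have h3 := hf
    rw [hr, subst_add hg', subst_mul hg', subst_pow hg', subst_X hg', h2,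
      show g ^ (n + 2) = X ^ (n + 2) * a ^ (n + 2) by rw [hgdef, mul_pow], mul_assoc] at h3
    exact h3
  have h2 := congrArg (fun u => coeff n (derivative R u * φ ^ (n + 1))) h1
  simp only [map_add, map_sum, derivative_X, one_mul, add_mul, Finset.sum_mul] at h2
  rw [← h2]
  have h3 : coeff n (derivative R (X ^ (n + 2) * (a ^ (n + 2) * r.subst g)) * φ ^ (n + 1)) = 0 := by
    have h4 : (X : R⟦X⟧) ^ (n + 1) ∣ derivative R (X ^ (n + 2) * (a ^ (n + 2) * r.subst g)) := by
      rw [Derivation.leibniz, derivative_pow, derivative_X, smul_eq_mul, smul_eq_mul]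
      refine dvd_add ⟨X * derivative R (a ^ (n + 2) * r.subst g), by ring⟩
        ⟨a ^ (n + 2) * r.subst g * ((n + 2 : ℕ) : R⟦X⟧), ?_⟩
      rw [show n + 2 - 1 = n + 1 by omega]
      ring
    exact X_pow_dvd_iff.1 (h4.mul_right _) n (Nat.lt_succ_self n)
  rw [h3, add_zero]
  have key : ∀ i ≤ n, coeff n (derivative R (C (coeff (i + 1) f) * g ^ (i + 1)) * φ ^ (n + 1)) =
      ((i + 1 : ℕ) : R) * coeff (i + 1) f * coeff (n - i) (derivative R g * φ ^ (n - i + 1)) := by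
    intro i hi
    have h4 : derivative R (C (coeff (i + 1) f) * g ^ (i + 1)) * φ ^ (n + 1) =
        C (((i + 1 : ℕ) : R) * coeff (i + 1) f) *
          (X ^ i * (derivative R g * φ ^ (n - i + 1))) := by
      rw [Derivation.leibniz, derivative_C, derivative_pow, smul_eq_mul, smul_zero, add_zero,
        show n + 1 = i + (n - i + 1) by omega, pow_add, ← h, Nat.add_sub_cancel, mul_pow,
        map_mul C, map_natCast C]
      ring
    rw [h4, coeff_C_mul, coeff_X_pow_mul', if_pos hi]
  rw [Finset.sum_eq_single (n + 1)]
  · have h4 : derivative R g * φ = 1 + X * (derivative R a * φ) := by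
      rw [hgdef, Derivation.leibniz, derivative_X, smul_eq_mul, smul_eq_mul]
      linear_combination ha
    rw [key n le_rfl, Nat.sub_self, zero_add, pow_one, h4]
    simp
  · rintro (_ | i) hk hkn
    · simp
    · have := Finset.mem_range.1 hk
      rw [key i (by omega), coeff_derivative_mul_pow_succ h (by omega), mul_zero]
  · simp

end PowerSeries
end

noncomputable section

/-! ### Counting codes -/

namespace Code

open scoped PowerSeries.WithPiTopology
open PowerSeries

theorem finite_good (n : ℕ) : {c : Code .forest | c.Good .generic ∧ c.numBd = n}.Finite :=
  (finite_cpx_le (8 * n + 1) .forest).subset fun c hc => by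
    have := hc.1.cpx_le'
    rw [hc.2] at this
    exact this

theorem coeff_monomial_mul_monomial (k r k' r' : ℕ) :
    MvPolynomial.coeff (Finsupp.single 0 k + Finsupp.single 1 r)
      ((MvPolynomial.X 0 : MvPolynomial (Fin 2) ℚ) ^ k' * MvPolynomial.X 1 ^ r') =
      if k' = k ∧ r' = r then 1 else 0 := by
  rw [MvPolynomial.X_pow_eq_monomial, MvPolynomial.X_pow_eq_monomial, MvPolynomial.monomial_mul,
    MvPolynomial.coeff_monomial, one_mul]
  refine if_congr ⟨fun h => ?_, ?_⟩ rfl rfl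
  · have h0 := DFunLike.congr_fun h 0
    have h1 := DFunLike.congr_fun h 1
    simpa using And.intro h0 h1
  · rintro ⟨rfl, rfl⟩
    rfl

/-- The coefficients of a generating function count. -/
theorem ncard_eq_coeffXYQ [UniformSpace GrassmannianGF.CoeffRing]
    [DiscreteUniformity GrassmannianGF.CoeffRing] {ι : Type*}
    {f : ι → GrassmannianGF.CoeffRing⟦X⟧} {S : GrassmannianGF.CoeffRing⟦X⟧} (hS : HasSum f S)
    (p : ι → Prop) (a b c : ι → ℕ) (hf : ∀ i, p i → f i = monomial (a i)
      (MvPolynomial.X 0 ^ b i * MvPolynomial.X 1 ^ c i)) (hf' : ∀ i, ¬ p i → f i = 0)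
    {n : ℕ} (hfin : {i | p i ∧ a i = n}.Finite) (k r : ℕ) :
    ({i | p i ∧ a i = n ∧ b i = k ∧ c i = r}.ncard : ℚ) = GrassmannianGF.coeffXYQ n k r S := by
  classical
  have h1 := (WithPiTopology.hasSum_iff_hasSum_coeff _).1 hS n
  have h2 := hasSum_sum_of_ne_finset_zero (s := hfin.toFinset) (f := fun i => coeff n (f i))
    (L := .unconditional ι) fun i hi => by
      rw [Set.Finite.mem_toFinset] at hi
      by_cases hp : p i
      · rw [hf i hp, coeff_monomial, if_neg fun h => hi ⟨hp, h.symm⟩]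
      · rw [hf' i hp, map_zero]
  rw [GrassmannianGF.coeffXYQ, h1.unique h2, MvPolynomial.coeff_sum]
  have h3 : ∀ i ∈ hfin.toFinset, MvPolynomial.coeff (Finsupp.single 0 k + Finsupp.single 1 r)
      (coeff n (f i)) = if b i = k ∧ c i = r then 1 else 0 := fun i hi => by
    rw [Set.Finite.mem_toFinset] at hi
    rw [hf i hi.1, coeff_monomial, if_pos hi.2.symm, coeff_monomial_mul_monomial]
  rw [Finset.sum_congr rfl h3, Finset.sum_boole, ← Set.ncard_coe_finset]
  congr 2
  ext i
  simp [and_assoc]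

/-- For `z = 0` the weight of a tree vanishes if it has trees in its gaps. -/
theorem X_mul_rootedWt {R : Type*} [CommRing R] (y q : R) (c : Code .tree)
    [Decidable ((fcons c fnil).Good .generic ∧ c.numRoots = 0)] :
    X * rootedWt y q 0 c = if (fcons c fnil).Good .generic ∧ c.numRoots = 0 then
      monomial (fcons c fnil).numBd (y ^ (fcons c fnil).kStat * q ^ (fcons c fnil).rStat) else 0 := by
  have hgood : (fcons c fnil).Good .generic ↔ (c.IsLollipop ∨ c.Good .generic) :=
    and_iff_left (show fnil.Good .generic from trivial)
  rw [rootedWt, lollipopWt]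
  by_cases h0 : c.IsLollipop
  · have h1 : ¬ c.Good .generic := by
      obtain ⟨h, hle, rfl⟩ := h0
      simp [Good, len]
    rw [if_pos h0, wt_of_not_good _ _ _ h1, mul_zero, zero_add]
    obtain ⟨h, hle, rfl⟩ := h0
    rw [if_pos ⟨hgood.2 (.inl ⟨h, hle, rfl⟩), rfl⟩]
    have h3 : h - 1 = 0 := by omega
    have h4 : mStat (color h 0) 0 = 0 := by
      simp only [color]
      split_ifs <;> rfl
    simp only [X_eq, ← monomial_zero_eq_C_apply, monomial_mul_monomial, numBd, kStat, rStat, rootK,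
      rootR, len, h3, h4, zero_add, add_zero, one_mul, pow_zero, mul_one]
  · rw [if_neg h0, add_zero]
    by_cases h1 : c.Good .generic
    · rw [wt_of_good _ _ _ h1]
      simp only [X_eq, ← monomial_zero_eq_C_apply, monomial_mul_monomial, numBd, kStat, rStat,
        h1.rootK_eq, h1.rootR_eq, add_zero, one_mul]
      split_ifs with h2
      · rw [h2.2, show c.numBd + 1 = 1 + (0 + c.numBd) by omega]
        congr 1
        ring
      · rw [zero_pow fun h => h2 ⟨hgood.2 (.inr h1), h⟩]
        simp
    · rw [wt_of_not_good _ _ _ h1, mul_zero, mul_zero, if_neg]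
      exact fun h => (hgood.1 h.1).elim h0 h1

end Code

/-! ### The generating functions of Grassmannian trees and forests -/

namespace GrassmannianGF

open scoped PowerSeries.WithPiTopology
open PowerSeries Code

variable [UniformSpace CoeffRing] [DiscreteUniformity CoeffRing]

/-- The generating function of planted trees, with a variable `z` that marks the gap trees. -/
abbrev planted (z : CoeffRing) : CoeffRing⟦X⟧ :=
  treeGF (MvPolynomial.X 0) (MvPolynomial.X 1) z .generic

/-- The generating function of forests, with a variable `z` that marks the trees. -/
abbrev forests (z : CoeffRing) : CoeffRing⟦X⟧ :=
  forestGF (MvPolynomial.X 0) (MvPolynomial.X 1) z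

theorem hasSubst_planted (z : CoeffRing) : HasSubst (planted z) :=
  .of_constantCoeff_zero' (constantCoeff_treeGF _ _ _ _)

/-- Substitution of the generating function of planted trees for `x` in the series `C`. -/
theorem subst_planted_serC (z : CoeffRing) : serC.subst (planted z) = x * forests z := by
  have hs := hasSubst_planted z
  have hc : constantCoeff (planted z) = 0 := constantCoeff_treeGF _ _ _ _
  have h := treeGF_eq (MvPolynomial.X 0) (MvPolynomial.X 1) z (P := planted z) rfl
  have h1 := congrArg (substAlgHom hs) serC_mul_denC
  rw [numC, denC] at h1
  have hy : substAlgHom hs y = y := by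
    rw [coe_substAlgHom, y]
    exact subst_C _
  have hq : substAlgHom hs q = q := by
    rw [coe_substAlgHom, q]
    exact subst_C _
  simp only [map_mul, map_add, map_sub, map_pow, map_one, hy, hq, substAlgHom_X] at h1
  have hu : IsUnit ((1 + planted z * q) * (1 + planted z * y * q) * (1 - planted z * q ^ 2) *
      (1 - planted z * y * q ^ 2)) := by
    rw [isUnit_iff_constantCoeff]
    simp [hc]
  rw [← coe_substAlgHom hs]
  exact hu.mul_right_cancel (h1.trans h.symm)

/-- Planted trees without forests in their gaps are counted by the inverse of `C`. -/
theorem planted_zero : planted 0 = serC.substInvOfIsUnit isUnit_coeff_one_serC := by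
  refine eq_substInvOfIsUnit constantCoeff_serC _ (constantCoeff_treeGF _ _ _ _) ?_
  rw [subst_planted_serC, forests, forestGF_eq]
  simp

theorem treeSeries_eq : treeSeries = x * (C (MvPolynomial.X 0 * MvPolynomial.X 1) * planted 0 +
    (1 + y)) := by
  rw [treeSeries, planted_zero, map_mul]
  simp only [y, q]
  ring

theorem constantCoeff_forests (z : CoeffRing) : constantCoeff (forests z) = 1 := by
  rw [forests, forestGF_eq]
  simp

/-- A forest is a sequence of trees with forests in their gaps. -/
theorem subst_treeSeries : treeSeries.subst (x * forests 1) = forests 1 - 1 := by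
  have hs : HasSubst (x * forests 1) := .of_constantCoeff_zero' (by simp)
  have h0 : HasSubst (serC.substInvOfIsUnit isUnit_coeff_one_serC) := HasSubst.substInvOfIsUnit ..
  have h1 : (serC.substInvOfIsUnit isUnit_coeff_one_serC).subst (x * forests 1) = planted 1 := by
    have hC : HasSubst serC := .of_constantCoeff_zero' constantCoeff_serC
    have h := subst_comp_subst_apply hC (hasSubst_planted 1)
      (serC.substInvOfIsUnit isUnit_coeff_one_serC)
    rw [subst_planted_serC, subst_substInvOfIsUnit_left _ constantCoeff_serC] at h
    rw [← h]
    exact subst_X (hasSubst_planted 1)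
  have hy : substAlgHom hs y = y := by
    rw [coe_substAlgHom, y]
    exact subst_C _
  have hq : substAlgHom hs q = q := by
    rw [coe_substAlgHom, q]
    exact subst_C _
  rw [← coe_substAlgHom hs] at h1 ⊢
  rw [treeSeries]
  simp only [map_mul, map_add, map_one, hy, hq, substAlgHom_X, h1]
  conv_rhs => rw [forests, forestGF_eq]
  simp only [map_mul, map_one, y, q]
  ring

theorem x_mul_forests :
    x * forests 1 = forestKernel.substInvOfIsUnit isUnit_coeff_one_forestKernel := by
  have hs : HasSubst (x * forests 1) := .of_constantCoeff_zero' (by simp)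
  refine eq_substInvOfIsUnit constantCoeff_forestKernel _ (by simp) ?_
  have h1 := congrArg (substAlgHom hs) forestKernel_mul
  rw [map_mul, map_add, map_one, coe_substAlgHom, subst_treeSeries, add_sub_cancel, subst_X hs] at h1
  have hu : IsUnit (forests 1) := by
    rw [isUnit_iff_constantCoeff, constantCoeff_forests]
    exact isUnit_one
  exact hu.mul_right_cancel h1

theorem coeff_forests (n : ℕ) : coeff n (forests 1) =
    (1 / ((n : ℚ) + 1)) • coeff n ((1 + treeSeries) ^ (n + 1)) := by
  have h := lagrange (f := x * forests 1) forestKernel_mul constantCoeff_forestKernel (by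
    rw [x_mul_forests]
    exact subst_substInvOfIsUnit_left _ constantCoeff_forestKernel _) n
  rw [coeff_succ_X_mul] at h
  rw [← h, ← nsmul_eq_mul, ← Nat.cast_smul_eq_nsmul ℚ, smul_smul]
  push_cast
  rw [one_div_mul_cancel (by positivity), one_smul]

end GrassmannianGF

namespace GrassmannianForest

open scoped PowerSeries.WithPiTopology
open PowerSeries Code GrassmannianGF

theorem finite_contractedForests (n k r : ℕ) : (contractedForests n k r).Finite := by
  refine Set.Finite.of_finite_image (f := codeClass n) ?_ codeClass_injective.injOn
  rw [image_contractedForests]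
  exact (finite_good n).subset fun c hc => ⟨hc.1, hc.2.1⟩

theorem finite_contractedTrees (n k r : ℕ) : (contractedTrees n k r).Finite := by
  refine (finite_contractedForests n k r).subset ?_
  rintro c ⟨F, h1, -, h2⟩
  exact ⟨F, h1, h2⟩

variable [UniformSpace CoeffRing] [DiscreteUniformity CoeffRing]

theorem ncard_contractedForests (n k r : ℕ) :
    ((contractedForests n k r).ncard : ℚ) = coeffXYQ n k r (forests 1) := by
  rw [← Set.ncard_image_of_injective _ codeClass_injective, image_contractedForests]
  exact ncard_eq_coeffXYQ (hasSum_forestGF _ _ 1) (fun c => c.Good .generic) numBd kStat rStat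
    (fun c hc => by rw [wt_of_good _ _ _ hc, one_pow, one_mul])
    (fun c hc => wt_of_not_good _ _ _ hc) (finite_good n) k r

theorem ncard_contractedTrees (n k r : ℕ) :
    ((contractedTrees n k r).ncard : ℚ) = coeffXYQ n k r treeSeries := by
  classical
  have hinj : Function.Injective fun c : Code .tree => fcons c fnil := by
    intro c c' h
    cases h
    rfl
  have himage : (fun c : Code .tree => fcons c fnil) '' {c | ((fcons c fnil).Good .generic ∧
      c.numRoots = 0) ∧ (fcons c fnil).numBd = n ∧ (fcons c fnil).kStat = k ∧
      (fcons c fnil).rStat = r} =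
      {c | c.Good .generic ∧ c.numBd = n ∧ c.kStat = k ∧ c.rStat = r ∧ c.numRoots = 1} := by
    ext c
    constructor
    · rintro ⟨c, ⟨⟨h1, h2⟩, h3, h4, h5⟩, rfl⟩
      exact ⟨h1, h3, h4, h5, by simp [numRoots, h2]⟩
    · rintro ⟨h1, h2, h3, h4, h5⟩
      cases c with
      | fnil => simp [numRoots] at h5
      | fcons c g =>
        cases g with
        | fnil => exact ⟨c, ⟨⟨h1, by simpa [numRoots] using h5⟩, h2, h3, h4⟩, rfl⟩
        | fcons c' g =>
          simp only [numRoots] at h5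
          omega
  have hS : HasSum (fun c => x * rootedWt (MvPolynomial.X 0) (MvPolynomial.X 1) 0 c) treeSeries := by
    rw [treeSeries_eq]
    exact HasSum.mul_left x (hasSum_rootedWt (MvPolynomial.X 0) (MvPolynomial.X 1) 0)
  have hfin : {c : Code .tree | ((fcons c fnil).Good .generic ∧ c.numRoots = 0) ∧
      (fcons c fnil).numBd = n}.Finite :=
    ((finite_good n).preimage hinj.injOn).subset fun c hc => ⟨hc.1.1, hc.2⟩
  rw [← Set.ncard_image_of_injective _ codeClass_injective, image_contractedTrees, ← himage,
    Set.ncard_image_of_injective _ hinj]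
  refine ncard_eq_coeffXYQ hS
    (fun c => (fcons c fnil).Good .generic ∧ c.numRoots = 0) (fun c => (fcons c fnil).numBd)
    (fun c => (fcons c fnil).kStat) (fun c => (fcons c fnil).rStat) ?_ ?_ hfin k r
  · intro c hc
    rw [X_mul_rootedWt, if_pos hc]
  · intro c hc
    rw [X_mul_rootedWt, if_neg hc]

end GrassmannianForest
end

theorem mainTheorem1 :
    (∀ n k r : ℕ,
      (GrassmannianForest.contractedTrees n k r).Finite ∧
      ((GrassmannianForest.contractedTrees n k r).ncard : ℚ) =
        GrassmannianGF.coeffXYQ n k r GrassmannianGF.treeSeries) ∧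
    (∃ G : PowerSeries GrassmannianGF.CoeffRing,
      GrassmannianGF.x * G =
        GrassmannianGF.forestKernel.substInvOfIsUnit
          GrassmannianGF.isUnit_coeff_one_forestKernel ∧
      ∀ n k r : ℕ,
        (GrassmannianForest.contractedForests n k r).Finite ∧
        ((GrassmannianForest.contractedForests n k r).ncard : ℚ) =
          GrassmannianGF.coeffXYQ n k r G) ∧
    (∀ G : PowerSeries GrassmannianGF.CoeffRing,
      GrassmannianGF.x * G =
        GrassmannianGF.forestKernel.substInvOfIsUnit
          GrassmannianGF.isUnit_coeff_one_forestKernel ↔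
      ∀ n : ℕ, PowerSeries.coeff n G =
        (1 / ((n : ℚ) + 1)) •
          PowerSeries.coeff n ((1 + GrassmannianGF.treeSeries) ^ (n + 1))) := by
  let _ : UniformSpace GrassmannianGF.CoeffRing := ⊥
  refine ⟨fun n k r => ⟨GrassmannianForest.finite_contractedTrees n k r,
    GrassmannianForest.ncard_contractedTrees n k r⟩,
    ⟨GrassmannianGF.forests 1, GrassmannianGF.x_mul_forests, fun n k r =>
      ⟨GrassmannianForest.finite_contractedForests n k r,
        GrassmannianForest.ncard_contractedForests n k r⟩⟩, fun G => ?_⟩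
  simp only [← GrassmannianGF.x_mul_forests, ← GrassmannianGF.coeff_forests]
  rw [mul_right_inj' PowerSeries.X_ne_zero]
  exact PowerSeries.ext_iff
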